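/- **Added mass cannot decrease.** Identify the plane with $\mathbb{C}$. A body is a compact set $B\subset\mathbb{C}$ of positive area $|B|$. **(1) Kinetic energy.** Let $B$ be a connected body and let $D_1,\dots,D_n$ ($n\ge 0$) be pairwise disjoint closed connected sets, disjoint from $B$ (the stationary impenetrable boundary; the $D_i$ may be unbounded). The fluid, of density $\varrho>0$, fills $F=\mathbb{C}\setminus(B\cup D_1\cup\dots\cup D_n)$, and $B$ translates with velocity $V\in\mathbb{C}\setminus\{0\}$. The resulting flow without circulation has a single-valued holomorphic complex potential $W$ on $F$ with velocity $\overline{dW/dz}$, such that: $\operatorname{Im}W$ extends continuously to $\overline F$; for some real constants, $\operatorname{Im}W=\operatorname{Im}(\overline V z)+\mathrm{const}$ on $\partial B$ and $\operatorname{Im}W=\mathrm{const}_i$ on $\partial D_i$; $dW/dz\to0$ at infinity in $F$; and $\int_F|dW/dz|^2<\infty$. Let $T=\frac{\varrho}{2}\int_F|dW/dz|^2$ be the kinetic energy and define the added mass coefficient $C_a$ by $T=\frac{C_a}{2}\,\varrho\,|B|\,|V|^2$. Then for every such flow, and every such flow of the same $B$ and $V$ in the absence of the $D_i$ (that is, with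 $n=0$), with coefficient $C_a^{\mathrm{free}}$, one has $C_a\ge C_a^{\mathrm{free}}$. **(2) Blasius formula.** For $0<\rho<1$ let $z(\zeta)=\sum_{k\in\mathbb{Z}}a_k\zeta^k+\frac{b}{\zeta-c}$, with $\rho<|c|<1$, be injective on the annulus $\rho<|\zeta|<1$ (minus $c$ if $b\ne0$) and continuous up to the boundary circles, the Laurent series being convergent in the open annulus ($b=0$ is the confined case). Let $W$ be holomorphic and single-valued in $\rho<|\zeta|<1$ (including $c$), with $\operatorname{Im}W$ continuous up to the boundary, $\operatorname{Im}W=\operatorname{Im}(\overline V z)+\mathrm{const}$ on $|\zeta|=1$ with $V=\mathrm{i}$, and $\operatorname{Im}W=\mathrm{const}$ on $|\zeta|=\rho$. For a number $A>0$ (the area enclosed by the image of $|\zeta|=1$) put $$C_a=-\frac{2\pi}{A}\operatorname{Im}\Big\{\frac{1}{2\pi\mathrm{i}}\oint_{|\zeta|=1}z(\zeta)\frac{dW}{d\zeta}\,d\zeta\Big\}-1,$$ where the integral is understood as the limit of the integrals over $|\zeta|=r$ as $r\to1^-$. In both (a) and (b) below the limits exist. (a) *Same body with and without the boundary.* Suppose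 that $B$ is a body, that $D$ is a closed set disjoint from $B$, and that $z$ maps the annulus (minus $c$ if $b\neq0$) onto $\mathbb{C}\setminus(B\cup D)$, the circle $|\zeta|=1$ onto $\partial B$ and the circle $|\zeta|=\rho$ onto $\partial D$. Let $z_0(\zeta)=\sum_{k\ge0}a^0_k\zeta^k+\frac{b_0}{\zeta-c_0}$, $|c_0|<1$, be injective on the unit disc minus $c_0$, continuous up to the unit circle, mapping the disc minus $c_0$ onto $\mathbb{C}\setminus B$ and the unit circle onto $\partial B$. Let $W_0$ be holomorphic in the whole disc with $\operatorname{Im}W_0$ continuous on the closed disc and $\operatorname{Im}W_0=\operatorname{Im}(\overline Vz_0)+\mathrm{const}$ on $|\zeta|=1$, $V=\mathrm i$. Then, with $A=|B|$, the coefficient of $(z,W)$ is at least the coefficient of $(z_0,W_0)$. (b) *$C_a(\rho)\ge C_a(0)$ for fixed coefficients of the map.* Let $C_a(\rho)$ be the coefficient of $(z,W)$, and $C_a(0)$ the coefficient of $(z,W_0)$ with the same $z$ and $A$, where $W_0$ is holomorphic in the whole unit disc, $\operatorname{Im}W_0$ is continuous on the closed disc, and $\operatorname{Im}W_0=\operatorname{Im}(\overline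 V z)+\mathrm{const}$ on $|\zeta|=1$, $V=\mathrm i$ (no inner boundary). Then $C_a(\rho)\ge C_a(0)$. -/

import Mathlib

open Set Filter Topology MeasureTheory ComplexConjugate

noncomputable section

/-! ### Flows in the physical plane -/

/-- The region occupied by the fluid: everything outside the body `B` and outside the stationary
obstacles `D i`. -/
def fluidRegion (B : Set ℂ) {n : ℕ} (D : Fin n → Set ℂ) : Set ℂ :=
  (B ∪ ⋃ i, D i)ᶜ

/-- `W` is a complex potential (with velocity field `conj (dW/dz)`) of the irrotational flow without
circulation that is generated when the body `B` translates with velocity `V` among the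
stationary impenetrable obstacles `D i`.  The potential `W` is a single-valued function, which
says that no closed loop carries circulation.  The no-flux conditions are expressed by the stream
function `ψ = Im W`: it is continuous up to the boundary, it agrees with the stream function
`Im (conj V * z)` of the rigid motion on the boundary of `B` up to an additive constant, and it is
constant on the boundary of each obstacle.  The velocity vanishes at infinity (an empty condition
if the fluid region is bounded) and its square is integrable. -/
structure IsPotentialFlow (B : Set ℂ) {n : ℕ} (D : Fin n → Set ℂ) (V : ℂ) (W : ℂ → ℂ) : Prop where
  holomorphic : DifferentiableOn ℂ W (fluidRegion B D)
  no_flux : ∃ ψ : ℂ → ℝ, ContinuousOn ψ (closure (fluidRegion B D)) ∧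
    (∀ z ∈ fluidRegion B D, ψ z = (W z).im) ∧
    (∃ β : ℝ, ∀ z ∈ frontier B, ψ z = (conj V * z).im + β) ∧
    (∀ i, ∃ γ : ℝ, ∀ z ∈ frontier (D i), ψ z = γ)
  velocity_at_infinity :
    Tendsto (deriv W) (cocompact ℂ ⊓ 𝓟 (fluidRegion B D)) (𝓝 0)
  finite_energy : IntegrableOn (fun z => ‖deriv W z‖ ^ 2) (fluidRegion B D)

/-- Kinetic energy `(ϱ / 2) ∫ |velocity|²` of a fluid of density `ϱ`. -/
def kineticEnergy (ϱ : ℝ) (F : Set ℂ) (W : ℂ → ℂ) : ℝ :=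
  ϱ / 2 * ∫ z in F, ‖deriv W z‖ ^ 2

/-- The added mass coefficient `C`, determined by `T = (C / 2) * ϱ * area B * |V|²`, where `T` is
the kinetic energy of the fluid. -/
def addedMassCoeff (ϱ : ℝ) (B : Set ℂ) {n : ℕ} (D : Fin n → Set ℂ) (V : ℂ) (W : ℂ → ℂ) : ℝ :=
  2 * kineticEnergy ϱ (fluidRegion B D) W / (ϱ * volume.real B * ‖V‖ ^ 2)

/-! ### Conformal maps from an annulus, and the Blasius formula -/

/-- The open annulus `ρ < |ζ| < 1` if `ρ > 0`, and the whole open unit disc if `ρ = 0`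
(no inner boundary). -/
def mapDomain (ρ : ℝ) : Set ℂ := {ζ | ‖ζ‖ < 1 ∧ (0 < ρ → ρ < ‖ζ‖)}

/-- The closed annulus `ρ ≤ |ζ| ≤ 1`, which is the closed unit disc if `ρ = 0`. -/
def closedMapDomain (ρ : ℝ) : Set ℂ := {ζ | ‖ζ‖ ≤ 1 ∧ ρ ≤ ‖ζ‖}

/-- `z(ζ) = ∑ₖ aₖ ζᵏ + b / (ζ - c)` is an injective holomorphic map on the annulus `ρ < |ζ| < 1`,
continuous up to the boundary, whose only possible singularity is the simple pole at `c`
(absent if `b = 0`).  For `ρ = 0` the annulus is the disc and there are no negative powers. -/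
structure IsLaurentMap (ρ : ℝ) (a : ℤ → ℂ) (b c : ℂ) (z : ℂ → ℂ) : Prop where
  pole_mem : c ∈ mapDomain ρ
  laurent : ∀ ζ ∈ mapDomain ρ, (b ≠ 0 → ζ ≠ c) →
    HasSum (fun k : ℤ => a k * ζ ^ k) (z ζ - b / (ζ - c))
  no_negative_powers : ρ = 0 → ∀ k < 0, a k = 0
  injOn : InjOn z {ζ ∈ mapDomain ρ | b ≠ 0 → ζ ≠ c}
  continuousOn : ContinuousOn z {ζ ∈ closedMapDomain ρ | b ≠ 0 → ζ ≠ c}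

/-- The map `z` carries the annulus onto the fluid region outside the body `B` and the stationary
obstacle `D`, the circle `|ζ| = 1` onto the boundary of `B`, and the circle `|ζ| = ρ` (if `ρ > 0`)
onto the boundary of `D`. -/
structure MapsOntoFluid (ρ : ℝ) (b c : ℂ) (z : ℂ → ℂ) (B D : Set ℂ) : Prop where
  image_eq : z '' {ζ ∈ mapDomain ρ | b ≠ 0 → ζ ≠ c} = (B ∪ D)ᶜ
  outer_circle : z '' Metric.sphere 0 1 = frontier B
  inner_circle : 0 < ρ → z '' Metric.sphere 0 ρ = frontier D

/-- `W` is the complex potential, as a function of `ζ`, of the flow caused by the velocity `V` of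
the body whose boundary is the image of `|ζ| = 1` under `z`: it is holomorphic and single-valued
in the annulus (also at the pole of `z`, the point at infinity of the fluid), its imaginary part is
continuous up to the boundary, `Im W = Im (conj V * z)` up to a constant on `|ζ| = 1`, and `Im W`
is constant on the stationary boundary `|ζ| = ρ` (no condition if `ρ = 0`). -/
structure IsMappedPotential (ρ : ℝ) (z : ℂ → ℂ) (V : ℂ) (W : ℂ → ℂ) : Prop where
  holomorphic : DifferentiableOn ℂ W (mapDomain ρ)
  no_flux : ∃ ψ : ℂ → ℝ, ContinuousOn ψ (closedMapDomain ρ) ∧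
    (∀ ζ ∈ mapDomain ρ, ψ ζ = (W ζ).im) ∧
    (∃ β : ℝ, ∀ ζ : ℂ, ‖ζ‖ = 1 → ψ ζ = (conj V * z ζ).im + β) ∧
    (0 < ρ → ∃ γ : ℝ, ∀ ζ : ℂ, ‖ζ‖ = ρ → ψ ζ = γ)

/-- `(2πi)⁻¹ ∮ z(ζ) W'(ζ) dζ` over the circle `|ζ| = r`. -/
def blasiusResidue (z W : ℂ → ℂ) (r : ℝ) : ℂ :=
  (2 * Real.pi * Complex.I)⁻¹ * ∮ ζ in C(0, r), z ζ * deriv W ζ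

/-- `Ca` is the added mass coefficient `-(2π / A) Im Res (z W') - 1` which the Blasius formula gives
for the unit velocity `i` and a body of area `A`.  The contour `|ζ| = 1` is approached from inside
the fluid, since `W'` need not extend to it. -/
def HasBlasiusAddedMass (A : ℝ) (z W : ℂ → ℂ) (Ca : ℝ) : Prop :=
  Tendsto (fun r : ℝ => -(2 * Real.pi / A) * (blasiusResidue z W r).im - 1) (𝓝[<] 1) (𝓝 Ca)

end

/-!
All three assertions rest on one minimum principle.  Let the stream function `Im W` of a flow in
`U₀ \ D` have the boundary values `m + const` on the boundary of `U₀`, and be constant on each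
component of the obstacle `D`.  Extended by these constants to `D`, it competes in the Dirichlet
problem solved by the stream function of the flow without the obstacle, whose gradient is orthogonal
to the gradient of the difference of the two; hence the obstacle can only increase the energy
(`energy_le_energy`).

The boundaries are arbitrary, so there is no Green's formula on them.  It is replaced by a
truncation argument: a function `φ` which tends to `0` at the boundary is approximated by the
functions `trunc S k ∘ φ`, which vanish near the boundary, are constant near the level sets of `φ`
to levels in `S`, and can be tested against a divergence-free field
(`integral_fderiv_eq_zero_of_weakDivFree`).  The same device bounds the energy of a flow for which
only the boundary values are known (`integrableOn_sq_of_weakDivFree`), as is the case for the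
potentials in the Blasius formula.  The kinetic energy inequality is the minimum principle in the
complement of the body, with `m` the stream function of the rigid motion, localised near the body.

In the Blasius formula, choose a function `M` which is equal to `z` near the boundary of the body
and vanishes near the obstacle.  The residue of `z W'` on circles close to `|ζ| = 1` is then the
integral of `W' ∂M/∂z̄` over the fluid region, up to a constant factor (`integral_blasius`).  Its
imaginary part is a term which depends on `M` only, minus the energy
(`IsObstacleFlow.integral_im_dbar`), so the minimum principle compares the coefficients.
For fixed coefficients of the map (`blasius_le_of_fixed_coefficients`), this is applied in the disc
`|ζ| < 1`, where the inner circle bounds the obstacle, and `M = κ z` with a radial cutoff `κ`.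
For a fixed body (`blasius_le_of_same_body`), it is applied in the physical plane, where
`M(x) = χ(x) x` is the same for both flows.  The potentials are transplanted by the inverse of the
conformal map; a Laurent map is proper, so the boundary values are transplanted as well
(`IsLaurentMap.tendsto_comp_invFunOn`), although the inverse map need not extend to the boundary.
-/

noncomputable section

/-! ### The divergence theorem for compactly supported fields -/

theorem integral_fderiv_apply_eq_zero {f : ℂ → ℝ} (hf : ContDiff ℝ 1 f)
    (hc : HasCompactSupport f) (v : ℂ) : ∫ z, fderiv ℝ f z v = 0 := by
  obtain ⟨C, hC⟩ := hf.lipschitzWith_of_hasCompactSupport hc one_ne_zero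
  have h1 : LipschitzWith 0 (fun _ : ℂ => (1 : ℝ)) := LipschitzWith.const 1
  have := LipschitzWith.integral_lineDeriv_mul_eq (μ := volume) h1 hC hc (-v)
  simp only [neg_neg, mul_one] at this
  have h2 : ∀ z, lineDeriv ℝ f z v = fderiv ℝ f z v := fun z =>
    ((hf.differentiable one_ne_zero) z).lineDeriv_eq_fderiv
  simp only [h2] at this
  rw [← this]
  simp [lineDeriv]

theorem fderiv_apply_eq {f : ℂ → ℝ} (z v : ℂ) :
    fderiv ℝ f z v = v.re * fderiv ℝ f z 1 + v.im * fderiv ℝ f z Complex.I := by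
  conv_lhs => rw [show v = v.re • (1 : ℂ) + v.im • Complex.I by
    simp [Complex.re_add_im]]
  rw [map_add, map_smul, map_smul, smul_eq_mul, smul_eq_mul]

/-- The divergence `∂ₓ (Re v) + ∂ᵧ (Im v)` of a planar vector field. -/
def divergence (v : ℂ → ℂ) (z : ℂ) : ℝ :=
  (fderiv ℝ v z 1).re + (fderiv ℝ v z Complex.I).im

/-- A vector field is weakly divergence free on `U` if it is orthogonal to the gradients of
the compactly supported test functions on `U`. -/
def WeakDivFree (v : ℂ → ℂ) (U : Set ℂ) : Prop :=
  ∀ φ : ℂ → ℝ, ContDiff ℝ 1 φ → HasCompactSupport φ → tsupport φ ⊆ U →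
    ∫ z in U, fderiv ℝ φ z (v z) = 0

theorem integral_divergence_eq_zero {v : ℂ → ℂ} (hv : ContDiff ℝ 1 v)
    (hc : HasCompactSupport v) : ∫ z, divergence v z = 0 := by
  have hre : ContDiff ℝ 1 fun z => (v z).re := Complex.reCLM.contDiff.comp hv
  have him : ContDiff ℝ 1 fun z => (v z).im := Complex.imCLM.contDiff.comp hv
  have cre : HasCompactSupport fun z => (v z).re := hc.comp_left (g := Complex.re) rfl
  have cim : HasCompactSupport fun z => (v z).im := hc.comp_left (g := Complex.im) rfl
  have hd := hv.differentiable one_ne_zero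
  have e1 : ∀ z, fderiv ℝ (fun z => (v z).re) z 1 = (fderiv ℝ v z 1).re := fun z => by
    have := (Complex.reCLM.hasFDerivAt.comp z (hd z).hasFDerivAt).fderiv
    exact congrArg (fun L => L 1) this
  have e2 : ∀ z, fderiv ℝ (fun z => (v z).im) z Complex.I = (fderiv ℝ v z Complex.I).im :=
    fun z => by
    have := (Complex.imCLM.hasFDerivAt.comp z (hd z).hasFDerivAt).fderiv
    exact congrArg (fun L => L Complex.I) this
  unfold divergence
  simp only [← e1, ← e2]
  rw [integral_add, integral_fderiv_apply_eq_zero hre cre, integral_fderiv_apply_eq_zero him cim,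
    add_zero]
  · exact ((hre.continuous_fderiv
      one_ne_zero).clm_apply continuous_const).integrable_of_hasCompactSupport
      ((cre.fderiv ℝ).comp_left (g := fun L : ℂ →L[ℝ] ℝ => L 1) rfl)
  · exact ((him.continuous_fderiv
      one_ne_zero).clm_apply continuous_const).integrable_of_hasCompactSupport
      ((cim.fderiv ℝ).comp_left (g := fun L : ℂ →L[ℝ] ℝ => L Complex.I) rfl)

theorem divergence_smul {f : ℂ → ℝ} {v : ℂ → ℂ} {z : ℂ} (hf : DifferentiableAt ℝ f z)
    (hv : DifferentiableAt ℝ v z) :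
    divergence (fun z => (f z : ℂ) * v z) z = fderiv ℝ f z (v z) + f z * divergence v z := by
  have h1 : HasFDerivAt (fun z => (f z : ℂ)) (Complex.ofRealCLM.comp (fderiv ℝ f z)) z :=
    Complex.ofRealCLM.hasFDerivAt.comp z hf.hasFDerivAt
  have h2 := (h1.mul hv.hasFDerivAt).fderiv
  rw [divergence]
  erw [h2]
  rw [fderiv_apply_eq z (v z)]
  simp [divergence]
  ring

theorem contDiff_of_tsupport_subset {E : Type*} [NormedAddCommGroup E] [NormedSpace ℝ E]
    {f : ℂ → E} {U K : Set ℂ} {n : ℕ} (hU : IsOpen U) (hf : ContDiffOn ℝ n f U)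
    (hK : IsClosed K) (hKU : K ⊆ U) (h0 : ∀ z ∉ K, f z = 0) : ContDiff ℝ n f := by
  rw [contDiff_iff_contDiffAt]
  intro z
  by_cases hz : z ∈ U
  · exact hf.contDiffAt (hU.mem_nhds hz)
  · have : f =ᶠ[𝓝 z] fun _ => 0 := by
      filter_upwards [hK.isOpen_compl.mem_nhds (fun h => hz (hKU h))] with y hy using h0 y hy
    exact contDiffAt_const.congr_of_eventuallyEq this

/-- If `f v` has compact support in `U` and `v` is divergence free there, then `∇f` and `v` are
orthogonal.  Either factor may provide the compact support `K`. -/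
theorem integral_fderiv_apply_eq_zero_of_divergence {U K : Set ℂ} (hU : IsOpen U)
    (hK : IsCompact K) (hKU : K ⊆ U) {f : ℂ → ℝ} {v : ℂ → ℂ} (hf : ContDiffOn ℝ 1 f U)
    (hv : ContDiffOn ℝ 1 v U) (hdiv : ∀ z ∈ U, divergence v z = 0)
    (h0 : (∀ z ∉ K, f z = 0) ∨ (∀ z ∉ K, v z = 0)) :
    ∫ z in U, fderiv ℝ f z (v z) = 0 := by
  set Y : ℂ → ℂ := fun z => (f z : ℂ) * v z with hY
  have hY0 : ∀ z ∉ K, Y z = 0 := by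
    rcases h0 with h | h <;> intro z hz <;> simp [hY, h z hz]
  have hYU : ContDiffOn ℝ 1 Y U := (Complex.ofRealCLM.contDiff.comp_contDiffOn hf).mul hv
  have hY1 : ContDiff ℝ 1 Y := contDiff_of_tsupport_subset (n := 1) hU hYU hK.isClosed hKU hY0
  have hYc : HasCompactSupport Y := HasCompactSupport.intro hK hY0
  have key := integral_divergence_eq_zero hY1 hYc
  have hout : ∀ z ∉ U, divergence Y z = 0 := by
    intro z hz
    have : Y =ᶠ[𝓝 z] fun _ => 0 := by
      filter_upwards [hK.isClosed.isOpen_compl.mem_nhds (fun h => hz (hKU h))] with y hy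
        using hY0 y hy
    simp [divergence, this.fderiv_eq]
  rw [← setIntegral_eq_integral_of_forall_compl_eq_zero hout] at key
  rw [← key]
  refine setIntegral_congr_fun hU.measurableSet fun z hz => ?_
  have := divergence_smul ((hf.contDiffAt (hU.mem_nhds hz)).differentiableAt one_ne_zero)
    ((hv.contDiffAt (hU.mem_nhds hz)).differentiableAt one_ne_zero)
  simp only [hY]
  rw [this, hdiv z hz]
  simp

theorem WeakDivFree.of_divergence {U : Set ℂ} (hU : IsOpen U) {v : ℂ → ℂ}
    (hv : ContDiffOn ℝ 1 v U) (hdiv : ∀ z ∈ U, divergence v z = 0) : WeakDivFree v U :=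
  fun _ hφ hc hs => integral_fderiv_apply_eq_zero_of_divergence hU hc hs hφ.contDiffOn hv hdiv
    (Or.inl fun _ hz => image_eq_zero_of_notMem_tsupport hz)

/-! ### Velocity fields -/

/-- The gradient `i · conj w'` of the stream function `Im w` of a holomorphic function `w`. -/
def streamGrad (w : ℂ → ℂ) (z : ℂ) : ℂ := Complex.I * conj (deriv w z)

theorem norm_streamGrad (w : ℂ → ℂ) (z : ℂ) : ‖streamGrad w z‖ = ‖deriv w z‖ := by
  simp [streamGrad]

theorem hasFDerivAt_im {w : ℂ → ℂ} {z : ℂ} (hw : DifferentiableAt ℂ w z) :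
    HasFDerivAt (fun z => (w z).im)
      (Complex.imCLM.comp ((ContinuousLinearMap.toSpanSingleton ℂ (deriv w z)).restrictScalars ℝ)) z :=
  Complex.imCLM.hasFDerivAt.comp z (hw.hasDerivAt.hasFDerivAt.restrictScalars ℝ)

theorem fderiv_im_apply {w : ℂ → ℂ} {z : ℂ} (hw : DifferentiableAt ℂ w z) (v : ℂ) :
    fderiv ℝ (fun z => (w z).im) z v = (deriv w z * v).im := by
  rw [(hasFDerivAt_im hw).fderiv]
  simp [mul_comm, -Complex.mul_im]

theorem fderiv_re_apply {w : ℂ → ℂ} {z : ℂ} (hw : DifferentiableAt ℂ w z) (v : ℂ) :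
    fderiv ℝ (fun z => (w z).re) z v = (deriv w z * v).re := by
  have : HasFDerivAt (fun z => (w z).re)
      (Complex.reCLM.comp ((ContinuousLinearMap.toSpanSingleton ℂ (deriv w z)).restrictScalars ℝ)) z :=
    Complex.reCLM.hasFDerivAt.comp z (hw.hasDerivAt.hasFDerivAt.restrictScalars ℝ)
  rw [this.fderiv]
  simp [mul_comm, -Complex.mul_re]

theorem contDiffOn_real {U : Set ℂ} (hU : IsOpen U) {w : ℂ → ℂ} (hw : DifferentiableOn ℂ w U)
    {n : ℕ} : ContDiffOn ℝ n w U :=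
  (hw.contDiffOn hU).restrict_scalars ℝ

theorem contDiffOn_im {U : Set ℂ} (hU : IsOpen U) {w : ℂ → ℂ} (hw : DifferentiableOn ℂ w U)
    {n : ℕ} : ContDiffOn ℝ n (fun z => (w z).im) U :=
  Complex.imCLM.contDiff.comp_contDiffOn (contDiffOn_real hU hw)

theorem contDiffOn_re {U : Set ℂ} (hU : IsOpen U) {w : ℂ → ℂ} (hw : DifferentiableOn ℂ w U)
    {n : ℕ} : ContDiffOn ℝ n (fun z => (w z).re) U :=
  Complex.reCLM.contDiff.comp_contDiffOn (contDiffOn_real hU hw)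

theorem contDiffOn_I_mul_conj {U : Set ℂ} (hU : IsOpen U) {H : ℂ → ℂ}
    (hH : DifferentiableOn ℂ H U) {n : ℕ} : ContDiffOn ℝ n (fun z => Complex.I * conj (H z)) U :=
  contDiffOn_const.mul (Complex.conjCLE.contDiff.comp_contDiffOn (contDiffOn_real hU hH))

theorem divergence_I_mul_conj {U : Set ℂ} (hU : IsOpen U) {H : ℂ → ℂ}
    (hH : DifferentiableOn ℂ H U) :
    ∀ z ∈ U, divergence (fun z => Complex.I * conj (H z)) z = 0 := by
  intro z hz
  have h1 := (hH.differentiableAt (hU.mem_nhds hz)).hasDerivAt.hasFDerivAt.restrictScalars ℝ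
  have h2 := ((Complex.conjCLE : ℂ →L[ℝ] ℂ).hasFDerivAt.comp z h1).const_mul Complex.I
  have h3 : fderiv ℝ (fun z => Complex.I * conj (H z)) z = _ := h2.fderiv
  rw [divergence, h3]
  simp

theorem contDiffOn_streamGrad {U : Set ℂ} (hU : IsOpen U) {w : ℂ → ℂ}
    (hw : DifferentiableOn ℂ w U) {n : ℕ} : ContDiffOn ℝ n (streamGrad w) U :=
  contDiffOn_I_mul_conj hU (hw.deriv hU)

theorem divergence_streamGrad {U : Set ℂ} (hU : IsOpen U) {w : ℂ → ℂ}
    (hw : DifferentiableOn ℂ w U) : ∀ z ∈ U, divergence (streamGrad w) z = 0 :=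
  divergence_I_mul_conj hU (hw.deriv hU)

theorem weakDivFree_streamGrad {U : Set ℂ} (hU : IsOpen U) {w : ℂ → ℂ}
    (hw : DifferentiableOn ℂ w U) : WeakDivFree (streamGrad w) U :=
  WeakDivFree.of_divergence hU (contDiffOn_streamGrad hU hw) (divergence_streamGrad hU hw)

/-- The gradient of `m`, rotated by a right angle. -/
def rotGrad (m : ℂ → ℝ) (z : ℂ) : ℂ :=
  ⟨-fderiv ℝ m z Complex.I, fderiv ℝ m z 1⟩

theorem rotGrad_eq (m : ℂ → ℝ) (z : ℂ) : rotGrad m z =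
    -((fderiv ℝ m z Complex.I : ℝ) : ℂ) + Complex.I * ((fderiv ℝ m z 1 : ℝ) : ℂ) := by
  apply Complex.ext <;> simp [rotGrad]

theorem contDiffOn_rotGrad {U : Set ℂ} (hU : IsOpen U) {m : ℂ → ℝ} (hm : ContDiffOn ℝ 2 m U) :
    ContDiffOn ℝ 1 (rotGrad m) U := by
  have h : ContDiffOn ℝ 1 (fderiv ℝ m) U := hm.fderiv_of_isOpen hU (by norm_num)
  have h1 : ∀ v : ℂ, ContDiffOn ℝ 1 (fun z => ((fderiv ℝ m z v : ℝ) : ℂ)) U := fun v =>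
    Complex.ofRealCLM.contDiff.comp_contDiffOn (h.clm_apply contDiffOn_const)
  have := (h1 Complex.I).neg.add ((contDiffOn_const (c := Complex.I)).mul (h1 1))
  exact this.congr fun z _ => rotGrad_eq m z

theorem divergence_rotGrad {U : Set ℂ} (hU : IsOpen U) {m : ℂ → ℝ} (hm : ContDiffOn ℝ 2 m U) :
    ∀ z ∈ U, divergence (rotGrad m) z = 0 := by
  intro z hz
  have h : ContDiffOn ℝ 1 (fderiv ℝ m) U := hm.fderiv_of_isOpen hU (by norm_num)
  have hd := ((h.contDiffAt (hU.mem_nhds hz)).differentiableAt one_ne_zero).hasFDerivAt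
  have h1 : ∀ v : ℂ, HasFDerivAt (fun z => ((fderiv ℝ m z v : ℝ) : ℂ))
      (Complex.ofRealCLM.comp ((fderiv ℝ (fderiv ℝ m) z).flip v)) z := fun v => by
    have h4 := Complex.ofRealCLM.hasFDerivAt.comp z (hd.clm_apply (hasFDerivAt_const v z))
    refine h4.congr_fderiv ?_
    ext
    simp
  have h2 := (h1 Complex.I).neg.add ((h1 1).const_mul Complex.I)
  have h3 : fderiv ℝ (rotGrad m) z = _ :=
    (h2.congr_of_eventuallyEq (Eventually.of_forall (rotGrad_eq m))).fderiv
  have hsymm := (hm.contDiffAt (hU.mem_nhds hz)).isSymmSndFDerivAt (by simp)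
  rw [divergence, h3]
  have := hsymm 1 Complex.I
  simp
  linarith

theorem weakDivFree_rotGrad {U : Set ℂ} (hU : IsOpen U) {m : ℂ → ℝ} (hm : ContDiffOn ℝ 2 m U) :
    WeakDivFree (rotGrad m) U :=
  WeakDivFree.of_divergence hU (contDiffOn_rotGrad hU hm) (divergence_rotGrad hU hm)

theorem norm_rotGrad_le (m : ℂ → ℝ) (z : ℂ) : ‖rotGrad m z‖ ≤ 2 * ‖fderiv ℝ m z‖ := by
  refine (Complex.norm_le_abs_re_add_abs_im _).trans ?_
  have h1 : |(rotGrad m z).re| ≤ ‖fderiv ℝ m z‖ := by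
    simpa [rotGrad] using (fderiv ℝ m z).le_opNorm Complex.I
  have h2 : |(rotGrad m z).im| ≤ ‖fderiv ℝ m z‖ := by
    simpa [rotGrad] using (fderiv ℝ m z).le_opNorm 1
  linarith

/-- A single-valued potential has no flux: if `χ` is constant near each boundary component of `U`,
the stream function of `w` is orthogonal to `χ`. -/
theorem integral_fderiv_streamGrad_eq_zero {U : Set ℂ} (hU : IsOpen U) {w : ℂ → ℂ}
    (hw : DifferentiableOn ℂ w U) {χ : ℂ → ℝ} (hχ : ContDiff ℝ 2 χ) {K : Set ℂ}
    (hK : IsCompact K) (hKU : K ⊆ U) (h0 : ∀ z ∉ K, fderiv ℝ χ z = 0) :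
    ∫ z in U, fderiv ℝ χ z (streamGrad w z) = 0 := by
  have := integral_fderiv_apply_eq_zero_of_divergence hU hK hKU (contDiffOn_re hU hw (n := 1))
    (contDiffOn_rotGrad hU hχ.contDiffOn) (divergence_rotGrad hU hχ.contDiffOn)
    (Or.inr fun z hz => by apply Complex.ext <;> simp [rotGrad, h0 z hz])
  rw [← neg_eq_zero, ← integral_neg, ← this]
  refine setIntegral_congr_fun hU.measurableSet fun z hz => ?_
  rw [fderiv_re_apply (hw.differentiableAt (hU.mem_nhds hz)), fderiv_apply_eq]
  simp [streamGrad, rotGrad]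
  ring

/-! ### Truncation of test functions -/

/-- A continuous approximation of the indicator function of `Sᶜ` which vanishes near `S` and
outside `[-k, k]`. -/
def truncSlope (S : Set ℝ) (k : ℕ) (s : ℝ) : ℝ :=
  min 1 (max 0 (k * Metric.infDist s S - 1)) * min 1 (max 0 (k - |s|))

/-- The bounded primitive of `truncSlope S k`: an approximation of the identity that is constant
near every point of `S` and near infinity. -/
def trunc (S : Set ℝ) (k : ℕ) (s : ℝ) : ℝ := ∫ t in (0 : ℝ)..s, truncSlope S k t

theorem continuous_truncSlope (S : Set ℝ) (k : ℕ) : Continuous (truncSlope S k) := by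
  unfold truncSlope
  have := Metric.continuous_infDist_pt S
  fun_prop

theorem truncSlope_nonneg (S : Set ℝ) (k : ℕ) (s : ℝ) : 0 ≤ truncSlope S k s :=
  mul_nonneg (le_min zero_le_one (le_max_left _ _)) (le_min zero_le_one (le_max_left _ _))

theorem truncSlope_le_one (S : Set ℝ) (k : ℕ) (s : ℝ) : truncSlope S k s ≤ 1 :=
  mul_le_one₀ (min_le_left _ _) (le_min zero_le_one (le_max_left _ _)) (min_le_left _ _)

theorem truncSlope_of_le {S : Set ℝ} {k : ℕ} {s : ℝ} (h : (k : ℝ) ≤ |s|) :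
    truncSlope S k s = 0 := by
  rw [truncSlope, max_eq_left (sub_nonpos.2 h), min_eq_right zero_le_one, mul_zero]

theorem truncSlope_of_dist {S : Set ℝ} {k : ℕ} {s s₀ : ℝ} (hs : s₀ ∈ S)
    (h : k * dist s s₀ ≤ 1) : truncSlope S k s = 0 := by
  have h1 : k * Metric.infDist s S ≤ 1 :=
    (mul_le_mul_of_nonneg_left (Metric.infDist_le_dist_of_mem hs) k.cast_nonneg).trans h
  rw [truncSlope, max_eq_left (sub_nonpos.2 h1), min_eq_right zero_le_one, zero_mul]

theorem tendsto_truncSlope {S : Set ℝ} (hS : IsClosed S) (hne : S.Nonempty) {s : ℝ} (hs : s ∉ S) :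
    Tendsto (fun k => truncSlope S k s) atTop (𝓝 1) := by
  have hd : 0 < Metric.infDist s S := (hS.notMem_iff_infDist_pos hne).1 hs
  have h1 : ∀ᶠ k : ℕ in atTop, 2 ≤ k * Metric.infDist s S :=
    (tendsto_natCast_atTop_atTop.atTop_mul_const hd).eventually_ge_atTop 2
  have h2 : ∀ᶠ k : ℕ in atTop, |s| + 1 ≤ k := tendsto_natCast_atTop_atTop.eventually_ge_atTop _
  refine tendsto_const_nhds.congr' ?_
  filter_upwards [h1, h2] with k h1 h2
  rw [truncSlope, min_eq_left, min_eq_left, mul_one]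
  · exact le_max_of_le_right (by linarith)
  · exact le_max_of_le_right (by linarith)

theorem hasDerivAt_trunc (S : Set ℝ) (k : ℕ) (s : ℝ) :
    HasDerivAt (trunc S k) (truncSlope S k s) s :=
  (continuous_truncSlope S k).integral_hasStrictDerivAt 0 s |>.hasDerivAt

theorem contDiff_trunc (S : Set ℝ) (k : ℕ) : ContDiff ℝ 1 (trunc S k) := by
  rw [contDiff_one_iff_deriv]
  refine ⟨fun s => (hasDerivAt_trunc S k s).differentiableAt, ?_⟩
  rw [show deriv (trunc S k) = truncSlope S k from funext fun s => (hasDerivAt_trunc S k s).deriv]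
  exact continuous_truncSlope S k

theorem trunc_zero (S : Set ℝ) (k : ℕ) : trunc S k 0 = 0 := by simp [trunc]

theorem trunc_eventuallyEq {S : Set ℝ} (k : ℕ) {s₀ : ℝ} (hs : s₀ ∈ S) :
    trunc S k =ᶠ[𝓝 s₀] fun _ => trunc S k s₀ := by
  have : ∀ᶠ s in 𝓝 s₀, (k : ℝ) * dist s s₀ < 1 := by
    have hc : Continuous fun s => (k : ℝ) * dist s s₀ := by fun_prop
    exact hc.continuousAt.eventually_lt continuousAt_const (by simp)
  filter_upwards [this] with s hs'
  have hi := fun a b => (continuous_truncSlope S k).intervalIntegrable (μ := volume) a b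
  have h0 : ∫ t in s₀..s, truncSlope S k t = 0 := by
    refine (intervalIntegral.integral_congr (g := fun _ => 0) fun t ht => ?_).trans (by simp)
    refine truncSlope_of_dist hs (le_trans ?_ hs'.le)
    refine mul_le_mul_of_nonneg_left ?_ k.cast_nonneg
    rw [Real.dist_eq, Real.dist_eq]
    exact abs_sub_left_of_mem_uIcc ht
  unfold trunc
  rw [← intervalIntegral.integral_add_adjacent_intervals (hi 0 s₀) (hi s₀ s), h0, add_zero]

theorem abs_trunc_le_abs (S : Set ℝ) (k : ℕ) (s : ℝ) : |trunc S k s| ≤ |s| := by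
  have := intervalIntegral.norm_integral_le_of_norm_le_const (a := 0) (b := s) (C := 1)
    (f := truncSlope S k) fun t _ => by
      rw [Real.norm_of_nonneg (truncSlope_nonneg S k t)]; exact truncSlope_le_one S k t
  simpa [trunc] using this

theorem abs_trunc_le (S : Set ℝ) (k : ℕ) (s : ℝ) : |trunc S k s| ≤ k := by
  rcases le_total |s| k with h | h
  · exact (abs_trunc_le_abs S k s).trans h
  have hi := fun a b => (continuous_truncSlope S k).intervalIntegrable (μ := volume) a b
  have hk : (0 : ℝ) ≤ k := k.cast_nonneg
  -- beyond `±k` the slope vanishes, so the value is the one at the end point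
  have main : ∀ c : ℝ, |c| = k → (∀ t ∈ uIcc c s, (k : ℝ) ≤ |t|) → |trunc S k s| ≤ k := by
    intro c hc ht
    have h0 : ∫ t in c..s, truncSlope S k t = 0 :=
      (intervalIntegral.integral_congr (g := fun _ => 0) fun t h =>
        truncSlope_of_le (ht t h)).trans (by simp)
    have : trunc S k s = trunc S k c := by
      unfold trunc
      rw [← intervalIntegral.integral_add_adjacent_intervals (hi 0 c) (hi c s), h0, add_zero]
    rw [this, ← hc]
    exact abs_trunc_le_abs S k c
  rcases le_abs'.1 h with h | h
  · refine main (-k) (by simp) fun t ht => ?_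
    rw [uIcc_of_ge h] at ht
    exact le_abs'.2 (Or.inl ht.2)
  · refine main k (by simp) fun t ht => ?_
    rw [uIcc_of_le h] at ht
    exact le_abs'.2 (Or.inr ht.1)

/-- Testing a divergence free field with the truncation of `φ`, localised by `η`. -/
theorem integral_trunc_eq_zero {U : Set ℂ} (hU : IsOpen U) {v : ℂ → ℂ} (hv : WeakDivFree v U)
    (hvc : ContinuousOn v U) {φ : ℂ → ℝ} {S : Set ℝ} (hS : IsClosed S) (h0 : 0 ∈ S)
    (hφ : ContinuousOn φ U)
    (hφ0 : ∀ p ∈ frontier U, Tendsto φ (𝓝[U] p) (𝓝 0))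
    (hφ1 : ContDiffOn ℝ 1 φ (U ∩ φ ⁻¹' Sᶜ)) {η : ℂ → ℝ} (hη : ContDiff ℝ 1 η)
    (hηc : HasCompactSupport η) (k : ℕ) :
    IntegrableOn (fun z => η z * truncSlope S k (φ z) * fderiv ℝ φ z (v z) +
      trunc S k (φ z) * fderiv ℝ η z (v z)) U ∧
    ∫ z in U, (η z * truncSlope S k (φ z) * fderiv ℝ φ z (v z) +
      trunc S k (φ z) * fderiv ℝ η z (v z)) = 0 := by
  classical
  have hO : IsOpen (U ∩ φ ⁻¹' Sᶜ) := hφ.isOpen_inter_preimage hU hS.isOpen_compl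
  set θ : ℂ → ℝ := fun z => if z ∈ U then trunc S k (φ z) * η z else 0 with hθ
  -- near the boundary `φ` is so small that its truncation vanishes
  have hout : ∀ z ∉ U, θ =ᶠ[𝓝 z] fun _ => 0 := by
    intro z hz
    have h1 : Tendsto φ (𝓝[U] z) (𝓝 0) := by
      by_cases hzc : z ∈ closure U
      · exact hφ0 z ⟨hzc, fun h => hz (interior_subset h)⟩
      · rw [mem_closure_iff_nhdsWithin_neBot, not_neBot] at hzc
        rw [hzc]; exact tendsto_bot
    have h2 := h1.eventually (trunc_eventuallyEq k h0)
    rw [eventually_nhdsWithin_iff] at h2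
    filter_upwards [h2] with y hy
    by_cases hyU : y ∈ U
    · simp [hθ, hyU, hy hyU, trunc_zero]
    · simp [hθ, hyU]
  have hin : ∀ z ∈ U, θ =ᶠ[𝓝 z] fun z => trunc S k (φ z) * η z := fun z hz => by
    filter_upwards [hU.mem_nhds hz] with y hy
    simp [hθ, hy]
  have hinS : ∀ z ∈ U, φ z ∈ S → θ =ᶠ[𝓝 z] fun y => trunc S k (φ z) * η y := fun z hz hzS => by
    have h1 := (hφ.continuousAt (hU.mem_nhds hz)).eventually (trunc_eventuallyEq k hzS)
    filter_upwards [hin z hz, h1] with y hy hy'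
    rw [hy, hy']
  have hφd : ∀ z ∈ U, φ z ∉ S → ContDiffAt ℝ 1 φ z := fun z hz hzS =>
    hφ1.contDiffAt (hO.mem_nhds ⟨hz, hzS⟩)
  have hθ1 : ContDiff ℝ 1 θ := by
    rw [contDiff_iff_contDiffAt]
    intro z
    by_cases hz : z ∈ U
    · by_cases hzS : φ z ∈ S
      · exact (contDiffAt_const.mul hη.contDiffAt).congr_of_eventuallyEq (hinS z hz hzS)
      · exact (((contDiff_trunc S k).contDiffAt.comp z (hφd z hz hzS)).mul
          hη.contDiffAt).congr_of_eventuallyEq (hin z hz)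
    · exact contDiffAt_const.congr_of_eventuallyEq (hout z hz)
  have hθc : HasCompactSupport θ := hηc.mono fun z hz hz' => hz (by
    simp only [hθ]; split_ifs <;> simp [hz'])
  have hθU : tsupport θ ⊆ U := fun z hz => by
    by_contra hzU
    exact (notMem_tsupport_iff_eventuallyEq.2 (hout z hzU)) hz
  have key := hv θ hθ1 hθc hθU
  have heq : ∀ z ∈ U, fderiv ℝ θ z (v z) = η z * truncSlope S k (φ z) * fderiv ℝ φ z (v z) +
      trunc S k (φ z) * fderiv ℝ η z (v z) := by
    intro z hz
    have hηz := (hη.differentiable one_ne_zero) z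
    by_cases hzS : φ z ∈ S
    · rw [(hinS z hz hzS).fderiv_eq, (hηz.hasFDerivAt.const_mul _).fderiv,
        truncSlope_of_dist hzS (by simp)]
      simp
    · have h1 := (hasDerivAt_trunc S k (φ z)).comp_hasFDerivAt z
        ((hφd z hz hzS).differentiableAt one_ne_zero).hasFDerivAt
      have h2 := HasFDerivAt.fderiv (h1.mul hηz.hasFDerivAt)
      rw [(hin z hz).fderiv_eq]
      erw [h2]
      simp
      ring
  refine ⟨?_, ?_⟩
  · refine IntegrableOn.congr_fun (f := fun z => fderiv ℝ θ z (v z)) ?_ heq hU.measurableSet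
    have hsupp : Function.support (fun z => fderiv ℝ θ z (v z)) ⊆ tsupport θ := fun z hz => by
      by_contra hzt
      exact hz (by simp [fderiv_of_notMem_tsupport (𝕜 := ℝ) hzt])
    have hI : IntegrableOn (fun z => fderiv ℝ θ z (v z)) (tsupport θ) :=
      (((hθ1.continuous_fderiv one_ne_zero).continuousOn).clm_apply
        (hvc.mono hθU)).integrableOn_compact hθc
    exact ((integrableOn_iff_integrable_of_support_subset hsupp).1 hI).integrableOn
  · rw [← key]
    exact (setIntegral_congr_fun hU.measurableSet heq).symm

/-! ### Finite energy -/

theorem aestronglyMeasurable_fderiv_apply (φ : ℂ → ℝ) {v : ℂ → ℂ} {μ : Measure ℂ}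
    (hv : AEStronglyMeasurable v μ) : AEStronglyMeasurable (fun z => fderiv ℝ φ z (v z)) μ := by
  simp_rw [fun z => fderiv_apply_eq (f := φ) z (v z)]
  have h1 := (measurable_fderiv_apply_const ℝ φ 1).aestronglyMeasurable (μ := μ)
  have h2 := (measurable_fderiv_apply_const ℝ φ Complex.I).aestronglyMeasurable (μ := μ)
  exact ((Complex.continuous_re.comp_aestronglyMeasurable hv).mul h1).add
    ((Complex.continuous_im.comp_aestronglyMeasurable hv).mul h2)

theorem integrable_fderiv_apply {φ : ℂ → ℝ} {v : ℂ → ℂ} {μ : Measure ℂ}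
    (hv : AEStronglyMeasurable v μ) (hφ2 : Integrable (fun z => ‖fderiv ℝ φ z‖ ^ 2) μ)
    (hv2 : Integrable (fun z => ‖v z‖ ^ 2) μ) :
    Integrable (fun z => fderiv ℝ φ z (v z)) μ := by
  refine (hφ2.add hv2).mono' (aestronglyMeasurable_fderiv_apply φ hv) (Eventually.of_forall ?_)
  intro z
  refine ((fderiv ℝ φ z).le_opNorm (v z)).trans ?_
  simp only [Pi.add_apply]
  nlinarith [sq_nonneg (‖fderiv ℝ φ z‖ - ‖v z‖), sq_nonneg ‖fderiv ℝ φ z‖, sq_nonneg ‖v z‖]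

/-- Cutoff functions which exhaust the plane. -/
theorem exists_cutoff : ∃ (η : ℕ → ℂ → ℝ) (C : ℝ), ∀ n : ℕ, ContDiff ℝ 1 (η n) ∧
    HasCompactSupport (η n) ∧ (∀ z, 0 ≤ η n z ∧ η n z ≤ 1) ∧
    (∀ z, ‖z‖ ≤ n + 1 → η n z = 1) ∧ (∀ z, ‖fderiv ℝ (η n) z‖ ≤ C / (n + 1)) ∧
    (∀ z, ‖z‖ < n + 1 → fderiv ℝ (η n) z = 0) ∧
    (∀ z, 2 * (n + 1) < ‖z‖ → fderiv ℝ (η n) z = 0) := by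
  let b : ContDiffBump (0 : ℂ) := ⟨1, 2, one_pos, one_lt_two⟩
  have hb : ContDiff ℝ 1 b := b.contDiff
  obtain ⟨C, hC⟩ := (b.hasCompactSupport.fderiv ℝ).exists_bound_of_continuous
    (hb.continuous_fderiv one_ne_zero)
  refine ⟨fun n z => b (((n : ℝ) + 1)⁻¹ • z), C, fun n => ?_⟩
  have hn : (0 : ℝ) < n + 1 := by positivity
  have hnorm : ∀ z : ℂ, ‖((n : ℝ) + 1)⁻¹ • z‖ = ‖z‖ / (n + 1) := fun z => by
    rw [norm_smul, norm_inv, Real.norm_of_nonneg hn.le]; field_simp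
  have hone : ∀ z : ℂ, ‖z‖ ≤ n + 1 → b (((n : ℝ) + 1)⁻¹ • z) = 1 := fun z hz => by
    apply b.one_of_mem_closedBall
    rw [mem_closedBall_zero_iff, hnorm]
    exact (div_le_one hn).2 hz
  have hzero : ∀ z : ℂ, 2 * ((n : ℝ) + 1) < ‖z‖ → b (((n : ℝ) + 1)⁻¹ • z) = 0 := fun z hz => by
    apply b.zero_of_le_dist
    rw [dist_zero_right, hnorm]
    exact (le_div_iff₀ hn).2 hz.le
  refine ⟨hb.comp (contDiff_const_smul _), ?_, fun z => ⟨b.nonneg, b.le_one⟩, hone, ?_, ?_, ?_⟩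
  · exact HasCompactSupport.intro (isCompact_closedBall (0 : ℂ) (2 * (n + 1))) fun z hz =>
      hzero z (by simpa using hz)
  · intro z
    have h1 : HasFDerivAt (fun z : ℂ => ((n : ℝ) + 1)⁻¹ • z)
        (((n : ℝ) + 1)⁻¹ • ContinuousLinearMap.id ℝ ℂ) z :=
      HasFDerivAt.const_smul (hasFDerivAt_id (𝕜 := ℝ) z) (((n : ℝ) + 1)⁻¹)
    have h2 := (((hb.differentiable one_ne_zero) (((n : ℝ) + 1)⁻¹ • z)).hasFDerivAt.comp z h1).fderiv
    change fderiv ℝ (fun z => b (((n : ℝ) + 1)⁻¹ • z)) z = _ at h2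
    rw [h2, ContinuousLinearMap.comp_smul, ContinuousLinearMap.comp_id, norm_smul, norm_inv,
      Real.norm_of_nonneg hn.le, div_eq_inv_mul]
    exact mul_le_mul_of_nonneg_left (hC _) (inv_nonneg.2 hn.le)
  · intro z hz
    have : (fun z => b (((n : ℝ) + 1)⁻¹ • z)) =ᶠ[𝓝 z] fun _ => 1 := by
      filter_upwards [continuous_norm.continuousAt.eventually_lt continuousAt_const hz] with y hy
        using hone y hy.le
    rw [this.fderiv_eq]
    simp
  · intro z hz
    have : (fun z => b (((n : ℝ) + 1)⁻¹ • z)) =ᶠ[𝓝 z] fun _ => 0 := by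
      filter_upwards [continuousAt_const.eventually_lt continuous_norm.continuousAt hz] with y hy
        using hzero y hy
    rw [this.fderiv_eq]
    simp

theorem setIntegral_const_indicator_le {U : Set ℂ} {c r : ℝ} (hc : 0 ≤ c) (hr : 0 ≤ r) :
    ∫ z in U, (Metric.closedBall (0 : ℂ) r).indicator (fun _ => c) z ≤ c * (Real.pi * r ^ 2) := by
  have hi : Integrable ((Metric.closedBall (0 : ℂ) r).indicator fun _ => c) :=
    (integrable_indicator_iff measurableSet_closedBall).2
      (integrableOn_const (isCompact_closedBall _ _).measure_ne_top)
  refine (setIntegral_le_integral hi (Eventually.of_forall fun z =>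
    indicator_nonneg (fun _ _ => hc) z)).trans ?_
  rw [integral_indicator_const _ measurableSet_closedBall, smul_eq_mul, mul_comm]
  refine mul_le_mul_of_nonneg_left (le_of_eq ?_) hc
  simp [Measure.real, Complex.volume_closedBall, ENNReal.toReal_mul, ENNReal.toReal_ofReal hr]
  ring

/-- The error made by cutting off a test function tends to zero: the energy of the cutoff is
invariant under scaling of the plane, hence bounded, and it is paired with the tail of the square
integrable field `v`. -/
theorem tendsto_integral_cutoff {U : Set ℂ} {v : ℂ → ℂ}
    (hv2 : IntegrableOn (fun z => ‖v z‖ ^ 2) U) {f : ℂ → ℝ}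
    {k : ℝ} (hf : ∀ z, |f z| ≤ k) {η : ℕ → ℂ → ℝ} {C : ℝ}
    (hC : ∀ n z, ‖fderiv ℝ (η n) z‖ ≤ C / (n + 1))
    (h1 : ∀ (n : ℕ) z, ‖z‖ < n + 1 → fderiv ℝ (η n) z = 0)
    (h2 : ∀ (n : ℕ) z, 2 * ((n : ℝ) + 1) < ‖z‖ → fderiv ℝ (η n) z = 0) :
    Tendsto (fun n => ∫ z in U, f z * fderiv ℝ (η n) z (v z)) atTop (𝓝 0) := by
  have hk : 0 ≤ k := (abs_nonneg _).trans (hf 0)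
  set T : ℕ → Set ℂ := fun n => {z | (n : ℝ) + 1 ≤ ‖z‖} with hT
  have hTm : ∀ n, MeasurableSet (T n) := fun n =>
    (isClosed_le continuous_const continuous_norm).measurableSet
  set t : ℕ → ℝ := fun n => ∫ z in U, (T n).indicator (fun z => ‖v z‖ ^ 2) z with ht
  have ht0 : Tendsto t atTop (𝓝 0) := by
    have := tendsto_integral_of_dominated_convergence (μ := volume.restrict U)
      (F := fun n z => (T n).indicator (fun z => ‖v z‖ ^ 2) z) (f := fun _ => 0)
      (fun z => ‖v z‖ ^ 2) (fun n => hv2.aestronglyMeasurable.indicator (hTm n)) hv2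
      (fun n => Eventually.of_forall fun z => by
        refine (norm_indicator_le_norm_self _ _).trans (by simp))
      (Eventually.of_forall fun z => by
        refine tendsto_const_nhds.congr' ?_
        filter_upwards [tendsto_natCast_atTop_atTop.eventually_ge_atTop ‖z‖] with n hn
        rw [indicator_of_notMem]
        simp only [hT, mem_ofPred_eq, not_le]
        linarith)
    simpa using this
  have main : ∀ δ > 0, ∀ n, ‖∫ z in U, f z * fderiv ℝ (η n) z (v z)‖ ≤
      k * δ * C ^ 2 * (4 * Real.pi) + k * δ⁻¹ * t n := by
    intro δ hδ n
    have hn : (0 : ℝ) < n + 1 := by positivity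
    set c : ℝ := k * δ * (C / (n + 1)) ^ 2
    have hc : 0 ≤ c := by positivity
    have hi1 : Integrable ((Metric.closedBall (0 : ℂ) (2 * (n + 1))).indicator fun _ => c)
        (volume.restrict U) :=
      ((integrable_indicator_iff measurableSet_closedBall).2
        (integrableOn_const (isCompact_closedBall _ _).measure_ne_top)).integrableOn
    have hi2 : Integrable (fun z => k * δ⁻¹ * (T n).indicator (fun z => ‖v z‖ ^ 2) z)
        (volume.restrict U) := (hv2.indicator (hTm n)).const_mul _
    have hb := norm_integral_le_of_norm_le (μ := volume.restrict U)
      (f := fun z => f z * fderiv ℝ (η n) z (v z)) (hi1.add hi2) (Eventually.of_forall fun z => by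
        simp only [Pi.add_apply]
        by_cases hz1 : ‖z‖ < n + 1
        · rw [h1 n z hz1]
          simp only [zero_apply, mul_zero, norm_zero]
          exact add_nonneg (indicator_nonneg (fun _ _ => hc) z)
            (mul_nonneg (by positivity) (indicator_nonneg (fun _ _ => by positivity) z))
        by_cases hz2 : 2 * ((n : ℝ) + 1) < ‖z‖
        · rw [h2 n z hz2]
          simp only [zero_apply, mul_zero, norm_zero]
          exact add_nonneg (indicator_nonneg (fun _ _ => hc) z)
            (mul_nonneg (by positivity) (indicator_nonneg (fun _ _ => by positivity) z))
        rw [indicator_of_mem (by simpa using hz2), indicator_of_mem (by simpa [hT] using hz1),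
          norm_mul, Real.norm_eq_abs]
        have h3 : ‖fderiv ℝ (η n) z (v z)‖ ≤ C / (n + 1) * ‖v z‖ :=
          ((fderiv ℝ (η n) z).le_opNorm _).trans
            (mul_le_mul_of_nonneg_right (hC n z) (norm_nonneg _))
        have h4 : C / (n + 1) * ‖v z‖ ≤ δ * (C / (n + 1)) ^ 2 + δ⁻¹ * ‖v z‖ ^ 2 := by
          set x := C / ((n : ℝ) + 1)
          have : 0 ≤ δ⁻¹ * (δ * x - ‖v z‖) ^ 2 := by positivity
          have e : δ⁻¹ * (δ * x - ‖v z‖) ^ 2 =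
              δ * x ^ 2 + δ⁻¹ * ‖v z‖ ^ 2 - 2 * (x * ‖v z‖) := by
            field_simp; ring
          have : 0 ≤ δ * x ^ 2 + δ⁻¹ * ‖v z‖ ^ 2 := by positivity
          linarith
        calc |f z| * ‖fderiv ℝ (η n) z (v z)‖
            ≤ k * (δ * (C / (n + 1)) ^ 2 + δ⁻¹ * ‖v z‖ ^ 2) :=
              mul_le_mul (hf z) (h3.trans h4) (norm_nonneg _) hk
          _ = c + k * δ⁻¹ * ‖v z‖ ^ 2 := by simp only [c]; ring)
    refine hb.trans ?_
    simp only [Pi.add_apply]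
    rw [integral_add hi1 hi2, integral_const_mul]
    refine add_le_add_left ((setIntegral_const_indicator_le hc (by positivity)).trans
      (le_of_eq ?_)) _
    simp only [c]
    field_simp
    ring
  rw [Metric.tendsto_nhds]
  intro ε hε
  set A := k * C ^ 2 * (4 * Real.pi) with hA
  have hA0 : 0 ≤ A := by positivity
  set δ := ε / (2 * (A + 1)) with hδ
  have hδ0 : 0 < δ := by positivity
  have h3 : Tendsto (fun n => k * δ⁻¹ * t n) atTop (𝓝 0) := by
    simpa using ht0.const_mul (k * δ⁻¹)
  filter_upwards [h3.eventually_lt_const (half_pos hε)] with n hn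
  rw [dist_zero_right]
  refine (main δ hδ0 n).trans_lt ?_
  have : k * δ * C ^ 2 * (4 * Real.pi) ≤ ε / 2 := by
    rw [show k * δ * C ^ 2 * (4 * Real.pi) = A * δ by simp only [hA]; ring, hδ]
    rw [mul_div_assoc', div_le_div_iff₀ (by positivity) (by positivity)]
    nlinarith
  linarith

/-- A square integrable divergence free field on `U` is orthogonal to the gradient of every finite
energy function `φ` which vanishes on the boundary of `U`.  No regularity of the boundary is
needed, and none of `φ` where it takes values in the closed set `S ∋ 0`. -/
theorem integral_fderiv_eq_zero_of_weakDivFree {U : Set ℂ} (hU : IsOpen U) {v : ℂ → ℂ}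
    (hv : WeakDivFree v U) (hvc : ContinuousOn v U) (hv2 : IntegrableOn (fun z => ‖v z‖ ^ 2) U)
    {φ : ℂ → ℝ} {S : Set ℝ} (hS : IsClosed S) (h0 : 0 ∈ S) (hφ : ContinuousOn φ U)
    (hφ0 : ∀ p ∈ frontier U, Tendsto φ (𝓝[U] p) (𝓝 0))
    (hφ1 : ContDiffOn ℝ 1 φ (U ∩ φ ⁻¹' Sᶜ))
    (hφ2 : IntegrableOn (fun z => ‖fderiv ℝ φ z‖ ^ 2) (U ∩ φ ⁻¹' Sᶜ)) :
    ∫ z in U ∩ φ ⁻¹' Sᶜ, fderiv ℝ φ z (v z) = 0 := by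
  obtain ⟨η, C, hη⟩ := exists_cutoff
  set O := U ∩ φ ⁻¹' Sᶜ with hOdef
  have hO : IsOpen O := hφ.isOpen_inter_preimage hU hS.isOpen_compl
  have hOU : O ⊆ U := inter_subset_left
  have hvm : AEStronglyMeasurable v (volume.restrict O) :=
    (hvc.mono hOU).aestronglyMeasurable hO.measurableSet
  have hint : IntegrableOn (fun z => fderiv ℝ φ z (v z)) O :=
    integrable_fderiv_apply hvm hφ2 (hv2.mono_set hOU)
  have hτm : ∀ k, AEStronglyMeasurable (fun z => truncSlope S k (φ z)) (volume.restrict O) :=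
    fun k => ((continuous_truncSlope S k).comp_continuousOn
      (hφ.mono hOU)).aestronglyMeasurable hO.measurableSet
  have hoff : ∀ k, ∀ z ∈ U \ O, truncSlope S k (φ z) = 0 := fun k z hz => by
    have : φ z ∈ S := by
      by_contra h
      exact hz.2 ⟨hz.1, h⟩
    exact truncSlope_of_dist this (by simp)
  have step : ∀ k, ∫ z in O, truncSlope S k (φ z) * fderiv ℝ φ z (v z) = 0 := by
    intro k
    have hbd : ∀ n z, ‖η n z * truncSlope S k (φ z) * fderiv ℝ φ z (v z)‖ ≤
        ‖fderiv ℝ φ z (v z)‖ := fun n z => by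
      rw [norm_mul, norm_mul, Real.norm_of_nonneg ((hη n).2.2.1 z).1,
        Real.norm_of_nonneg (truncSlope_nonneg S k _)]
      exact mul_le_of_le_one_left (norm_nonneg _) (mul_le_one₀ ((hη n).2.2.1 z).2
        (truncSlope_nonneg S k _) (truncSlope_le_one S k _))
    have hm1 : ∀ n, AEStronglyMeasurable
        (fun z => η n z * truncSlope S k (φ z) * fderiv ℝ φ z (v z)) (volume.restrict O) := fun n =>
      ((hη n).1.continuous.aestronglyMeasurable.mul (hτm k)).mul
        (aestronglyMeasurable_fderiv_apply φ hvm)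
    have hF1 : ∀ n, IntegrableOn
        (fun z => η n z * truncSlope S k (φ z) * fderiv ℝ φ z (v z)) O := fun n =>
      hint.norm.mono' (hm1 n) (Eventually.of_forall (hbd n))
    have hlim : Tendsto (fun n => ∫ z in O, η n z * truncSlope S k (φ z) * fderiv ℝ φ z (v z))
        atTop (𝓝 (∫ z in O, truncSlope S k (φ z) * fderiv ℝ φ z (v z))) := by
      refine tendsto_integral_of_dominated_convergence _ hm1 hint.norm
        (fun n => Eventually.of_forall (hbd n)) (Eventually.of_forall fun z => ?_)
      refine tendsto_const_nhds.congr' ?_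
      filter_upwards [tendsto_natCast_atTop_atTop.eventually_ge_atTop ‖z‖] with n hn
      rw [(hη n).2.2.2.1 z (by linarith), one_mul]
    have hzero := tendsto_integral_cutoff hv2 (f := fun z => trunc S k (φ z))
      (fun z => abs_trunc_le S k (φ z)) (fun n => (hη n).2.2.2.2.1) (fun n => (hη n).2.2.2.2.2.1)
      (fun n => (hη n).2.2.2.2.2.2)
    have heq : ∀ n, ∫ z in U, trunc S k (φ z) * fderiv ℝ (η n) z (v z) =
        -∫ z in O, η n z * truncSlope S k (φ z) * fderiv ℝ φ z (v z) := by
      intro n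
      obtain ⟨hI, hE⟩ := integral_trunc_eq_zero hU hv hvc hS h0 hφ hφ0 hφ1 (hη n).1 (hη n).2.1 k
      have hzer : ∀ z ∈ U \ O, η n z * truncSlope S k (φ z) * fderiv ℝ φ z (v z) = 0 :=
        fun z hz => by rw [hoff k z hz]; simp
      have hF1U : IntegrableOn
          (fun z => η n z * truncSlope S k (φ z) * fderiv ℝ φ z (v z)) U :=
        (hF1 n).of_forall_sdiff_eq_zero hU.measurableSet hzer
      have hF2U : IntegrableOn (fun z => trunc S k (φ z) * fderiv ℝ (η n) z (v z)) U := by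
        refine (hI.sub hF1U).congr (Eventually.of_forall fun z => ?_)
        simp
      rw [integral_add hF1U hF2U] at hE
      rw [← setIntegral_eq_of_subset_of_forall_sdiff_eq_zero hU.measurableSet hOU hzer]
      linarith
    simp_rw [heq] at hzero
    have := tendsto_nhds_unique hzero hlim.neg
    linarith
  have hlim : Tendsto (fun k => ∫ z in O, truncSlope S k (φ z) * fderiv ℝ φ z (v z)) atTop
      (𝓝 (∫ z in O, fderiv ℝ φ z (v z))) := by
    refine tendsto_integral_of_dominated_convergence _
      (fun k => (hτm k).mul (aestronglyMeasurable_fderiv_apply φ hvm)) hint.norm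
      (fun k => Eventually.of_forall fun z => ?_) ?_
    · rw [norm_mul, Real.norm_of_nonneg (truncSlope_nonneg S k _)]
      exact mul_le_of_le_one_left (norm_nonneg _) (truncSlope_le_one S k _)
    · filter_upwards [ae_restrict_mem hO.measurableSet] with z hz
      simpa using (tendsto_truncSlope hS ⟨0, h0⟩ hz.2).mul_const (fderiv ℝ φ z (v z))
  simp_rw [step] at hlim
  exact (tendsto_nhds_unique tendsto_const_nhds hlim).symm

/-- The gradient of a function vanishes almost everywhere on its level sets. -/
theorem ae_fderiv_eq_zero_of_eq {U : Set ℂ} (hU : IsOpen U) {φ : ℂ → ℝ}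
    (hφ : ContDiffOn ℝ 1 φ U) (s : ℝ) :
    ∀ᵐ z ∂volume.restrict U, φ z = s → fderiv ℝ φ z = 0 := by
  have hm : MeasurableSet (U ∩ φ ⁻¹' {s}) := by
    obtain ⟨t, ht, h⟩ := (continuousOn_iff_isClosed.1 hφ.continuousOn) {s} isClosed_singleton
    rw [inter_comm, h]
    exact ht.measurableSet.inter hU.measurableSet
  have hd : ∀ z ∈ U, HasFDerivAt (fun z => (φ z : ℂ)) (Complex.ofRealCLM.comp (fderiv ℝ φ z)) z :=
    fun z hz => Complex.ofRealCLM.hasFDerivAt.comp z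
      ((hφ.contDiffAt (hU.mem_nhds hz)).differentiableAt one_ne_zero).hasFDerivAt
  have happ : ApproximatesLinearOn (fun z => (φ z : ℂ)) (0 : ℂ →L[ℝ] ℂ) (U ∩ φ ⁻¹' {s}) 0 := by
    intro x hx y hy
    have h1 : φ x = s := hx.2
    have h2 : φ y = s := hy.2
    simp [h1, h2]
  have := happ.norm_fderiv_sub_le volume hm (fun z => Complex.ofRealCLM.comp (fderiv ℝ φ z))
    (fun z hz => (hd z hz.1).hasFDerivWithinAt)
  rw [ae_restrict_iff' hm] at this
  rw [ae_restrict_iff' hU.measurableSet]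
  filter_upwards [this] with z hz hzU hzs
  have h := hz ⟨hzU, hzs⟩
  simp only [sub_zero, nonpos_iff_eq_zero, nnnorm_eq_zero] at h
  ext v
  have := congrArg (fun L : ℂ →L[ℝ] ℂ => L v) h
  simpa using this

theorem ae_fderiv_eq_zero_of_mem {U : Set ℂ} (hU : IsOpen U) {φ : ℂ → ℝ}
    (hφ : ContDiffOn ℝ 1 φ U) {S : Set ℝ} (hS : S.Countable) :
    ∀ᵐ z ∂volume.restrict U, φ z ∈ S → fderiv ℝ φ z = 0 := by
  have := (ae_ball_iff hS).2 fun s _ => ae_fderiv_eq_zero_of_eq hU hφ s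
  filter_upwards [this] with z hz h using hz _ h rfl

theorem sq_le_two_mul_add {x y d : ℝ} (h : |d| ≤ y * x) :
    x ^ 2 ≤ 2 * (x ^ 2 - d) + y ^ 2 := by
  have := (abs_le.1 h).2
  nlinarith [sq_nonneg (x - y)]

/-- A Caccioppoli estimate: if a divergence free field `v` is, up to a field `∇q` of finite energy,
the gradient of a bounded function which vanishes on the boundary of `U`, then `v` has finite energy
as soon as it has finite energy near infinity. -/
theorem integrableOn_sq_of_weakDivFree {U : Set ℂ} (hU : IsOpen U) {v : ℂ → ℂ}
    (hv : WeakDivFree v U) (hvc : ContinuousOn v U) {φ q : ℂ → ℝ} (hφ : ContDiffOn ℝ 1 φ U)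
    (hφ0 : ∀ p ∈ frontier U, Tendsto φ (𝓝[U] p) (𝓝 0)) {K : ℝ} (hK : ∀ z ∈ U, |φ z| ≤ K)
    (hq : ∀ z ∈ U, fderiv ℝ φ z (v z) = ‖v z‖ ^ 2 - fderiv ℝ q z (v z))
    (hq2 : IntegrableOn (fun z => ‖fderiv ℝ q z‖ ^ 2) U) {R : ℝ}
    (hfar : IntegrableOn (fun z => ‖v z‖ ^ 2) (U ∩ {z | R ≤ ‖z‖})) :
    IntegrableOn (fun z => ‖v z‖ ^ 2) U := by
  obtain ⟨η, C, hη⟩ := exists_cutoff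
  obtain ⟨n, hn⟩ := exists_nat_ge R
  obtain ⟨h1, h2, h3, h4, h5, h6, h7⟩ := hη n
  have hUm := hU.measurableSet
  have hTm : MeasurableSet {z : ℂ | R ≤ ‖z‖} :=
    (isClosed_le continuous_const continuous_norm).measurableSet
  have hvm : AEStronglyMeasurable v (volume.restrict U) := hvc.aestronglyMeasurable hUm
  have hv2m : AEStronglyMeasurable (fun z => ‖v z‖ ^ 2) (volume.restrict U) :=
    hvm.norm.pow 2
  have hφm : AEStronglyMeasurable φ (volume.restrict U) :=
    hφ.continuousOn.aestronglyMeasurable hUm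
  have hτm : ∀ k, AEStronglyMeasurable (fun z => truncSlope {0} k (φ z)) (volume.restrict U) :=
    fun k => (continuous_truncSlope _ k).comp_aestronglyMeasurable hφm
  have htm : ∀ k, AEStronglyMeasurable (fun z => trunc {0} k (φ z)) (volume.restrict U) :=
    fun k => (contDiff_trunc _ k).continuous.comp_aestronglyMeasurable hφm
  have hfar' : IntegrableOn ({z : ℂ | R ≤ ‖z‖}.indicator fun z => ‖v z‖ ^ 2) U := by
    rw [IntegrableOn, integrable_indicator_iff hTm, IntegrableOn, Measure.restrict_restrict hTm,
      inter_comm]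
    exact hfar
  set g : ℂ → ℝ := fun z => K * ((Metric.closedBall (0 : ℂ) (2 * (n + 1))).indicator
    (fun _ => (C / (n + 1)) ^ 2) z + {z : ℂ | R ≤ ‖z‖}.indicator (fun z => ‖v z‖ ^ 2) z) with hg
  have hgi : IntegrableOn g U :=
    ((((integrable_indicator_iff measurableSet_closedBall).2
      (integrableOn_const (isCompact_closedBall _ _).measure_ne_top)).integrableOn).add
        hfar').const_mul K
  have hF2 : ∀ k, ∀ z ∈ U, ‖trunc {0} k (φ z) * fderiv ℝ (η n) z (v z)‖ ≤ g z := by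
    intro k z hz
    have hK0 : 0 ≤ K := (abs_nonneg _).trans (hK z hz)
    have hnn : 0 ≤ g z := mul_nonneg hK0 (add_nonneg
      (indicator_nonneg (fun _ _ => by positivity) z)
      (indicator_nonneg (fun _ _ => by positivity) z))
    by_cases hz1 : ‖z‖ < n + 1
    · rw [h6 z hz1]; simpa using hnn
    by_cases hz2 : 2 * ((n : ℝ) + 1) < ‖z‖
    · rw [h7 z hz2]; simpa using hnn
    have hzR : z ∈ {z : ℂ | R ≤ ‖z‖} := by
      simp only [mem_ofPred_eq]; linarith
    simp only [hg]
    rw [indicator_of_mem (by simpa using hz2), indicator_of_mem hzR, norm_mul, Real.norm_eq_abs]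
    refine mul_le_mul ((abs_trunc_le_abs _ _ _).trans (hK z hz)) ?_ (norm_nonneg _) hK0
    refine ((fderiv ℝ (η n) z).le_opNorm _).trans ?_
    have := mul_le_mul_of_nonneg_right (h5 z) (norm_nonneg (v z))
    nlinarith [sq_nonneg (C / (n + 1) - ‖v z‖), sq_nonneg (C / (n + 1)), sq_nonneg ‖v z‖]
  have hbound : ∀ k, Integrable (fun z => η n z * truncSlope {0} k (φ z) * ‖v z‖ ^ 2)
        (volume.restrict U) ∧
      ∫ z in U, η n z * truncSlope {0} k (φ z) * ‖v z‖ ^ 2 ≤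
        2 * (∫ z in U, g z) + ∫ z in U, ‖fderiv ℝ q z‖ ^ 2 := by
    intro k
    obtain ⟨hI, hE⟩ := integral_trunc_eq_zero hU hv hvc (S := {0}) isClosed_singleton rfl
      hφ.continuousOn hφ0 (hφ.mono inter_subset_left) h1 h2 k
    have hI2 : IntegrableOn (fun z => trunc {0} k (φ z) * fderiv ℝ (η n) z (v z)) U :=
      hgi.mono' ((htm k).mul (aestronglyMeasurable_fderiv_apply _ hvm))
        ((ae_restrict_iff' hUm).2 (Eventually.of_forall (hF2 k)))
    have hI1 : IntegrableOn
        (fun z => η n z * truncSlope {0} k (φ z) * fderiv ℝ φ z (v z)) U := by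
      refine (hI.sub hI2).congr (Eventually.of_forall fun z => ?_)
      simp
    have hpt : ∀ z ∈ U, η n z * truncSlope {0} k (φ z) * ‖v z‖ ^ 2 ≤
        2 * (η n z * truncSlope {0} k (φ z) * fderiv ℝ φ z (v z)) + ‖fderiv ℝ q z‖ ^ 2 := by
      intro z hz
      rw [hq z hz]
      have hc0 : 0 ≤ η n z * truncSlope {0} k (φ z) :=
        mul_nonneg (h3 z).1 (truncSlope_nonneg _ _ _)
      have hc1 : η n z * truncSlope {0} k (φ z) ≤ 1 :=
        mul_le_one₀ (h3 z).2 (truncSlope_nonneg _ _ _) (truncSlope_le_one _ _ _)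
      have := sq_le_two_mul_add ((fderiv ℝ q z).le_opNorm (v z))
      have h8 := mul_le_mul_of_nonneg_left this hc0
      have h9 := mul_le_mul_of_nonneg_right hc1 (sq_nonneg ‖fderiv ℝ q z‖)
      nlinarith
    have hP : Integrable (fun z => η n z * truncSlope {0} k (φ z) * ‖v z‖ ^ 2)
        (volume.restrict U) := by
      refine ((hI1.const_mul 2).add hq2).mono'
        ((h1.continuous.aestronglyMeasurable.mul (hτm k)).mul hv2m)
        ((ae_restrict_iff' hUm).2 (Eventually.of_forall fun z hz => ?_))
      rw [Real.norm_of_nonneg (mul_nonneg (mul_nonneg (h3 z).1 (truncSlope_nonneg _ _ _))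
        (sq_nonneg _))]
      exact hpt z hz
    refine ⟨hP, ?_⟩
    have := setIntegral_mono_on hP ((hI1.const_mul 2).add hq2) hUm hpt
    simp only [Pi.add_apply] at this
    rw [integral_add (hI1.const_mul 2) hq2, integral_const_mul] at this
    rw [integral_add hI1 hI2] at hE
    have h10 : -∫ z in U, g z ≤ ∫ z in U, trunc {0} k (φ z) * fderiv ℝ (η n) z (v z) := by
      rw [← integral_neg]
      exact setIntegral_mono_on hgi.neg hI2 hUm fun z hz => (abs_le.1 (hF2 k z hz)).1
    linarith
  set C₁ := 2 * (∫ z in U, g z) + ∫ z in U, ‖fderiv ℝ q z‖ ^ 2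
  set f : ℂ → ℝ := fun z => η n z * (if φ z = 0 then 0 else 1) * ‖v z‖ ^ 2 with hf
  have hlim : ∀ z, Tendsto (fun k => η n z * truncSlope {0} k (φ z) * ‖v z‖ ^ 2) atTop
      (𝓝 (f z)) := by
    intro z
    refine (Tendsto.const_mul _ ?_).mul_const _
    split_ifs with h
    · refine tendsto_const_nhds.congr fun k => ?_
      rw [truncSlope_of_dist (mem_singleton (0 : ℝ)) (by simp [h])]
    · exact tendsto_truncSlope isClosed_singleton (singleton_nonempty _) h
  have hfi : Integrable f (volume.restrict U) := by
    refine ⟨aestronglyMeasurable_of_tendsto_ae atTop (fun k => (hbound k).1.aestronglyMeasurable)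
      (Eventually.of_forall hlim), ?_⟩
    have hle : ∫⁻ z in U, ‖f z‖ₑ ≤ ENNReal.ofReal C₁ := by
      have e : ∀ z, ‖f z‖ₑ = liminf (fun k => ‖η n z * truncSlope {0} k (φ z) * ‖v z‖ ^ 2‖ₑ)
          atTop := fun z =>
        (((continuous_enorm.tendsto _).comp (hlim z)).liminf_eq).symm
      simp_rw [e]
      refine (lintegral_liminf_le' fun k => (hbound k).1.aestronglyMeasurable.enorm).trans ?_
      refine liminf_le_of_le (by isBoundedDefault) fun b hb => ?_
      obtain ⟨k, hk⟩ := hb.exists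
      refine hk.trans ?_
      rw [← ofReal_integral_norm_eq_lintegral_enorm (hbound k).1]
      refine ENNReal.ofReal_le_ofReal (le_of_eq_of_le ?_ (hbound k).2)
      refine integral_congr_ae (Eventually.of_forall fun z => ?_)
      exact Real.norm_of_nonneg (mul_nonneg (mul_nonneg (h3 z).1 (truncSlope_nonneg _ _ _))
        (sq_nonneg _))
    exact hle.trans_lt ENNReal.ofReal_lt_top
  refine ((hfi.add hfar').add hq2).mono' hv2m ?_
  filter_upwards [ae_restrict_mem hUm, ae_fderiv_eq_zero_of_eq hU hφ 0] with z hz hz0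
  rw [Real.norm_of_nonneg (sq_nonneg _)]
  simp only [Pi.add_apply]
  have hf0 : 0 ≤ f z := by
    simp only [hf]
    refine mul_nonneg (mul_nonneg (h3 z).1 ?_) (sq_nonneg _)
    split_ifs <;> norm_num
  have hi0 : 0 ≤ {z : ℂ | R ≤ ‖z‖}.indicator (fun z => ‖v z‖ ^ 2) z :=
    indicator_nonneg (fun _ _ => by positivity) z
  by_cases hφz : φ z = 0
  · -- on the zero set of `φ` the fields `v` and `∇q` agree almost everywhere
    have h8 := hq z hz
    rw [hz0 hφz, zero_apply] at h8
    have h9 := (le_abs_self _).trans ((fderiv ℝ q z).le_opNorm (v z))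
    nlinarith [sq_nonneg (‖v z‖ - ‖fderiv ℝ q z‖), norm_nonneg (v z)]
  · by_cases hzR : R ≤ ‖z‖
    · rw [indicator_of_mem (show z ∈ {z : ℂ | R ≤ ‖z‖} from hzR)]
      have := sq_nonneg ‖fderiv ℝ q z‖
      linarith
    · have : f z = ‖v z‖ ^ 2 := by
        simp only [hf]
        rw [h4 z (by linarith), if_neg hφz]
        ring
      have := sq_nonneg ‖fderiv ℝ q z‖
      linarith

/-! ### Comparison of flows with and without an obstacle -/

theorem fderiv_im_streamGrad {w w' : ℂ → ℂ} {z : ℂ} (hw : DifferentiableAt ℂ w z) :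
    fderiv ℝ (fun z => (w z).im) z (streamGrad w' z) = (deriv w z * conj (deriv w' z)).re := by
  rw [fderiv_im_apply hw, streamGrad]
  simp

theorem fderiv_im_streamGrad_self {w : ℂ → ℂ} {z : ℂ} (hw : DifferentiableAt ℂ w z) :
    fderiv ℝ (fun z => (w z).im) z (streamGrad w z) = ‖deriv w z‖ ^ 2 := by
  rw [fderiv_im_streamGrad hw, Complex.mul_conj, Complex.ofReal_re, Complex.normSq_eq_norm_sq]

theorem norm_fderiv_im_le {w : ℂ → ℂ} {z : ℂ} (hw : DifferentiableAt ℂ w z) :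
    ‖fderiv ℝ (fun z => (w z).im) z‖ ≤ ‖deriv w z‖ := by
  refine ContinuousLinearMap.opNorm_le_bound _ (norm_nonneg _) fun v => ?_
  rw [fderiv_im_apply hw, Real.norm_eq_abs, ← norm_mul]
  exact Complex.abs_im_le_norm _

theorem integrableOn_norm_fderiv_im_sq {U : Set ℂ} (hU : IsOpen U) {w : ℂ → ℂ}
    (hw : DifferentiableOn ℂ w U) (hE : IntegrableOn (fun z => ‖deriv w z‖ ^ 2) U) :
    IntegrableOn (fun z => ‖fderiv ℝ (fun z => (w z).im) z‖ ^ 2) U := by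
  refine hE.mono' ((measurable_fderiv ℝ _).norm.pow_const 2).aestronglyMeasurable ?_
  filter_upwards [ae_restrict_mem hU.measurableSet] with z hz
  rw [Real.norm_of_nonneg (sq_nonneg _)]
  exact pow_le_pow_left₀ (norm_nonneg _)
    (norm_fderiv_im_le (hw.differentiableAt (hU.mem_nhds hz))) 2

theorem integrableOn_norm_fderiv_sub_sq {U : Set ℂ} (hU : IsOpen U) {f g : ℂ → ℝ}
    (hf : ContDiffOn ℝ 1 f U) (hg : ContDiffOn ℝ 1 g U)
    (hf2 : IntegrableOn (fun z => ‖fderiv ℝ f z‖ ^ 2) U)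
    (hg2 : IntegrableOn (fun z => ‖fderiv ℝ g z‖ ^ 2) U) :
    IntegrableOn (fun z => ‖fderiv ℝ (fun z => f z - g z) z‖ ^ 2) U := by
  refine ((hf2.add hg2).const_mul 2).mono'
    ((measurable_fderiv ℝ _).norm.pow_const 2).aestronglyMeasurable ?_
  filter_upwards [ae_restrict_mem hU.measurableSet] with z hz
  rw [Real.norm_of_nonneg (sq_nonneg _), fderiv_fun_sub
    ((hf.contDiffAt (hU.mem_nhds hz)).differentiableAt one_ne_zero)
    ((hg.contDiffAt (hU.mem_nhds hz)).differentiableAt one_ne_zero)]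
  have h1 := norm_sub_le (fderiv ℝ f z) (fderiv ℝ g z)
  have h2 := pow_le_pow_left₀ (norm_nonneg _) h1 2
  simp only [Pi.add_apply]
  nlinarith [sq_nonneg (‖fderiv ℝ f z‖ - ‖fderiv ℝ g z‖)]

/-- Green's formula.  The stream function `Im w` of a flow in `U₀ \ D` which equals `m + β` on the
boundary of `U₀` and a locally constant function `d` on `D` is indistinguishable from `m` when
paired with a divergence free field on the whole of `U₀`: the difference `Im w - m - β`, extended
by constants to the obstacles, vanishes on the boundary of `U₀`. -/
theorem integral_fderiv_im_eq {U₀ D : Set ℂ} (hU₀ : IsOpen U₀) (hD : IsClosed D) (hDU : D ⊆ U₀)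
    {w : ℂ → ℂ} (hw : DifferentiableOn ℂ w (U₀ \ D)) {m : ℂ → ℝ} (hm : ContDiffOn ℝ 1 m U₀)
    (hm2 : IntegrableOn (fun z => ‖fderiv ℝ m z‖ ^ 2) U₀) (hmD : ∀ z ∈ D, m =ᶠ[𝓝 z] fun _ => 0)
    {β : ℝ} (hβ : ∀ p ∈ frontier U₀, Tendsto (fun z => (w z).im - m z) (𝓝[U₀ \ D] p) (𝓝 β))
    {d : ℂ → ℝ} {S : Set ℝ} (hS : S.Finite) (hdS : ∀ z ∈ D, d z ∈ S) (hdc : ContinuousOn d D)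
    (hd : ∀ p ∈ D, Tendsto (fun z => (w z).im) (𝓝[U₀ \ D] p) (𝓝 (d p)))
    (hE : IntegrableOn (fun z => ‖deriv w z‖ ^ 2) (U₀ \ D)) {v : ℂ → ℂ} (hv : WeakDivFree v U₀)
    (hvc : ContinuousOn v U₀) (hv2 : IntegrableOn (fun z => ‖v z‖ ^ 2) U₀) :
    ∫ z in U₀ \ D, fderiv ℝ (fun z => (w z).im) z (v z) = ∫ z in U₀, fderiv ℝ m z (v z) := by
  classical
  set U := U₀ \ D with hUdef
  have hU : IsOpen U := hU₀.sdiff hD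
  have hUU₀ : U ⊆ U₀ := sdiff_subset
  have hwim : ContDiffOn ℝ 1 (fun z => (w z).im) U := contDiffOn_im hU hw (n := 1)
  set φ : ℂ → ℝ := fun z => if z ∈ D then d z - β else (w z).im - m z - β with hφdef
  set T : Set ℝ := insert 0 ((fun s => s - β) '' S)
  have hTf : T.Finite := (hS.image _).insert 0
  have hφD : ∀ z ∈ D, φ z = d z - β := fun z hz => if_pos hz
  have hφU : ∀ z ∈ U, φ z = (w z).im - m z - β := fun z hz => if_neg hz.2
  have hφT : ∀ z ∈ D, φ z ∈ T := fun z hz => by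
    rw [hφD z hz]; exact Or.inr ⟨d z, hdS z hz, rfl⟩
  have hφ1U : ContDiffOn ℝ 1 φ U :=
    ((hwim.sub (hm.mono hUU₀)).sub contDiffOn_const).congr hφU
  have hφc : ContinuousOn φ U₀ := by
    intro z hz
    by_cases hzD : z ∈ D
    · have hu : U₀ = D ∪ U := (union_sdiff_cancel hDU).symm
      have h1 : ContinuousWithinAt φ D z :=
        ((hdc z hzD).sub continuousWithinAt_const).congr hφD (hφD z hzD)
      have h2 : ContinuousWithinAt φ U z := by
        have h3 : Tendsto (fun y => (w y).im - β) (𝓝[U] z) (𝓝 (φ z)) := by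
          rw [hφD z hzD]; exact (hd z hzD).sub_const β
        refine h3.congr' ?_
        filter_upwards [self_mem_nhdsWithin, mem_nhdsWithin_of_mem_nhds (hmD z hzD)] with y hy hy'
        rw [hφU y hy, hy', sub_zero]
      rw [hu]
      exact h1.union h2
    · exact ((hφ1U.continuousOn).continuousAt (hU.mem_nhds ⟨hz, hzD⟩)).continuousWithinAt
  have hφ0 : ∀ p ∈ frontier U₀, Tendsto φ (𝓝[U₀] p) (𝓝 0) := by
    intro p hp
    have hpD : p ∉ D := fun h => (hU₀.frontier_eq ▸ hp).2 (hDU h)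
    have hn : 𝓝[U₀] p = 𝓝[U] p := by
      rw [hUdef, sdiff_eq]
      exact (nhdsWithin_inter_of_mem' (mem_nhdsWithin_of_mem_nhds
        (hD.isOpen_compl.mem_nhds hpD))).symm
    rw [hn]
    have h3 : Tendsto (fun z => (w z).im - m z - β) (𝓝[U] p) (𝓝 0) := by
      simpa using (hβ p hp).sub_const β
    refine h3.congr' ?_
    filter_upwards [self_mem_nhdsWithin] with y hy
    rw [hφU y hy]
  set O := U₀ ∩ φ ⁻¹' Tᶜ
  have hO : IsOpen O := hφc.isOpen_inter_preimage hU₀ hTf.isClosed.isOpen_compl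
  have hOU : O ⊆ U := fun z hz => ⟨hz.1, fun h => hz.2 (hφT z h)⟩
  have hfd : ∀ z ∈ U, fderiv ℝ φ z = fderiv ℝ (fun z => (w z).im - m z) z := fun z hz => by
    have : φ =ᶠ[𝓝 z] fun z => (w z).im - m z - β := by
      filter_upwards [hU.mem_nhds hz] with y hy using hφU y hy
    rw [this.fderiv_eq, fderiv_sub_const]
  have hfd' : ∀ z ∈ U, fderiv ℝ φ z = fderiv ℝ (fun z => (w z).im) z - fderiv ℝ m z :=
    fun z hz => by
    rw [hfd z hz, fderiv_fun_sub ((hwim.contDiffAt (hU.mem_nhds hz)).differentiableAt one_ne_zero)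
      ((hm.contDiffAt (hU₀.mem_nhds hz.1)).differentiableAt one_ne_zero)]
  have hw2 := integrableOn_norm_fderiv_im_sq hU hw hE
  have hφ2 : IntegrableOn (fun z => ‖fderiv ℝ φ z‖ ^ 2) U :=
    (integrableOn_norm_fderiv_sub_sq hU hwim (hm.mono hUU₀) hw2 (hm2.mono_set hUU₀)).congr_fun
      (fun z hz => by simp only [hfd z hz]) hU.measurableSet
  have key := integral_fderiv_eq_zero_of_weakDivFree hU₀ hv hvc hv2 hTf.isClosed
    (mem_insert 0 _) hφc hφ0 (hφ1U.mono hOU) (hφ2.mono_set hOU)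
  -- off the exceptional values the gradient of `φ` vanishes almost everywhere
  have key2 : ∫ z in U, fderiv ℝ φ z (v z) = 0 := by
    rw [← key]
    refine setIntegral_eq_of_subset_of_ae_sdiff_eq_zero hU.measurableSet.nullMeasurableSet hOU ?_
    have := ae_fderiv_eq_zero_of_mem hU hφ1U hTf.countable
    rw [ae_restrict_iff' hU.measurableSet] at this
    filter_upwards [this] with z hz hzO
    have : φ z ∈ T := by
      by_contra h
      exact hzO.2 ⟨hzO.1.1, h⟩
    rw [hz hzO.1 this, zero_apply]
  have hvU : AEStronglyMeasurable v (volume.restrict U) :=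
    (hvc.mono hUU₀).aestronglyMeasurable hU.measurableSet
  have hi1 : IntegrableOn (fun z => fderiv ℝ (fun z => (w z).im) z (v z)) U :=
    integrable_fderiv_apply hvU hw2 (hv2.mono_set hUU₀)
  have hi2 : IntegrableOn (fun z => fderiv ℝ m z (v z)) U :=
    integrable_fderiv_apply hvU (hm2.mono_set hUU₀) (hv2.mono_set hUU₀)
  have e : ∫ z in U, fderiv ℝ φ z (v z) =
      ∫ z in U, (fderiv ℝ (fun z => (w z).im) z (v z) - fderiv ℝ m z (v z)) :=
    setIntegral_congr_fun hU.measurableSet fun z hz => by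
      rw [hfd' z hz, sub_apply]
  rw [e, integral_sub hi1 hi2] at key2
  rw [sub_eq_zero.1 key2]
  refine (setIntegral_eq_of_subset_of_forall_sdiff_eq_zero hU₀.measurableSet hUU₀
    fun z hz => ?_).symm
  have hzD : z ∈ D := by
    by_contra h
    exact hz.2 ⟨hz.1, h⟩
  rw [(hmD z hzD).fderiv_eq]
  simp

/-- The energy of a flow is the pairing of its boundary data `q` with the flow. -/
theorem integral_energy_eq {U : Set ℂ} (hU : IsOpen U) {w : ℂ → ℂ}
    (hw : DifferentiableOn ℂ w U) {q : ℂ → ℝ} (hq : ContDiffOn ℝ 1 q U)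
    (hq2 : IntegrableOn (fun z => ‖fderiv ℝ q z‖ ^ 2) U) {β : ℝ}
    (hβ : ∀ p ∈ frontier U, Tendsto (fun z => (w z).im - q z) (𝓝[U] p) (𝓝 β))
    (hE : IntegrableOn (fun z => ‖deriv w z‖ ^ 2) U) :
    ∫ z in U, ‖deriv w z‖ ^ 2 = ∫ z in U, fderiv ℝ q z (streamGrad w z) := by
  have h := integral_fderiv_im_eq hU isClosed_empty (empty_subset U) (w := w) (by simpa using hw)
    hq hq2 (by simp) (β := β) (by simpa using hβ) (d := fun _ => 0) (S := ∅) finite_empty (by simp)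
    (by simp) (by simp) (by simpa using hE) (weakDivFree_streamGrad hU hw)
    ((contDiffOn_streamGrad hU hw (n := 0)).continuousOn) (by simpa [norm_streamGrad] using hE)
  simp only [sdiff_empty] at h
  rw [← h]
  exact setIntegral_congr_fun hU.measurableSet fun z hz =>
    (fderiv_im_streamGrad_self (hw.differentiableAt (hU.mem_nhds hz))).symm

/-- Stationary obstacles cannot decrease the energy: extended by constants to the obstacles, the
stream function with obstacles competes with the harmonic one in Dirichlet's principle. -/
theorem energy_le_energy {U₀ D : Set ℂ} (hU₀ : IsOpen U₀) (hD : IsClosed D) (hDU : D ⊆ U₀)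
    {w w₀ : ℂ → ℂ} (hw : DifferentiableOn ℂ w (U₀ \ D)) (hw₀ : DifferentiableOn ℂ w₀ U₀)
    {m : ℂ → ℝ} (hm : ContDiffOn ℝ 1 m U₀)
    (hm2 : IntegrableOn (fun z => ‖fderiv ℝ m z‖ ^ 2) U₀) (hmD : ∀ z ∈ D, m =ᶠ[𝓝 z] fun _ => 0)
    {β : ℝ} (hβ : ∀ p ∈ frontier U₀, Tendsto (fun z => (w z).im - m z) (𝓝[U₀ \ D] p) (𝓝 β))
    {β₀ : ℝ} (hβ₀ : ∀ p ∈ frontier U₀, Tendsto (fun z => (w₀ z).im - m z) (𝓝[U₀] p) (𝓝 β₀))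
    {d : ℂ → ℝ} {S : Set ℝ} (hS : S.Finite) (hdS : ∀ z ∈ D, d z ∈ S) (hdc : ContinuousOn d D)
    (hd : ∀ p ∈ D, Tendsto (fun z => (w z).im) (𝓝[U₀ \ D] p) (𝓝 (d p)))
    (hE : IntegrableOn (fun z => ‖deriv w z‖ ^ 2) (U₀ \ D))
    (hE₀ : IntegrableOn (fun z => ‖deriv w₀ z‖ ^ 2) U₀) :
    ∫ z in U₀, ‖deriv w₀ z‖ ^ 2 ≤ ∫ z in U₀ \ D, ‖deriv w z‖ ^ 2 := by
  have hU : IsOpen (U₀ \ D) := hU₀.sdiff hD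
  have hUU₀ : U₀ \ D ⊆ U₀ := sdiff_subset
  have h1 := integral_energy_eq hU₀ hw₀ hm hm2 hβ₀ hE₀
  have hc := (contDiffOn_streamGrad hU₀ hw₀ (n := 0)).continuousOn
  have h2 := integral_fderiv_im_eq hU₀ hD hDU hw hm hm2 hmD hβ hS hdS hdc hd hE
    (weakDivFree_streamGrad hU₀ hw₀) hc (by simpa [norm_streamGrad] using hE₀)
  have hi : IntegrableOn (fun z => fderiv ℝ (fun z => (w z).im) z (streamGrad w₀ z)) (U₀ \ D) :=
    integrable_fderiv_apply ((hc.mono hUU₀).aestronglyMeasurable hU.measurableSet)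
      (integrableOn_norm_fderiv_im_sq hU hw hE)
      (by simp only [norm_streamGrad]; exact hE₀.mono_set hUU₀)
  have hE₀U := hE₀.mono_set hUU₀
  have h3 := setIntegral_mono_on (hi.const_mul 2) (hE.add hE₀U) hU.measurableSet fun z hz => by
    rw [fderiv_im_streamGrad (hw.differentiableAt (hU.mem_nhds hz))]
    have h4 := Complex.re_le_norm (deriv w z * conj (deriv w₀ z))
    rw [norm_mul, Complex.norm_conj] at h4
    simp only [Pi.add_apply]
    nlinarith [sq_nonneg (‖deriv w z‖ - ‖deriv w₀ z‖)]
  have h5 := setIntegral_mono_set hE₀ (Eventually.of_forall fun z => by positivity)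
    (LE.le.eventuallyLE hUU₀)
  rw [integral_const_mul] at h3
  simp only [Pi.add_apply] at h3
  rw [integral_add hE hE₀U, h2, ← h1] at h3
  linarith

/-- A cutoff function which separates the boundary of `U₀` (value `1`) from `D` (value `0`). -/
structure IsCutoff (U₀ D : Set ℂ) (χ : ℂ → ℝ) : Prop where
  contDiff : ContDiff ℝ 2 χ
  bounded : ∃ C, ∀ z, |χ z| ≤ C
  compact : ∃ K : Set ℂ, IsCompact K ∧ K ⊆ U₀ \ D ∧ ∀ z ∉ K, fderiv ℝ χ z = 0
  outer : ∀ p ∈ frontier U₀, χ =ᶠ[𝓝 p] fun _ => 1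
  inner : ∀ p ∈ D, χ =ᶠ[𝓝 p] fun _ => 0

/-- Boundary data in `U₀` of finite energy, localised away from `D`. -/
structure IsBoundaryData (U₀ D : Set ℂ) (m : ℂ → ℝ) : Prop where
  contDiffOn : ContDiffOn ℝ 1 m U₀
  energy : IntegrableOn (fun z => ‖fderiv ℝ m z‖ ^ 2) U₀
  bounded : ∃ C, ∀ z ∈ U₀, |m z| ≤ C
  inner : ∀ p ∈ D, m =ᶠ[𝓝 p] fun _ => 0

/-- The potential `w` of a flow in `U₀ \ D` whose stream function is `m` plus a constant on the
boundary of `U₀` and is constant on the boundary of the obstacle `D`.  Finite energy is required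
near infinity only. -/
structure IsObstacleFlow (U₀ D : Set ℂ) (m : ℂ → ℝ) (w : ℂ → ℂ) : Prop where
  holomorphic : DifferentiableOn ℂ w (U₀ \ D)
  outer : ∃ β, ∀ p ∈ frontier U₀, Tendsto (fun z => (w z).im - m z) (𝓝[U₀ \ D] p) (𝓝 β)
  inner : ∃ γ, ∀ p ∈ D, Tendsto (fun z => (w z).im) (𝓝[U₀ \ D] p) (𝓝 γ)
  bounded : ∃ C, ∀ z ∈ U₀ \ D, |(w z).im| ≤ C
  far : ∃ R, IntegrableOn (fun z => ‖deriv w z‖ ^ 2) ((U₀ \ D) ∩ {z | R ≤ ‖z‖})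

theorem isCutoff_one (U₀ : Set ℂ) : IsCutoff U₀ ∅ fun _ => 1 where
  contDiff := contDiff_const
  bounded := ⟨1, by simp⟩
  compact := ⟨∅, isCompact_empty, empty_subset _, by simp⟩
  outer := fun _ _ => EventuallyEq.rfl
  inner := by simp

theorem IsBoundaryData.empty {U₀ D : Set ℂ} {m : ℂ → ℝ} (h : IsBoundaryData U₀ D m) :
    IsBoundaryData U₀ ∅ m :=
  ⟨h.contDiffOn, h.energy, h.bounded, by simp⟩

theorem IsCutoff.integrable {U₀ D : Set ℂ} {χ : ℂ → ℝ} (h : IsCutoff U₀ D χ) (c : ℝ) :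
    Integrable fun z => ‖fderiv ℝ (fun z => c * (1 - χ z)) z‖ ^ 2 := by
  obtain ⟨K, hK, -, h0⟩ := h.compact
  have hd := h.contDiff.differentiable two_ne_zero
  have e : ∀ z, fderiv ℝ (fun z => c * (1 - χ z)) z = -(c • fderiv ℝ χ z) := fun z => by
    rw [fderiv_const_mul ((hd z).const_sub 1), fderiv_const_sub]
    simp
  simp_rw [e]
  refine Continuous.integrable_of_hasCompactSupport ?_ (HasCompactSupport.intro hK fun z hz => ?_)
  · exact (((h.contDiff.continuous_fderiv two_ne_zero).const_smul c).neg.norm).pow 2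
  · simp [h0 z hz]

/-- The energy of a flow past an obstacle is finite, and is given by the boundary data. -/
theorem IsObstacleFlow.energy {U₀ D : Set ℂ} (hU₀ : IsOpen U₀) (hD : IsClosed D)
    {m χ : ℂ → ℝ} {w : ℂ → ℂ} (hw : IsObstacleFlow U₀ D m w) (hm : IsBoundaryData U₀ D m)
    (hχ : IsCutoff U₀ D χ) :
    IntegrableOn (fun z => ‖deriv w z‖ ^ 2) (U₀ \ D) ∧
    ∫ z in U₀ \ D, ‖deriv w z‖ ^ 2 = ∫ z in U₀ \ D, fderiv ℝ m z (streamGrad w z) := by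
  have hU : IsOpen (U₀ \ D) := hU₀.sdiff hD
  have hUU₀ : U₀ \ D ⊆ U₀ := sdiff_subset
  obtain ⟨β, hβ⟩ := hw.outer
  obtain ⟨γ, hγ⟩ := hw.inner
  set r : ℂ → ℝ := fun z => (β - γ) * (1 - χ z) with hr
  -- the boundary data `q = m - r` are assumed by the stream function up to the same constant
  -- on the boundary of `U₀` and on the obstacle
  set q : ℂ → ℝ := fun z => m z - r z with hqdef
  have hχ1 : ContDiff ℝ 1 χ := hχ.contDiff.of_le one_le_two
  have hr1 : ContDiff ℝ 1 r := contDiff_const.mul (contDiff_const.sub hχ1)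
  have hm1 : ContDiffOn ℝ 1 m (U₀ \ D) := hm.contDiffOn.mono hUU₀
  have hq1 : ContDiffOn ℝ 1 q (U₀ \ D) := hm1.sub hr1.contDiffOn
  have hr2 : IntegrableOn (fun z => ‖fderiv ℝ r z‖ ^ 2) (U₀ \ D) :=
    (hχ.integrable (β - γ)).integrableOn
  have hq2 : IntegrableOn (fun z => ‖fderiv ℝ q z‖ ^ 2) (U₀ \ D) :=
    integrableOn_norm_fderiv_sub_sq hU hm1 hr1.contDiffOn (hm.energy.mono_set hUU₀) hr2
  have hlim : ∀ p ∈ frontier (U₀ \ D),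
      Tendsto (fun z => (w z).im - q z) (𝓝[U₀ \ D] p) (𝓝 β) := by
    intro p hp
    by_cases hpD : p ∈ D
    · have h1 : Tendsto (fun z => (w z).im + (β - γ)) (𝓝[U₀ \ D] p) (𝓝 β) := by
        simpa using (hγ p hpD).add_const (β - γ)
      refine h1.congr' ?_
      filter_upwards [mem_nhdsWithin_of_mem_nhds (hm.inner p hpD),
        mem_nhdsWithin_of_mem_nhds (hχ.inner p hpD)] with y hy hy'
      simp only [hqdef, hr, hy, hy']
      ring
    · have hpU : p ∈ frontier U₀ := by
        rw [hU.frontier_eq] at hp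
        rw [hU₀.frontier_eq]
        exact ⟨closure_mono hUU₀ hp.1, fun h => hp.2 ⟨h, hpD⟩⟩
      refine (hβ p hpU).congr' ?_
      filter_upwards [mem_nhdsWithin_of_mem_nhds (hχ.outer p hpU)] with y hy
      simp only [hqdef, hr, hy]
      ring
  have hgc := (contDiffOn_streamGrad hU hw.holomorphic (n := 0)).continuousOn
  have hwim : ContDiffOn ℝ 1 (fun z => (w z).im) (U₀ \ D) :=
    contDiffOn_im hU hw.holomorphic (n := 1)
  have hE : IntegrableOn (fun z => ‖deriv w z‖ ^ 2) (U₀ \ D) := by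
    obtain ⟨C₁, hC₁⟩ := hw.bounded
    obtain ⟨C₂, hC₂⟩ := hm.bounded
    obtain ⟨C₃, hC₃⟩ := hχ.bounded
    obtain ⟨R, hR⟩ := hw.far
    have := integrableOn_sq_of_weakDivFree hU (weakDivFree_streamGrad hU hw.holomorphic) hgc
      (φ := fun z => (w z).im - q z - β) (q := q)
      ((hwim.sub hq1).sub contDiffOn_const) (fun p hp => by simpa using (hlim p hp).sub_const β)
      (K := C₁ + (C₂ + |β - γ| * (1 + C₃)) + |β|) (fun z hz => by
        have h1 : |r z| ≤ |β - γ| * (1 + C₃) := by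
          rw [hr, abs_mul]
          refine mul_le_mul_of_nonneg_left ((abs_sub _ _).trans ?_) (abs_nonneg _)
          simpa using hC₃ z
        have h2 : |q z| ≤ C₂ + |β - γ| * (1 + C₃) :=
          (abs_sub _ _).trans (add_le_add (hC₂ z hz.1) h1)
        exact (abs_sub _ _).trans (add_le_add ((abs_sub _ _).trans (add_le_add (hC₁ z hz) h2))
          le_rfl))
      (fun z hz => by
        have hd := hw.holomorphic.differentiableAt (hU.mem_nhds hz)
        rw [fderiv_sub_const, fderiv_fun_sub
          ((hwim.contDiffAt (hU.mem_nhds hz)).differentiableAt one_ne_zero)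
          ((hq1.contDiffAt (hU.mem_nhds hz)).differentiableAt one_ne_zero), sub_apply,
          fderiv_im_streamGrad_self hd, norm_streamGrad])
      hq2 (R := R) (by simpa only [norm_streamGrad] using hR)
    simpa only [norm_streamGrad] using this
  refine ⟨hE, ?_⟩
  rw [integral_energy_eq hU hw.holomorphic hq1 hq2 hlim hE]
  have hgm := hgc.aestronglyMeasurable (μ := volume) hU.measurableSet
  have hg2 : IntegrableOn (fun z => ‖streamGrad w z‖ ^ 2) (U₀ \ D) := by
    simpa only [norm_streamGrad] using hE
  have e : ∫ z in U₀ \ D, fderiv ℝ q z (streamGrad w z) =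
      ∫ z in U₀ \ D, (fderiv ℝ m z (streamGrad w z) - fderiv ℝ r z (streamGrad w z)) :=
    setIntegral_congr_fun hU.measurableSet fun z hz => by
      rw [hqdef, fderiv_fun_sub ((hm1.contDiffAt (hU.mem_nhds hz)).differentiableAt one_ne_zero)
        (hr1.differentiable one_ne_zero z), sub_apply]
  rw [e, integral_sub (integrable_fderiv_apply hgm (hm.energy.mono_set hUU₀) hg2)
    (integrable_fderiv_apply hgm hr2 hg2), sub_eq_self]
  obtain ⟨K, hK, hKU, h0⟩ := hχ.compact
  have h1 := integral_fderiv_streamGrad_eq_zero hU hw.holomorphic hχ.contDiff hK hKU h0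
  have e2 : ∀ z, fderiv ℝ r z (streamGrad w z) = (γ - β) * fderiv ℝ χ z (streamGrad w z) :=
    fun z => by
      rw [hr, fderiv_const_mul ((hχ1.differentiable one_ne_zero z).const_sub 1), fderiv_const_sub]
      simp
      ring
  simp_rw [e2]
  rw [integral_const_mul, h1, mul_zero]

/-- Twice the Wirtinger derivative `∂M/∂z̄`. -/
def dbar (M : ℂ → ℂ) (z : ℂ) : ℂ := fderiv ℝ M z 1 + Complex.I * fderiv ℝ M z Complex.I

theorem im_deriv_mul_dbar {w M : ℂ → ℂ} {z : ℂ} (hw : DifferentiableAt ℂ w z)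
    (hM : DifferentiableAt ℝ M z) : (deriv w z * dbar M z).im =
      fderiv ℝ (fun z => (w z).im) z (rotGrad (fun z => (M z).im) z) -
        fderiv ℝ (fun z => -(M z).re) z (streamGrad w z) := by
  have h1 : ∀ v, fderiv ℝ (fun z => (M z).im) z v = (fderiv ℝ M z v).im := fun v => by
    have := (Complex.imCLM.hasFDerivAt.comp z hM.hasFDerivAt).fderiv
    exact congrArg (fun L => L v) this
  have h2 : ∀ v, fderiv ℝ (fun z => -(M z).re) z v = -(fderiv ℝ M z v).re := fun v => by
    have := (Complex.reCLM.hasFDerivAt.comp z hM.hasFDerivAt).neg.fderiv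
    exact congrArg (fun L => L v) this
  rw [fderiv_im_apply hw, fderiv_apply_eq z (streamGrad w z), h2, h2]
  simp [rotGrad, h1, dbar, streamGrad]
  ring

/-- The Blasius integral of a flow is its energy, up to a term which depends on the boundary data
only. -/
theorem IsObstacleFlow.integral_im_dbar {U₀ D : Set ℂ} (hU₀ : IsOpen U₀) (hD : IsClosed D)
    (hDU : D ⊆ U₀) {χ : ℂ → ℝ} {w M : ℂ → ℂ} (hM : ContDiffOn ℝ 2 M U₀)
    (hw : IsObstacleFlow U₀ D (fun z => -(M z).re) w)
    (hm : IsBoundaryData U₀ D fun z => -(M z).re)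
    (hM2 : IntegrableOn (fun z => ‖fderiv ℝ (fun z => (M z).im) z‖ ^ 2) U₀)
    (hχ : IsCutoff U₀ D χ) :
    ∫ z in U₀ \ D, (deriv w z * dbar M z).im =
      (∫ z in U₀, fderiv ℝ (fun z => -(M z).re) z (rotGrad (fun z => (M z).im) z)) -
        ∫ z in U₀ \ D, ‖deriv w z‖ ^ 2 := by
  have hU : IsOpen (U₀ \ D) := hU₀.sdiff hD
  have hUU₀ : U₀ \ D ⊆ U₀ := sdiff_subset
  obtain ⟨hE, hE1⟩ := hw.energy hU₀ hD hm hχ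
  obtain ⟨β, hβ⟩ := hw.outer
  obtain ⟨γ, hγ⟩ := hw.inner
  have hMim : ContDiffOn ℝ 2 (fun z => (M z).im) U₀ := Complex.imCLM.contDiff.comp_contDiffOn hM
  have hrc := (contDiffOn_rotGrad hU₀ hMim).continuousOn
  have hrm := hrc.aestronglyMeasurable (μ := volume) hU₀.measurableSet
  have hr2 : IntegrableOn (fun z => ‖rotGrad (fun z => (M z).im) z‖ ^ 2) U₀ := by
    refine (hM2.const_mul 4).mono' (hrm.norm.pow 2) (Eventually.of_forall fun z => ?_)
    rw [Real.norm_of_nonneg (sq_nonneg _)]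
    have := pow_le_pow_left₀ (norm_nonneg _) (norm_rotGrad_le (fun z => (M z).im) z) 2
    linarith
  have h1 := integral_fderiv_im_eq hU₀ hD hDU hw.holomorphic hm.contDiffOn hm.energy hm.inner hβ
    (finite_singleton γ) (d := fun _ => γ) (by simp) continuousOn_const hγ hE
    (weakDivFree_rotGrad hU₀ hMim) hrc hr2
  rw [← h1, hE1, ← integral_sub]
  · exact setIntegral_congr_fun hU.measurableSet fun z hz =>
      im_deriv_mul_dbar (hw.holomorphic.differentiableAt (hU.mem_nhds hz))
        ((hM.contDiffAt (hU₀.mem_nhds hz.1)).differentiableAt two_ne_zero)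
  · exact integrable_fderiv_apply (hrm.mono_measure (Measure.restrict_mono hUU₀ le_rfl))
      (integrableOn_norm_fderiv_im_sq hU hw.holomorphic hE) (hr2.mono_set hUU₀)
  · refine integrable_fderiv_apply ((contDiffOn_streamGrad hU hw.holomorphic
      (n := 0)).continuousOn.aestronglyMeasurable hU.measurableSet) (hm.energy.mono_set hUU₀) ?_
    simp only [norm_streamGrad]
    exact hE

/-- An obstacle cannot increase the Blasius integral. -/
theorem IsObstacleFlow.integral_im_dbar_le {U₀ D : Set ℂ} (hU₀ : IsOpen U₀) (hD : IsClosed D)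
    (hDU : D ⊆ U₀) {χ : ℂ → ℝ} {w w₀ M : ℂ → ℂ} (hM : ContDiffOn ℝ 2 M U₀)
    (hw : IsObstacleFlow U₀ D (fun z => -(M z).re) w)
    (hw₀ : IsObstacleFlow U₀ ∅ (fun z => -(M z).re) w₀)
    (hm : IsBoundaryData U₀ D fun z => -(M z).re)
    (hM2 : IntegrableOn (fun z => ‖fderiv ℝ (fun z => (M z).im) z‖ ^ 2) U₀)
    (hχ : IsCutoff U₀ D χ) :
    ∫ z in U₀ \ D, (deriv w z * dbar M z).im ≤ ∫ z in U₀, (deriv w₀ z * dbar M z).im := by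
  have hE := (hw.energy hU₀ hD hm hχ).1
  have hE₀ := (hw₀.energy hU₀ isClosed_empty hm.empty (isCutoff_one U₀)).1
  have h1 := hw.integral_im_dbar hU₀ hD hDU hM hm hM2 hχ
  have h2 := hw₀.integral_im_dbar hU₀ isClosed_empty (empty_subset _) hM hm.empty hM2
    (isCutoff_one U₀)
  obtain ⟨β, hβ⟩ := hw.outer
  obtain ⟨γ, hγ⟩ := hw.inner
  obtain ⟨β₀, hβ₀⟩ := hw₀.outer
  have hhol₀ := hw₀.holomorphic
  rw [sdiff_empty] at h2 hE₀ hβ₀ hhol₀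
  have h3 := energy_le_energy hU₀ hD hDU hw.holomorphic hhol₀ hm.contDiffOn hm.energy hm.inner
    hβ hβ₀ (finite_singleton γ) (d := fun _ => γ) (by simp) continuousOn_const hγ hE hE₀
  rw [h1, h2]
  linarith

/-! ### Flows in the physical plane: kinetic energy -/

open scoped Manifold ContDiff in
theorem exists_bodyCutoff {B D : Set ℂ} (hB : IsCompact B) (hD : IsClosed D)
    (hBD : Disjoint B D) : ∃ χ : ℂ → ℝ, ContDiff ℝ 2 χ ∧ HasCompactSupport χ ∧
      (∀ z ∈ B, χ =ᶠ[𝓝 z] fun _ => 1) ∧ (∀ z ∈ D, χ =ᶠ[𝓝 z] fun _ => 0) := by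
  obtain ⟨R, hR⟩ := hB.isBounded.subset_ball 0
  have hs : IsClosed (D ∪ (Metric.ball (0 : ℂ) R)ᶜ) :=
    hD.union Metric.isOpen_ball.isClosed_compl
  have hd : Disjoint (D ∪ (Metric.ball (0 : ℂ) R)ᶜ) B := by
    rw [disjoint_union_left]
    exact ⟨hBD.symm, disjoint_compl_left_iff_subset.2 hR⟩
  obtain ⟨χ, h0, h1, -⟩ := exists_contMDiffMap_zero_one_nhds_of_isClosed 𝓘(ℝ, ℂ) (n := 2) hs
    hB.isClosed hd
  rw [eventually_nhdsSet_iff_forall] at h0 h1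
  refine ⟨χ, χ.contMDiff.contDiff, ?_, h1, fun z hz => h0 z (Or.inl hz)⟩
  refine HasCompactSupport.intro (isCompact_closedBall (0 : ℂ) R) fun z hz => ?_
  exact (h0 z (Or.inr fun h => hz (Metric.ball_subset_closedBall h))).self_of_nhds

theorem tendsto_im_of_continuousOn_closure {F : Set ℂ} {W : ℂ → ℂ} {ψ : ℂ → ℝ}
    (hψ : ContinuousOn ψ (closure F)) (hW : ∀ z ∈ F, ψ z = (W z).im) (p : ℂ) :
    Tendsto (fun z => (W z).im) (𝓝[F] p) (𝓝 (ψ p)) := by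
  by_cases hp : p ∈ closure F
  · refine ((hψ p hp).mono subset_closure).tendsto.congr' ?_
    filter_upwards [self_mem_nhdsWithin] with z hz using hW z hz
  · rw [mem_closure_iff_nhdsWithin_neBot, not_neBot] at hp
    rw [hp]; exact tendsto_bot

theorem contDiff_im_const_mul (a : ℂ) {n : ℕ} : ContDiff ℝ n fun z : ℂ => (a * z).im :=
  Complex.imCLM.contDiff.comp (contDiff_const.mul contDiff_id)

theorem integrable_norm_fderiv_sq {m : ℂ → ℝ} (hm : ContDiff ℝ 1 m) (hc : HasCompactSupport m) :
    Integrable fun z => ‖fderiv ℝ m z‖ ^ 2 := by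
  have h1 : Continuous fun z => ‖fderiv ℝ m z‖ ^ 2 :=
    (hm.continuous_fderiv one_ne_zero).norm.pow 2
  refine h1.integrable_of_hasCompactSupport (HasCompactSupport.intro hc fun z hz => ?_)
  rw [fderiv_of_notMem_tsupport (𝕜 := ℝ) hz]
  simp

/-- The stream function `Im (conj V * z)` of the rigid motion, localised near the body. -/
theorem exists_rigidData {B D : Set ℂ} (hB : IsCompact B) (hD : IsClosed D)
    (hBD : Disjoint B D) (V : ℂ) : ∃ m : ℂ → ℝ, ContDiff ℝ 1 m ∧
      Integrable (fun z => ‖fderiv ℝ m z‖ ^ 2) ∧ (∀ z ∈ D, m =ᶠ[𝓝 z] fun _ => 0) ∧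
      ∀ p ∈ B, ∀ F : Set ℂ, Tendsto m (𝓝[F] p) (𝓝 (conj V * p).im) := by
  obtain ⟨χ, hχ, hχc, hχ1, hχ0⟩ := exists_bodyCutoff hB hD hBD
  set ℓ : ℂ → ℝ := fun z => (conj V * z).im with hℓ
  have hℓ1 : ContDiff ℝ 1 ℓ := contDiff_im_const_mul (conj V) (n := 1)
  have hm1 : ContDiff ℝ 1 fun z => χ z * ℓ z := (hχ.of_le one_le_two).mul hℓ1
  have hmc : HasCompactSupport fun z => χ z * ℓ z := hχc.mul_right
  refine ⟨fun z => χ z * ℓ z, hm1, ?_, fun z hz => ?_, fun p hp F => ?_⟩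
  · exact integrable_norm_fderiv_sq hm1 hmc
  · filter_upwards [hχ0 z hz] with y hy
    rw [hy, zero_mul]
  · have h1 : Tendsto ℓ (𝓝[F] p) (𝓝 (ℓ p)) := hℓ1.continuous.continuousAt.mono_left inf_le_left
    refine h1.congr' ?_
    filter_upwards [mem_nhdsWithin_of_mem_nhds (hχ1 p hp)] with y hy
    rw [hy, one_mul]

theorem exists_continuousOn_eq_const {n : ℕ} {D : Fin n → Set ℂ} (hD : ∀ i, IsClosed (D i))
    (hDD : Pairwise fun i j => Disjoint (D i) (D j)) (γ : Fin n → ℝ) :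
    ∃ d : ℂ → ℝ, (∀ i, ∀ z ∈ D i, d z = γ i) ∧ ContinuousOn d (⋃ i, D i) := by
  have hdD : ∀ i, ∀ z ∈ D i, ∑ j, (D j).indicator (fun _ => γ j) z = γ i := fun i z hz => by
    rw [Finset.sum_eq_single i, indicator_of_mem hz]
    · intro j _ hj
      exact indicator_of_notMem (fun h => (hDD hj).ne_of_mem h hz rfl) _
    · simp
  exact ⟨fun z => ∑ i, (D i).indicator (fun _ => γ i) z, hdD,
    (locallyFinite_of_finite D).continuousOn_iUnion hD fun i => continuousOn_const.congr (hdD i)⟩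

theorem kineticEnergy_le {B : Set ℂ} {n : ℕ} {D : Fin n → Set ℂ} {V : ℂ} {W W₀ : ℂ → ℂ}
    (hB : IsCompact B) (hD : ∀ i, IsClosed (D i)) (hBD : ∀ i, Disjoint B (D i))
    (hDD : Pairwise fun i j => Disjoint (D i) (D j)) (hW : IsPotentialFlow B D V W)
    (hW₀ : IsPotentialFlow B (![] : Fin 0 → Set ℂ) V W₀) {ϱ : ℝ} (hϱ : 0 ≤ ϱ) :
    kineticEnergy ϱ (fluidRegion B (![] : Fin 0 → Set ℂ)) W₀ ≤
      kineticEnergy ϱ (fluidRegion B D) W := by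
  have hE : IsClosed (⋃ i, D i) := isClosed_iUnion_of_finite hD
  have hBE : Disjoint B (⋃ i, D i) := disjoint_iUnion_right.2 hBD
  have hF : fluidRegion B D = Bᶜ \ ⋃ i, D i := by
    rw [fluidRegion, compl_union, sdiff_eq]
  have hF₀ : fluidRegion B (![] : Fin 0 → Set ℂ) = Bᶜ := by simp [fluidRegion]
  obtain ⟨ψ, hψc, hψ, ⟨β, hβ⟩, hγ⟩ := hW.no_flux
  obtain ⟨ψ₀, hψ₀c, hψ₀, ⟨β₀, hβ₀⟩, -⟩ := hW₀.no_flux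
  have hhol := hW.holomorphic
  have hhol₀ := hW₀.holomorphic
  have hen := hW.finite_energy
  have hen₀ := hW₀.finite_energy
  rw [kineticEnergy, kineticEnergy]
  rw [hF] at hψc hψ hhol hen ⊢
  rw [hF₀] at hψ₀c hψ₀ hhol₀ hen₀ ⊢
  refine mul_le_mul_of_nonneg_left ?_ (by positivity)
  choose γ hγ using hγ
  obtain ⟨m, hm1, hm2, hmD, hmB⟩ := exists_rigidData hB hE hBE V
  obtain ⟨d, hdD, hdc⟩ := exists_continuousOn_eq_const hD hDD γ
  have hBf : ∀ p ∈ frontier Bᶜ, p ∈ frontier B ∧ p ∈ B := fun p hp => by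
    rw [frontier_compl] at hp
    exact ⟨hp, hB.isClosed.frontier_subset hp⟩
  refine energy_le_energy (β := β) (β₀ := β₀) (d := d) hB.isClosed.isOpen_compl hE
    (subset_compl_iff_disjoint_left.2 hBE) hhol hhol₀
    hm1.contDiffOn hm2.integrableOn hmD ?_ ?_ (finite_range γ)
    (fun z hz => ?_) hdc ?_ hen hen₀
  · intro p hp
    have := (tendsto_im_of_continuousOn_closure hψc hψ p).sub (hmB p (hBf p hp).2 _)
    rwa [hβ p (hBf p hp).1, add_sub_cancel_left] at this
  · intro p hp
    have := (tendsto_im_of_continuousOn_closure hψ₀c hψ₀ p).sub (hmB p (hBf p hp).2 _)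
    rwa [hβ₀ p (hBf p hp).1, add_sub_cancel_left] at this
  · obtain ⟨i, hi⟩ := mem_iUnion.1 hz
    exact ⟨i, (hdD i z hi).symm⟩
  · intro p hp
    obtain ⟨i, hi⟩ := mem_iUnion.1 hp
    rw [hdD i p hi]
    by_cases hpi : p ∈ interior (D i)
    · have : 𝓝[Bᶜ \ ⋃ i, D i] p = ⊥ := by
        rw [← notMem_closure_iff_nhdsWithin_eq_bot, mem_closure_iff]
        intro h
        obtain ⟨y, hy, hy'⟩ := h _ isOpen_interior hpi
        exact hy'.2 (mem_iUnion.2 ⟨i, interior_subset hy⟩)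
      rw [this]; exact tendsto_bot
    · have := tendsto_im_of_continuousOn_closure hψc hψ p
      rwa [hγ i p ⟨subset_closure hi, hpi⟩] at this

theorem addedMassCoeff_le {B : Set ℂ} {n : ℕ} {D : Fin n → Set ℂ} {V : ℂ} {W W₀ : ℂ → ℂ}
    (hB : IsCompact B) (hD : ∀ i, IsClosed (D i)) (hBD : ∀ i, Disjoint B (D i))
    (hDD : Pairwise fun i j => Disjoint (D i) (D j)) (hW : IsPotentialFlow B D V W)
    (hW₀ : IsPotentialFlow B (![] : Fin 0 → Set ℂ) V W₀) {ϱ : ℝ} (hϱ : 0 ≤ ϱ) :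
    addedMassCoeff ϱ B (![] : Fin 0 → Set ℂ) V W₀ ≤ addedMassCoeff ϱ B D V W :=
  div_le_div_of_nonneg_right
    (mul_le_mul_of_nonneg_left (kineticEnergy_le hB hD hBD hDD hW hW₀ hϱ) zero_le_two)
    (by positivity)

/-! ### Circle integrals as area integrals -/

/-- A smooth step, as a function of the squared radius, from `0` at `s ^ 2` to `1` at `t ^ 2`. -/
def radialProfile (s t u : ℝ) : ℝ := Real.smoothTransition ((u - s ^ 2) / (t ^ 2 - s ^ 2))

/-- A smooth radial function which is `0` for `‖ζ‖ ≤ s` and `1` for `‖ζ‖ ≥ t`. -/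
def radialCutoff (s t : ℝ) (ζ : ℂ) : ℝ := radialProfile s t (‖ζ‖ ^ 2)

theorem contDiff_radialProfile (s t : ℝ) {n : ℕ} : ContDiff ℝ n (radialProfile s t) := by
  have h : ContDiff ℝ n fun u : ℝ => (u - s ^ 2) / (t ^ 2 - s ^ 2) := by fun_prop
  exact (Real.smoothTransition.contDiff (n := n)).comp h

theorem contDiff_radialCutoff (s t : ℝ) {n : ℕ} : ContDiff ℝ n (radialCutoff s t) :=
  (contDiff_radialProfile s t).comp (contDiff_norm_sq ℝ)

theorem radialProfile_of_le {s t u : ℝ} (hs : 0 < s) (hst : s < t) (h : u ≤ s ^ 2) :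
    radialProfile s t u = 0 :=
  Real.smoothTransition.zero_of_nonpos (div_nonpos_of_nonpos_of_nonneg (by linarith)
    (by nlinarith))

theorem radialProfile_of_ge {s t u : ℝ} (hs : 0 < s) (hst : s < t) (h : t ^ 2 ≤ u) :
    radialProfile s t u = 1 :=
  Real.smoothTransition.one_of_one_le ((one_le_div (by nlinarith)).2 (by linarith))

theorem radialCutoff_of_le {s t : ℝ} (hs : 0 < s) (hst : s < t) {ζ : ℂ} (h : ‖ζ‖ ≤ s) :
    radialCutoff s t ζ = 0 :=
  radialProfile_of_le hs hst (pow_le_pow_left₀ (norm_nonneg _) h 2)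

theorem radialCutoff_of_ge {s t : ℝ} (hs : 0 < s) (hst : s < t) {ζ : ℂ} (h : t ≤ ‖ζ‖) :
    radialCutoff s t ζ = 1 :=
  radialProfile_of_ge hs hst (pow_le_pow_left₀ (by linarith) h 2)

theorem abs_radialCutoff_le (s t : ℝ) (ζ : ℂ) : |radialCutoff s t ζ| ≤ 1 := by
  rw [radialCutoff, radialProfile, abs_of_nonneg (Real.smoothTransition.nonneg _)]
  exact Real.smoothTransition.le_one _

theorem deriv_radialProfile_of_lt {s t u : ℝ} (hs : 0 < s) (hst : s < t) (h : u < s ^ 2) :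
    deriv (radialProfile s t) u = 0 := by
  have : radialProfile s t =ᶠ[𝓝 u] fun _ => 0 := by
    filter_upwards [Iio_mem_nhds h] with y hy using radialProfile_of_le hs hst (le_of_lt hy)
  rw [this.deriv_eq, deriv_const]

theorem deriv_radialProfile_of_gt {s t u : ℝ} (hs : 0 < s) (hst : s < t) (h : t ^ 2 < u) :
    deriv (radialProfile s t) u = 0 := by
  have : radialProfile s t =ᶠ[𝓝 u] fun _ => 1 := by
    filter_upwards [Ioi_mem_nhds h] with y hy using radialProfile_of_ge hs hst (le_of_lt hy)
  rw [this.deriv_eq, deriv_const]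

theorem dbar_ofReal {X : ℂ → ℝ} {ζ : ℂ} (hX : DifferentiableAt ℝ X ζ) :
    dbar (fun ζ => (X ζ : ℂ)) ζ = (fderiv ℝ X ζ 1 : ℝ) + Complex.I * (fderiv ℝ X ζ Complex.I : ℝ) := by
  have : fderiv ℝ (fun ζ => (X ζ : ℂ)) ζ = Complex.ofRealCLM.comp (fderiv ℝ X ζ) :=
    (Complex.ofRealCLM.hasFDerivAt.comp ζ hX.hasFDerivAt).fderiv
  rw [dbar, this]
  simp

theorem dbar_radialCutoff (s t : ℝ) (ζ : ℂ) :
    dbar (fun ζ => (radialCutoff s t ζ : ℂ)) ζ =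
      (2 * deriv (radialProfile s t) (‖ζ‖ ^ 2) : ℝ) * ζ := by
  have hd := ((contDiff_radialProfile s t (n := 1)).differentiable one_ne_zero) (‖ζ‖ ^ 2)
  have h1 : HasFDerivAt (fun ζ : ℂ => ‖ζ‖ ^ 2) (2 • innerSL ℝ ζ) ζ :=
    (hasStrictFDerivAt_norm_sq ζ).hasFDerivAt
  have h2 := hd.hasDerivAt.comp_hasFDerivAt ζ h1
  have h3 : fderiv ℝ (radialCutoff s t) ζ = _ := h2.fderiv
  have h4 : DifferentiableAt ℝ (radialCutoff s t) ζ := h2.differentiableAt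
  rw [dbar_ofReal h4, h3]
  apply Complex.ext <;> simp [Complex.inner] <;> ring

theorem integral_Ioo_circleMap {r : ℝ} (H : ℂ → ℂ) :
    ∫ θ in Ioo (-Real.pi) Real.pi, circleMap 0 r θ * H (circleMap 0 r θ) =
      -Complex.I * ∮ ζ in C(0, r), H ζ := by
  have hper : Function.Periodic (fun θ => circleMap 0 r θ * H (circleMap 0 r θ)) (2 * Real.pi) :=
    fun θ => by simp only [periodic_circleMap 0 r θ]
  have h1 := hper.intervalIntegral_add_eq (-Real.pi) 0
  rw [show -Real.pi + 2 * Real.pi = Real.pi by ring, zero_add] at h1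
  rw [← integral_Ioc_eq_integral_Ioo, ← intervalIntegral.integral_of_le
    (by linarith [Real.pi_pos]), h1, circleIntegral, ← intervalIntegral.integral_const_mul]
  refine intervalIntegral.integral_congr fun θ _ => ?_
  simp only [deriv_circleMap, smul_eq_mul]
  linear_combination ((circleMap 0 r θ * H (circleMap 0 r θ))) * Complex.I_mul_I

/-- A circle integral which does not depend on the radius, as an area integral. -/
theorem integral_mul_dbar_radialCutoff {s t : ℝ} (hs : 0 < s) (hst : s < t) {A : Set ℂ}
    (hsub : {ζ : ℂ | s ≤ ‖ζ‖ ∧ ‖ζ‖ ≤ t} ⊆ A) {H : ℂ → ℂ}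
    (hH : ContinuousOn H A) {J : ℂ}
    (hJ : ∀ r, s ≤ r → r ≤ t → ∮ ζ in C(0, r), H ζ = J) :
    ∫ ζ in A, H ζ * dbar (fun ζ => (radialCutoff s t ζ : ℂ)) ζ = -Complex.I * J := by
  set κ' : ℝ → ℝ := deriv (radialProfile s t) with hκ
  have hκc : Continuous κ' := (contDiff_radialProfile s t (n := 1)).continuous_deriv le_rfl
  have ht : 0 < t := hs.trans hst
  have hκ0 : ∀ r, 0 < r → r ∉ Icc s t → κ' (r ^ 2) = 0 := fun r hr h => by
    rw [mem_Icc, not_and_or, not_le, not_le] at h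
    rcases h with h | h
    · exact deriv_radialProfile_of_lt hs hst (pow_lt_pow_left₀ h hr.le two_ne_zero)
    · exact deriv_radialProfile_of_gt hs hst (pow_lt_pow_left₀ h ht.le two_ne_zero)
  simp_rw [dbar_radialCutoff]
  have h0 : ∀ ζ ∉ A, H ζ * ((2 * κ' (‖ζ‖ ^ 2) : ℝ) * ζ) = 0 := fun ζ hζ => by
    rcases eq_or_ne ζ 0 with rfl | hne
    · simp
    · rw [hκ0 ‖ζ‖ (norm_pos_iff.2 hne) fun h => hζ (hsub h)]
      simp
  rw [setIntegral_eq_integral_of_forall_compl_eq_zero h0, ← Complex.integral_comp_polarCoord_symm]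
  set G : ℝ × ℝ → ℂ := fun p =>
    ((2 * p.1 * κ' (p.1 ^ 2) : ℝ) : ℂ) * (circleMap 0 p.1 p.2 * H (circleMap 0 p.1 p.2)) with hG
  have hsymm : ∀ p : ℝ × ℝ, Complex.polarCoord.symm p = circleMap 0 p.1 p.2 := fun p => by
    rw [Complex.polarCoord_symm_apply, circleMap, zero_add, Complex.exp_mul_I, Complex.ofReal_cos,
      Complex.ofReal_sin]
  have e1 : ∫ p in polarCoord.target, p.1 • (fun ζ : ℂ => H ζ * ((2 * κ' (‖ζ‖ ^ 2) : ℝ) * ζ))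
      (Complex.polarCoord.symm p) = ∫ p in polarCoord.target, G p := by
    refine setIntegral_congr_fun polarCoord.open_target.measurableSet fun p hp => ?_
    have hp1 : 0 < p.1 := hp.1
    simp only [hsymm, hG, norm_circleMap_zero, sq_abs, Complex.real_smul]
    push_cast
    ring
  have hsub2 : Icc s t ×ˢ Ioo (-Real.pi) Real.pi ⊆ polarCoord.target := fun p hp =>
    ⟨hs.trans_le hp.1.1, hp.2⟩
  have e2 : ∫ p in polarCoord.target, G p = ∫ p in Icc s t ×ˢ Ioo (-Real.pi) Real.pi, G p := by
    refine setIntegral_eq_of_subset_of_forall_sdiff_eq_zero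
      polarCoord.open_target.measurableSet hsub2 fun p hp => ?_
    have : p.1 ∉ Icc s t := fun h => hp.2 ⟨h, hp.1.2⟩
    simp [hG, hκ0 p.1 hp.1.1 this]
  have hcm : Continuous fun p : ℝ × ℝ => circleMap 0 p.1 p.2 := by
    unfold circleMap; fun_prop
  have hGi : IntegrableOn G (Icc s t ×ˢ Ioo (-Real.pi) Real.pi) := by
    have hc : ContinuousOn G (Icc s t ×ˢ Icc (-Real.pi) Real.pi) := by
      have h1 : Continuous fun p : ℝ × ℝ => ((2 * p.1 * κ' (p.1 ^ 2) : ℝ) : ℂ) := by fun_prop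
      refine h1.continuousOn.mul (hcm.continuousOn.mul (hH.comp hcm.continuousOn fun p hp => ?_))
      apply hsub
      rw [mem_ofPred_eq, norm_circleMap_zero, abs_of_pos (hs.trans_le hp.1.1)]
      exact hp.1
    exact (hc.integrableOn_compact (isCompact_Icc.prod isCompact_Icc)).mono_set
      (prod_mono le_rfl Ioo_subset_Icc_self)
  rw [e1, e2, Measure.volume_eq_prod, setIntegral_prod _ hGi]
  have e3 : ∫ r in Icc s t, ∫ θ in Ioo (-Real.pi) Real.pi, G (r, θ) =
      ∫ r in Icc s t, ((2 * r * κ' (r ^ 2) : ℝ) : ℂ) * (-Complex.I * J) :=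
    setIntegral_congr_fun measurableSet_Icc fun r hr => by
      simp only [hG]
      rw [integral_const_mul, integral_Ioo_circleMap, hJ r hr.1 hr.2]
  rw [e3, integral_mul_const, integral_complex_ofReal, integral_Icc_eq_integral_Ioc,
    ← intervalIntegral.integral_of_le hst.le]
  have hder : ∀ r ∈ uIcc s t,
      HasDerivAt (fun r => radialProfile s t (r ^ 2)) (2 * r * κ' (r ^ 2)) r := fun r _ => by
    have h1 := ((contDiff_radialProfile s t (n := 1)).differentiable one_ne_zero
      (r ^ 2)).hasDerivAt.comp r (hasDerivAt_pow 2 r)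
    refine h1.congr_deriv ?_
    simp only [hκ]
    push_cast
    ring
  rw [intervalIntegral.integral_eq_sub_of_hasDerivAt hder
    (Continuous.intervalIntegrable (by fun_prop) _ _), radialProfile_of_ge hs hst le_rfl,
    radialProfile_of_le hs hst le_rfl]
  simp

/-- The region `s < ‖ζ‖ < 1` inside the unit circle. -/
def collar (s : ℝ) : Set ℂ := {ζ | s < ‖ζ‖ ∧ ‖ζ‖ < 1}

theorem isOpen_collar (s : ℝ) : IsOpen (collar s) :=
  (isOpen_lt continuous_const continuous_norm).inter (isOpen_lt continuous_norm continuous_const)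

theorem circleIntegral_eq_of_differentiableOn {s : ℝ} (hs : 0 ≤ s) {H : ℂ → ℂ}
    (hH : DifferentiableOn ℂ H (collar s)) {r r' : ℝ} (hr : s < r) (hr1 : r < 1)
    (hr' : s < r') (hr1' : r' < 1) : ∮ ζ in C(0, r), H ζ = ∮ ζ in C(0, r'), H ζ := by
  have main : ∀ r r' : ℝ, s < r → r ≤ r' → r' < 1 →
      ∮ ζ in C(0, r), H ζ = ∮ ζ in C(0, r'), H ζ := fun r r' hr hrr hr1 => by
    refine (Complex.circleIntegral_eq_of_differentiable_on_annulus_off_countable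
      (hs.trans_lt hr) hrr countable_empty (hH.continuousOn.mono fun ζ hζ => ?_)
      fun ζ hζ => hH.differentiableAt ((isOpen_collar s).mem_nhds ?_)).symm
    · simp only [Set.mem_sdiff, mem_closedBall_zero_iff, mem_ball_zero_iff, not_lt] at hζ
      exact ⟨hr.trans_le hζ.2, hζ.1.trans_lt hr1⟩
    · simp only [Set.mem_sdiff, mem_closedBall_zero_iff, mem_ball_zero_iff, not_le] at hζ
      exact ⟨hr.trans hζ.1.2, hζ.1.1.trans hr1⟩
  rcases le_total r r' with h | h
  · exact main r r' hr h hr1'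
  · exact (main r' r hr' h hr1).symm

theorem blasiusResidue_eq {s : ℝ} (hs : 0 ≤ s) {z W : ℂ → ℂ} (hz : DifferentiableOn ℂ z (collar s))
    (hW : DifferentiableOn ℂ W (collar s)) {r r' : ℝ} (hr : s < r) (hr1 : r < 1)
    (hr' : s < r') (hr1' : r' < 1) : blasiusResidue z W r = blasiusResidue z W r' := by
  have hH : DifferentiableOn ℂ (fun ζ => z ζ * deriv W ζ) (collar s) :=
    hz.mul (hW.deriv (isOpen_collar s))
  rw [blasiusResidue, blasiusResidue, circleIntegral_eq_of_differentiableOn hs hH hr hr1 hr' hr1']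

theorem hasBlasiusAddedMass {s : ℝ} (hs : 0 ≤ s) {z W : ℂ → ℂ}
    (hz : DifferentiableOn ℂ z (collar s)) (hW : DifferentiableOn ℂ W (collar s)) {r : ℝ}
    (hr : s < r) (hr1 : r < 1) (A : ℝ) :
    HasBlasiusAddedMass A z W (-(2 * Real.pi / A) * (blasiusResidue z W r).im - 1) := by
  refine tendsto_const_nhds.congr' ?_
  filter_upwards [Ioo_mem_nhdsLT (hr.trans hr1)] with r' hr'
  rw [blasiusResidue_eq hs hz hW hr hr1 hr'.1 hr'.2]

theorem integral_blasius {s t t' : ℝ} (hs : 0 ≤ s) (ht : s < t) (htt : t < t') (ht' : t' < 1)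
    {z W : ℂ → ℂ} (hz : DifferentiableOn ℂ z (collar s)) (hW : DifferentiableOn ℂ W (collar s))
    {r : ℝ} (hr : s < r) (hr1 : r < 1) :
    ∫ ζ in collar s, z ζ * deriv W ζ * dbar (fun ζ => (radialCutoff t t' ζ : ℂ)) ζ =
      2 * Real.pi * blasiusResidue z W r := by
  have hH : DifferentiableOn ℂ (fun ζ => z ζ * deriv W ζ) (collar s) :=
    hz.mul (hW.deriv (isOpen_collar s))
  rw [integral_mul_dbar_radialCutoff (hs.trans_lt ht) htt (A := collar s)
    (fun ζ hζ => ⟨ht.trans_le hζ.1, hζ.2.trans_lt ht'⟩) hH.continuousOn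
    (J := ∮ ζ in C(0, r), z ζ * deriv W ζ)
    (fun r' h1 h2 => circleIntegral_eq_of_differentiableOn hs hH (ht.trans_le h1)
      (h2.trans_lt ht') hr hr1), blasiusResidue]
  have hpi : (Real.pi : ℂ) ≠ 0 := by exact_mod_cast Real.pi_ne_zero
  field_simp
  linear_combination (-∮ ζ in C(0, r), z ζ * deriv W ζ) * Complex.I_mul_I

/-! ### Laurent maps -/

theorem isOpen_mapDomain (ρ : ℝ) : IsOpen (mapDomain ρ) := by
  by_cases h : 0 < ρ
  · have : mapDomain ρ = {ζ | ‖ζ‖ < 1} ∩ {ζ | ρ < ‖ζ‖} := by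
      ext ζ; simp [mapDomain, h]
    rw [this]
    exact (isOpen_lt continuous_norm continuous_const).inter
      (isOpen_lt continuous_const continuous_norm)
  · have : mapDomain ρ = {ζ | ‖ζ‖ < 1} := by
      ext ζ; simp [mapDomain, h]
    rw [this]
    exact isOpen_lt continuous_norm continuous_const

/-- The domain of a Laurent map: the annulus without the pole. -/
def regularDomain (ρ : ℝ) (b c : ℂ) : Set ℂ := {ζ ∈ mapDomain ρ | b ≠ 0 → ζ ≠ c}

theorem isOpen_regularDomain (ρ : ℝ) (b c : ℂ) : IsOpen (regularDomain ρ b c) := by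
  by_cases h : b = 0
  · have : regularDomain ρ b c = mapDomain ρ := by
      ext ζ; simp [regularDomain, h]
    rw [this]
    exact isOpen_mapDomain ρ
  · have : regularDomain ρ b c = mapDomain ρ ∩ {c}ᶜ := by
      ext ζ; simp [regularDomain, h]
    rw [this]
    exact (isOpen_mapDomain ρ).inter isOpen_compl_singleton

theorem mapDomain_subset_closed {ρ : ℝ} (hρ : 0 ≤ ρ) : mapDomain ρ ⊆ closedMapDomain ρ := by
  intro ζ hζ
  refine ⟨hζ.1.le, ?_⟩
  rcases hρ.eq_or_lt with h | h
  · rw [← h]; exact norm_nonneg _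
  · exact (hζ.2 h).le

theorem isCompact_closedMapDomain (ρ : ℝ) : IsCompact (closedMapDomain ρ) := by
  have : closedMapDomain ρ = Metric.closedBall 0 1 ∩ {ζ | ρ ≤ ‖ζ‖} := by
    ext ζ; simp [closedMapDomain]
  rw [this]
  exact (isCompact_closedBall 0 1).inter_right (isClosed_le continuous_const continuous_norm)

theorem zpow_norm_le {s t : ℝ} (hs : 0 < s) {ζ : ℂ} (h1 : s ≤ ‖ζ‖) (h2 : ‖ζ‖ ≤ t) (k : ℤ) :
    ‖ζ‖ ^ k ≤ t ^ k + s ^ k := by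
  have ht : 0 < t := hs.trans_le (h1.trans h2)
  rcases le_total 0 k with hk | hk
  · exact (zpow_le_zpow_left₀ hk (norm_nonneg _) h2).trans
      (le_add_of_nonneg_right (zpow_nonneg hs.le k))
  · have : ‖ζ‖ ^ k ≤ s ^ k := by
      obtain ⟨j, rfl⟩ : ∃ j, k = -j := ⟨-k, by simp⟩
      rw [zpow_neg, zpow_neg]
      exact inv_anti₀ (zpow_pos hs j) (zpow_le_zpow_left₀ (by linarith) hs.le h1)
    exact this.trans (le_add_of_nonneg_left (zpow_nonneg ht.le k))

theorem IsLaurentMap.summable {ρ : ℝ} {a : ℤ → ℂ} {b c : ℂ} {z : ℂ → ℂ}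
    (h : IsLaurentMap ρ a b c z) {r : ℝ} (hr0 : 0 < r) (hr : ρ < r) (hr1 : r < 1) (hrc : r ≠ ‖c‖) :
    Summable fun k : ℤ => ‖a k‖ * r ^ k := by
  have hn : ‖(r : ℂ)‖ = r := by rw [Complex.norm_real, Real.norm_of_nonneg hr0.le]
  have := (h.laurent r ⟨by rwa [hn], fun _ => by rwa [hn]⟩
    (fun _ hc => hrc (by rw [← hc, hn]))).summable.norm
  simpa [norm_mul, norm_zpow, abs_of_pos hr0] using this

/-- The regular part of a Laurent map is holomorphic, also at the pole. -/
theorem IsLaurentMap.exists_regularPart {ρ : ℝ} (hρ : 0 ≤ ρ) {a : ℤ → ℂ} {b c : ℂ} {z : ℂ → ℂ}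
    (h : IsLaurentMap ρ a b c z) : ∃ L : ℂ → ℂ, DifferentiableOn ℂ L (mapDomain ρ) ∧
      ∀ ζ ∈ regularDomain ρ b c, z ζ = L ζ + b / (ζ - c) := by
  refine ⟨fun ζ => ∑' k : ℤ, a k * ζ ^ k, ?_, fun ζ hζ => ?_⟩
  · intro ζ hζ
    -- a radius between two given ones which avoids the pole
    have hrad : ∀ x y : ℝ, x < y → ∃ r, x < r ∧ r < y ∧ r ≠ ‖c‖ := fun x y hxy => by
      obtain ⟨r, hr⟩ := ((Ioo_infinite hxy).sdiff (finite_singleton ‖c‖)).nonempty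
      exact ⟨r, hr.1.1, hr.1.2, hr.2⟩
    obtain ⟨t, ht, ht1, htc⟩ := hrad ‖ζ‖ 1 hζ.1
    have ht0 : 0 < t := (norm_nonneg _).trans_lt ht
    rcases hρ.eq_or_lt with h0 | h0
    · have hopen : IsOpen (Metric.ball (0 : ℂ) t) := Metric.isOpen_ball
      have hsum := h.summable ht0 (h0 ▸ ht0) ht1 htc
      have hd : DifferentiableOn ℂ (fun ζ => ∑' k : ℤ, a k * ζ ^ k) (Metric.ball (0 : ℂ) t) := by
        refine Complex.differentiableOn_tsum_of_summable_norm hsum (fun k => ?_) hopen fun k ξ hξ => ?_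
        · rcases le_or_gt 0 k with hk | hk
          · exact fun ξ _ => ((differentiableAt_zpow.2 (Or.inr hk)).const_mul
              _).differentiableWithinAt
          · simp only [h.no_negative_powers h0.symm k hk, zero_mul]
            exact differentiableOn_const 0
        · rw [norm_mul, norm_zpow]
          rcases le_or_gt 0 k with hk | hk
          · exact mul_le_mul_of_nonneg_left (zpow_le_zpow_left₀ hk (norm_nonneg _)
              (mem_ball_zero_iff.1 hξ).le) (norm_nonneg _)
          · simp [h.no_negative_powers h0.symm k hk]
      exact (hd.differentiableAt (hopen.mem_nhds (by simpa using ht))).differentiableWithinAt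
    · obtain ⟨s, hs, hs1, hsc⟩ := hrad ρ ‖ζ‖ (hζ.2 h0)
      have hs0 : 0 < s := h0.trans hs
      have hopen : IsOpen {ξ : ℂ | s < ‖ξ‖ ∧ ‖ξ‖ < t} :=
        (isOpen_lt continuous_const continuous_norm).inter
          (isOpen_lt continuous_norm continuous_const)
      have hsum := (h.summable ht0 ((hs.trans hs1).trans ht) ht1 htc).add
        (h.summable hs0 hs (hs1.trans hζ.1) hsc)
      have hd : DifferentiableOn ℂ (fun ζ => ∑' k : ℤ, a k * ζ ^ k)
          {ξ : ℂ | s < ‖ξ‖ ∧ ‖ξ‖ < t} := by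
        refine Complex.differentiableOn_tsum_of_summable_norm hsum (fun k ξ hξ => ?_) hopen
          fun k ξ hξ => ?_
        · exact ((differentiableAt_zpow.2 (Or.inl (norm_pos_iff.1
            (hs0.trans hξ.1)))).const_mul _).differentiableWithinAt
        · rw [norm_mul, norm_zpow, ← mul_add]
          exact mul_le_mul_of_nonneg_left (zpow_norm_le hs0 hξ.1.le hξ.2.le k) (norm_nonneg _)
      exact (hd.differentiableAt (hopen.mem_nhds ⟨hs1, ht⟩)).differentiableWithinAt
  · simp only
    rw [(h.laurent ζ hζ.1 hζ.2).tsum_eq]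
    ring

theorem IsLaurentMap.differentiableOn {ρ : ℝ} (hρ : 0 ≤ ρ) {a : ℤ → ℂ} {b c : ℂ} {z : ℂ → ℂ}
    (h : IsLaurentMap ρ a b c z) : DifferentiableOn ℂ z (regularDomain ρ b c) := by
  obtain ⟨L, hL, hz⟩ := h.exists_regularPart hρ
  refine DifferentiableOn.congr ?_ hz
  refine (hL.mono fun ζ hζ => hζ.1).add fun ζ hζ => ?_
  by_cases hb : b = 0
  · simp only [hb, zero_div]
    exact differentiableWithinAt_const 0
  · exact ((differentiableAt_const b).div (differentiableAt_id.sub_const c)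
      (sub_ne_zero.2 (hζ.2 hb))).differentiableWithinAt

/-- Near a genuine pole the map is large. -/
theorem IsLaurentMap.exists_near_pole {ρ : ℝ} (hρ : 0 ≤ ρ) {a : ℤ → ℂ} {b c : ℂ} {z : ℂ → ℂ}
    (h : IsLaurentMap ρ a b c z) (hb : b ≠ 0) (R : ℝ) :
    ∃ δ > 0, Metric.ball c δ ⊆ mapDomain ρ ∧ ∀ ζ ∈ Metric.ball c δ, ζ ≠ c → R < ‖z ζ‖ := by
  obtain ⟨L, hL, hz⟩ := h.exists_regularPart hρ
  have hLc : ContinuousAt L c :=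
    (hL.differentiableAt ((isOpen_mapDomain ρ).mem_nhds h.pole_mem)).continuousAt
  have h1 : ∀ᶠ ζ in 𝓝 c, ‖L ζ‖ < ‖L c‖ + 1 :=
    hLc.norm.eventually_lt_const (lt_add_one _)
  have h2 : ∀ᶠ ζ in 𝓝 c, ‖ζ - c‖ * (|R| + ‖L c‖ + 1) < ‖b‖ := by
    have : Continuous fun ζ : ℂ => ‖ζ - c‖ * (|R| + ‖L c‖ + 1) := by fun_prop
    exact this.continuousAt.eventually_lt_const (by simpa using norm_pos_iff.2 hb)
  obtain ⟨δ, hδ, hball⟩ := Metric.mem_nhds_iff.1 (Filter.inter_mem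
    ((isOpen_mapDomain ρ).mem_nhds h.pole_mem) (Filter.inter_mem h1 h2))
  refine ⟨δ, hδ, fun ζ hζ => (hball hζ).1, fun ζ hζ hne => ?_⟩
  obtain ⟨hm, h1, h2⟩ := hball hζ
  have h1 : ‖L ζ‖ < ‖L c‖ + 1 := h1
  have h2 : ‖ζ - c‖ * (|R| + ‖L c‖ + 1) < ‖b‖ := h2
  have hpos : 0 < ‖ζ - c‖ := norm_pos_iff.2 (sub_ne_zero.2 hne)
  rw [hz ζ ⟨hm, fun _ => hne⟩]
  have h3 : |R| + ‖L c‖ + 1 < ‖b / (ζ - c)‖ := by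
    rw [norm_div, lt_div_iff₀ hpos, mul_comm]
    exact h2
  have h4 := norm_sub_norm_le (b / (ζ - c)) (-L ζ)
  rw [norm_neg, sub_neg_eq_add, add_comm (b / (ζ - c))] at h4
  linarith [le_abs_self R]

/-- The closed annulus without the pole. -/
def closedRegularDomain (ρ : ℝ) (b c : ℂ) : Set ℂ := {ζ ∈ closedMapDomain ρ | b ≠ 0 → ζ ≠ c}

/-- A Laurent map is proper. -/
theorem IsLaurentMap.isCompact_preimage {ρ : ℝ} (hρ : 0 ≤ ρ) {a : ℤ → ℂ} {b c : ℂ} {z : ℂ → ℂ}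
    (h : IsLaurentMap ρ a b c z) {K : Set ℂ} (hK : IsCompact K) :
    IsCompact (closedRegularDomain ρ b c ∩ z ⁻¹' K) := by
  obtain ⟨T, hT, hTK⟩ : ∃ T : Set ℂ, IsCompact T ∧ T ⊆ closedRegularDomain ρ b c ∧
      closedRegularDomain ρ b c ∩ z ⁻¹' K ⊆ T := by
    by_cases hb : b = 0
    · have : closedRegularDomain ρ b c = closedMapDomain ρ := by
        ext ζ; simp [closedRegularDomain, hb]
      rw [this]
      exact ⟨_, isCompact_closedMapDomain ρ, Subset.rfl, inter_subset_left⟩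
    · obtain ⟨R, hR⟩ := hK.isBounded.exists_norm_le
      obtain ⟨δ, hδ, hball, hlarge⟩ := h.exists_near_pole hρ hb R
      refine ⟨closedMapDomain ρ ∩ (Metric.ball c δ)ᶜ, (isCompact_closedMapDomain ρ).inter_right
        Metric.isOpen_ball.isClosed_compl, fun ζ hζ => ⟨hζ.1, fun _ hc => hζ.2 ?_⟩,
        fun ζ hζ => ⟨hζ.1.1, fun hc => ?_⟩⟩
      · rw [hc]; exact Metric.mem_ball_self hδ
      · exact (hlarge ζ hc (hζ.1.2 hb)).not_ge (hR _ hζ.2)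
  have hc := (h.continuousOn.mono hTK.1).preimage_isClosed_of_isClosed hT.isClosed hK.isClosed
  have : closedRegularDomain ρ b c ∩ z ⁻¹' K = T ∩ z ⁻¹' K :=
    Subset.antisymm (fun ζ hζ => ⟨hTK.2 hζ, hζ.2⟩) (fun ζ hζ => ⟨hTK.1 hζ.1, hζ.2⟩)
  rw [this]
  exact hT.of_isClosed_subset hc inter_subset_left

theorem collar_subset_regularDomain {ρ s : ℝ} {b c : ℂ} (hρs : ρ ≤ s) (hcs : ‖c‖ ≤ s) :
    collar s ⊆ regularDomain ρ b c := fun ζ hζ =>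
  ⟨⟨hζ.2, fun _ => hρs.trans_lt hζ.1⟩, fun _ hc => by
    have := hζ.1
    rw [hc] at this
    linarith⟩

/-! ### The Blasius formula for fixed coefficients of the map -/

theorem dbar_ofReal_mul {X : ℂ → ℝ} {z : ℂ → ℂ} {ζ : ℂ} (hX : DifferentiableAt ℝ X ζ)
    (hz : DifferentiableAt ℂ z ζ) :
    dbar (fun ζ => (X ζ : ℂ) * z ζ) ζ = z ζ * dbar (fun ζ => (X ζ : ℂ)) ζ := by
  have h1 : HasFDerivAt (fun ζ => (X ζ : ℂ)) (Complex.ofRealCLM.comp (fderiv ℝ X ζ)) ζ :=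
    Complex.ofRealCLM.hasFDerivAt.comp ζ hX.hasFDerivAt
  have h2 := (hz.hasDerivAt.hasFDerivAt.restrictScalars ℝ)
  have h3 : fderiv ℝ (fun ζ => (X ζ : ℂ) * z ζ) ζ = _ := (h1.mul h2).fderiv
  rw [dbar_ofReal hX, dbar, h3]
  simp
  linear_combination ((X ζ : ℂ) * deriv z ζ) * Complex.I_mul_I

theorem norm_fderiv_re_le (M : ℂ → ℂ) {ζ : ℂ} (hM : DifferentiableAt ℝ M ζ) :
    ‖fderiv ℝ (fun ζ => -(M ζ).re) ζ‖ ≤ ‖fderiv ℝ M ζ‖ := by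
  have h : HasFDerivAt (fun ζ => -(M ζ).re) (-(Complex.reCLM.comp (fderiv ℝ M ζ))) ζ :=
    (Complex.reCLM.hasFDerivAt.comp ζ hM.hasFDerivAt).neg
  rw [h.fderiv, norm_neg]
  refine (ContinuousLinearMap.opNorm_comp_le _ _).trans ?_
  simp

theorem norm_fderiv_im_le_norm (M : ℂ → ℂ) {ζ : ℂ} (hM : DifferentiableAt ℝ M ζ) :
    ‖fderiv ℝ (fun ζ => (M ζ).im) ζ‖ ≤ ‖fderiv ℝ M ζ‖ := by
  have h : HasFDerivAt (fun ζ => (M ζ).im) (Complex.imCLM.comp (fderiv ℝ M ζ)) ζ :=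
    Complex.imCLM.hasFDerivAt.comp ζ hM.hasFDerivAt
  rw [h.fderiv]
  refine (ContinuousLinearMap.opNorm_comp_le _ _).trans ?_
  simp

theorem integrableOn_sq_of_norm_le {U : Set ℂ} (hU : IsOpen U) {M : ℂ → ℂ} {f : ℂ → ℝ}
    (hM2 : IntegrableOn (fun ζ => ‖fderiv ℝ M ζ‖ ^ 2) U)
    (hf : ∀ ζ ∈ U, ‖fderiv ℝ f ζ‖ ≤ ‖fderiv ℝ M ζ‖) :
    IntegrableOn (fun ζ => ‖fderiv ℝ f ζ‖ ^ 2) U := by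
  refine hM2.mono' ((measurable_fderiv ℝ _).norm.pow_const 2).aestronglyMeasurable ?_
  filter_upwards [ae_restrict_mem hU.measurableSet] with ζ hζ
  rw [Real.norm_of_nonneg (sq_nonneg _)]
  exact pow_le_pow_left₀ (norm_nonneg _) (hf ζ hζ) 2

theorem abs_det_toSpanSingleton (a : ℂ) :
    |((ContinuousLinearMap.toSpanSingleton ℂ a).restrictScalars ℝ : ℂ →L[ℝ] ℂ).det| =
      ‖a‖ ^ 2 := by
  have h : ((ContinuousLinearMap.toSpanSingleton ℂ a).restrictScalars ℝ : ℂ →L[ℝ] ℂ).det =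
      Algebra.norm ℝ a := by
    have e : (((ContinuousLinearMap.toSpanSingleton ℂ a).restrictScalars ℝ : ℂ →L[ℝ] ℂ) :
        ℂ →ₗ[ℝ] ℂ) = Algebra.lmul ℝ ℂ a := by
      refine LinearMap.ext fun v => ?_
      simp [mul_comm]
    rw [Algebra.norm_apply, ContinuousLinearMap.det, e]
  rw [h, Algebra.norm_complex_apply, Complex.normSq_eq_norm_sq, abs_of_nonneg (sq_nonneg _)]

/-- The area of the image of an injective holomorphic map is the integral of `‖z'‖ ^ 2`; so the
latter is finite if the image is bounded. -/
theorem integrableOn_deriv_sq_of_injOn {A : Set ℂ} (hA : IsOpen A) {z : ℂ → ℂ}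
    (hz : DifferentiableOn ℂ z A) (hinj : InjOn z A) {C : ℝ} (hC : ∀ ζ ∈ A, ‖z ζ‖ ≤ C) :
    IntegrableOn (fun ζ => ‖deriv z ζ‖ ^ 2) A := by
  have h := integrableOn_image_iff_integrableOn_abs_det_fderiv_smul volume hA.measurableSet
    (fun ζ hζ => ((hz.differentiableAt (hA.mem_nhds hζ)).hasDerivAt.hasFDerivAt.restrictScalars
      ℝ).hasFDerivWithinAt) hinj (fun _ => (1 : ℝ))
  simp only [abs_det_toSpanSingleton, smul_eq_mul, mul_one] at h
  rw [← h]
  refine integrableOn_const (ne_top_of_le_ne_top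
    (isCompact_closedBall (0 : ℂ) C).measure_ne_top (measure_mono ?_))
  rintro _ ⟨ζ, hζ, rfl⟩
  simpa using hC ζ hζ

theorem norm_fderiv_eq_norm_deriv {z : ℂ → ℂ} {ζ : ℂ} (hz : DifferentiableAt ℂ z ζ) :
    ‖fderiv ℝ z ζ‖ = ‖deriv z ζ‖ := by
  rw [(hz.hasDerivAt.hasFDerivAt.restrictScalars ℝ).fderiv]
  simp

theorem integrableOn_of_isCompact {U K : Set ℂ} (hU : MeasurableSet U) (hK : IsCompact K)
    {f : ℂ → ℂ} (hf : ContinuousOn f K) (h0 : ∀ z ∈ U, z ∉ K → f z = 0) : IntegrableOn f U := by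
  have h1 : IntegrableOn f (U ∩ K) := (hf.integrableOn_compact hK).mono_set inter_subset_right
  exact h1.of_forall_sdiff_eq_zero hU fun z hz => h0 z hz.1 fun h => hz.2 ⟨hz.1, h⟩

section radial

variable {σ s t : ℝ} {z W : ℂ → ℂ}

theorem contDiffOn_radialCutoff_mul (hσ : 0 ≤ σ) (hs : σ < s) (hst : s < t)
    (hz : DifferentiableOn ℂ z (collar σ)) :
    ContDiffOn ℝ 2 (fun ζ => (radialCutoff s t ζ : ℂ) * z ζ) (Metric.ball 0 1) := by
  intro ζ hζ
  rcases lt_or_ge ‖ζ‖ s with h | h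
  · have : (fun ζ => (radialCutoff s t ζ : ℂ) * z ζ) =ᶠ[𝓝 ζ] fun _ => 0 := by
      filter_upwards [continuous_norm.continuousAt.eventually_lt_const h] with y hy
      rw [radialCutoff_of_le (hσ.trans_lt hs) hst (le_of_lt hy)]
      simp
    exact (contDiffAt_const.congr_of_eventuallyEq this).contDiffWithinAt
  · have hc : ζ ∈ collar σ := ⟨hs.trans_le h, by simpa using hζ⟩
    have h1 : ContDiffAt ℝ 2 (fun ζ => (radialCutoff s t ζ : ℂ)) ζ :=
      (Complex.ofRealCLM.contDiff.comp (contDiff_radialCutoff s t (n := 2))).contDiffAt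
    have h2 : ContDiffAt ℝ 2 z ζ :=
      (contDiffOn_real (isOpen_collar σ) hz (n := 2)).contDiffAt ((isOpen_collar σ).mem_nhds hc)
    exact (h1.mul h2).contDiffWithinAt

theorem dbar_radialCutoff_eq_zero (hs : 0 < s) (hst : s < t) {ζ : ℂ} (h : ‖ζ‖ < s ∨ t < ‖ζ‖) :
    dbar (fun ζ => (radialCutoff s t ζ : ℂ)) ζ = 0 := by
  rw [dbar_radialCutoff]
  rcases h with h | h
  · rw [deriv_radialProfile_of_lt hs hst (pow_lt_pow_left₀ h (norm_nonneg _) two_ne_zero)]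
    simp
  · rw [deriv_radialProfile_of_gt hs hst (pow_lt_pow_left₀ h (hs.trans hst).le two_ne_zero)]
    simp

theorem dbar_radialCutoff_mul (hσ : 0 ≤ σ) (hs : σ < s) (hst : s < t)
    (hz : DifferentiableOn ℂ z (collar σ)) {ζ : ℂ} (hζ : ‖ζ‖ < 1) :
    dbar (fun ζ => (radialCutoff s t ζ : ℂ) * z ζ) ζ =
      z ζ * dbar (fun ζ => (radialCutoff s t ζ : ℂ)) ζ := by
  rcases lt_or_ge ‖ζ‖ s with h | h
  · have : (fun ζ => (radialCutoff s t ζ : ℂ) * z ζ) =ᶠ[𝓝 ζ] fun _ => 0 := by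
      filter_upwards [continuous_norm.continuousAt.eventually_lt_const h] with y hy
      rw [radialCutoff_of_le (hσ.trans_lt hs) hst (le_of_lt hy)]
      simp
    rw [dbar_radialCutoff_eq_zero (hσ.trans_lt hs) hst (Or.inl h), dbar, this.fderiv_eq]
    simp
  · exact dbar_ofReal_mul ((contDiff_radialCutoff s t (n := 1)).differentiable one_ne_zero ζ)
      (hz.differentiableAt ((isOpen_collar σ).mem_nhds ⟨hs.trans_le h, hζ⟩))

theorem integral_im_dbar_radial (hσ : 0 ≤ σ) (hs : σ < s) (hst : s < t) (ht : t < 1)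
    (hz : DifferentiableOn ℂ z (collar σ)) (hW : DifferentiableOn ℂ W (collar σ)) {U : Set ℂ}
    (hU : IsOpen U) (hUball : U ⊆ Metric.ball 0 1) (hcU : collar σ ⊆ U) :
    ∫ ζ in U, (deriv W ζ * dbar (fun ζ => (radialCutoff s t ζ : ℂ) * z ζ) ζ).im =
      2 * Real.pi * (blasiusResidue z W s).im := by
  have hs0 := hσ.trans_lt hs
  set F : ℂ → ℂ := fun ζ => z ζ * deriv W ζ * dbar (fun ζ => (radialCutoff s t ζ : ℂ)) ζ with hF
  have e1 : ∫ ζ in U, (deriv W ζ * dbar (fun ζ => (radialCutoff s t ζ : ℂ) * z ζ) ζ).im =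
      ∫ ζ in U, (F ζ).im := setIntegral_congr_fun hU.measurableSet fun ζ hζ => by
    simp only [hF]
    rw [dbar_radialCutoff_mul hσ hs hst hz (by simpa using hUball hζ)]
    ring_nf
  have hoff : ∀ ζ ∈ U, ζ ∉ {ζ : ℂ | s ≤ ‖ζ‖ ∧ ‖ζ‖ ≤ t} → F ζ = 0 := fun ζ _ h => by
    rw [mem_ofPred_eq, not_and_or, not_le, not_le] at h
    simp only [hF]
    rw [dbar_radialCutoff_eq_zero hs0 hst h, mul_zero]
  have hK : IsCompact {ζ : ℂ | s ≤ ‖ζ‖ ∧ ‖ζ‖ ≤ t} := by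
    refine (isCompact_closedBall (0 : ℂ) t).of_isClosed_subset
      ((isClosed_le continuous_const continuous_norm).inter
        (isClosed_le continuous_norm continuous_const)) fun ζ hζ => by simpa using hζ.2
  have hKc : {ζ : ℂ | s ≤ ‖ζ‖ ∧ ‖ζ‖ ≤ t} ⊆ collar σ := fun ζ hζ =>
    ⟨hs.trans_le hζ.1, hζ.2.trans_lt ht⟩
  have hdc : Continuous (dbar fun ζ => (radialCutoff s t ζ : ℂ)) := by
    rw [show (dbar fun ζ => (radialCutoff s t ζ : ℂ)) = _ from funext (dbar_radialCutoff s t)]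
    have := (contDiff_radialProfile s t (n := 1)).continuous_deriv le_rfl
    fun_prop
  have hFc : ContinuousOn F (collar σ) :=
    (hz.continuousOn.mul (hW.deriv (isOpen_collar σ)).continuousOn).mul hdc.continuousOn
  have hFi : IntegrableOn F U :=
    integrableOn_of_isCompact hU.measurableSet hK (hFc.mono hKc) hoff
  have e2 : ∫ ζ in U, (F ζ).im = (∫ ζ in U, F ζ).im := Complex.imCLM.integral_comp_comm hFi
  have e3 : ∫ ζ in U, F ζ = ∫ ζ in collar σ, F ζ :=
    setIntegral_eq_of_subset_of_forall_sdiff_eq_zero hU.measurableSet hcU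
      fun ζ hζ => hoff ζ hζ.1 fun h => hζ.2 (hKc h)
  rw [e1, e2, e3, hF, integral_blasius hσ hs hst ht hz hW hs (hst.trans ht)]
  simp [mul_assoc]

end radial

theorem isCutoff_radial {ρ s t : ℝ} (hs0 : 0 < s) (hρs : ρ < s) (hst : s < t) (ht : t < 1) :
    IsCutoff (Metric.ball 0 1) (Metric.closedBall 0 ρ) (radialCutoff s t) where
  contDiff := contDiff_radialCutoff s t (n := 2)
  bounded := ⟨1, abs_radialCutoff_le s t⟩
  compact := by
    refine ⟨{ζ : ℂ | s ≤ ‖ζ‖ ∧ ‖ζ‖ ≤ t}, ?_, fun ζ hζ => ⟨?_, ?_⟩, fun ζ hζ => ?_⟩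
    · exact (isCompact_closedBall (0 : ℂ) t).of_isClosed_subset
        ((isClosed_le continuous_const continuous_norm).inter
          (isClosed_le continuous_norm continuous_const)) fun ζ hζ => by simpa using hζ.2
    · simpa using hζ.2.trans_lt ht
    · simpa using hρs.trans_le hζ.1
    · rw [mem_ofPred_eq, not_and_or, not_le, not_le] at hζ
      rcases hζ with h | h
      · have : radialCutoff s t =ᶠ[𝓝 ζ] fun _ => 0 := by
          filter_upwards [continuous_norm.continuousAt.eventually_lt_const h] with y hy
            using radialCutoff_of_le hs0 hst (le_of_lt hy)
        rw [this.fderiv_eq]; simp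
      · have : radialCutoff s t =ᶠ[𝓝 ζ] fun _ => 1 := by
          filter_upwards [continuous_norm.continuousAt.eventually_const_lt h] with y hy
            using radialCutoff_of_ge hs0 hst (le_of_lt hy)
        rw [this.fderiv_eq]; simp
  outer := fun p hp => by
    have h : t < ‖p‖ := by
      rw [frontier_ball _ one_ne_zero] at hp
      rwa [mem_sphere_zero_iff_norm.1 hp]
    filter_upwards [continuous_norm.continuousAt.eventually_const_lt h] with y hy
      using radialCutoff_of_ge hs0 hst (le_of_lt hy)
  inner := fun p hp => by
    have h : ‖p‖ < s := (mem_closedBall_zero_iff.1 hp).trans_lt hρs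
    filter_upwards [continuous_norm.continuousAt.eventually_lt_const h] with y hy
      using radialCutoff_of_le hs0 hst (le_of_lt hy)

theorem integrableOn_fderiv_radial {σ s t : ℝ} {z : ℂ → ℂ} (hσ : 0 ≤ σ) (hs : σ < s)
    (hst : s < t) (ht : t < 1) (hz : DifferentiableOn ℂ z (collar σ))
    (hz2 : IntegrableOn (fun ζ => ‖deriv z ζ‖ ^ 2) (collar t)) :
    IntegrableOn (fun ζ => ‖fderiv ℝ (fun ζ => (radialCutoff s t ζ : ℂ) * z ζ) ζ‖ ^ 2)
      (Metric.ball 0 1) := by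
  have hM := contDiffOn_radialCutoff_mul hσ hs hst hz
  set M : ℂ → ℂ := fun ζ => (radialCutoff s t ζ : ℂ) * z ζ with hMdef
  have h1 : IntegrableOn (fun ζ => ‖fderiv ℝ M ζ‖ ^ 2) (Metric.closedBall 0 t) := by
    refine ContinuousOn.integrableOn_compact (isCompact_closedBall _ _) ?_
    refine ContinuousOn.mono ?_ (Metric.closedBall_subset_ball ht)
    exact ((hM.continuousOn_fderiv_of_isOpen Metric.isOpen_ball one_le_two).norm).pow 2
  have h2 : IntegrableOn (fun ζ => ‖fderiv ℝ M ζ‖ ^ 2) (collar t) := by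
    refine hz2.congr_fun (fun ζ hζ => ?_) (isOpen_collar t).measurableSet
    have : M =ᶠ[𝓝 ζ] z := by
      filter_upwards [continuous_norm.continuousAt.eventually_const_lt hζ.1] with y hy
      simp [hMdef, radialCutoff_of_ge (hσ.trans_lt hs) hst (le_of_lt hy)]
    simp only
    rw [this.fderiv_eq, norm_fderiv_eq_norm_deriv (hz.differentiableAt
      ((isOpen_collar σ).mem_nhds ⟨(hs.trans hst).trans hζ.1, hζ.2⟩))]
  refine (h1.union h2).mono_set fun ζ hζ => ?_
  rcases le_or_gt ‖ζ‖ t with h | h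
  · exact Or.inl (by simpa using h)
  · exact Or.inr ⟨h, by simpa using hζ⟩

/-- A potential in the annulus `mapDomain ρ`, seen as a flow in the unit disc with the obstacle
`D`, which is the inner disc or empty. -/
theorem IsMappedPotential.isObstacleFlow {ρ : ℝ} {D : Set ℂ} {s t : ℝ} {z W : ℂ → ℂ}
    (hs0 : 0 < s) (hst : s < t) (ht : t < 1)
    (hD : Metric.ball 0 1 \ D = mapDomain ρ) (hρ : 0 ≤ ρ) (hDρ : ∀ p ∈ D, 0 < ρ ∧ ‖p‖ ≤ ρ)
    (hρ1 : ρ < 1)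
    (hz : ContinuousOn z {ζ | t ≤ ‖ζ‖ ∧ ‖ζ‖ ≤ 1}) (hW : IsMappedPotential ρ z Complex.I W) :
    IsObstacleFlow (Metric.ball 0 1) D
      (fun ζ => -((radialCutoff s t ζ : ℂ) * z ζ).re) W := by
  obtain ⟨ψ, hψc, hψ, ⟨β, hβ⟩, hγ⟩ := hW.no_flux
  have hlim : ∀ p ∈ closedMapDomain ρ,
      Tendsto (fun ζ => (W ζ).im) (𝓝[mapDomain ρ] p) (𝓝 (ψ p)) := fun p hp => by
    refine ((hψc p hp).mono (mapDomain_subset_closed hρ)).tendsto.congr' ?_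
    filter_upwards [self_mem_nhdsWithin] with ζ hζ using hψ ζ hζ
  refine ⟨hD ▸ hW.holomorphic, ⟨β, fun p hp => ?_⟩, ?_, ?_, ⟨1, ?_⟩⟩
  · rw [hD]
    rw [frontier_ball _ one_ne_zero, mem_sphere_zero_iff_norm] at hp
    have h1 := hlim p ⟨hp.le, by rw [hp]; exact hρ1.le⟩
    have h2 : Tendsto z (𝓝[mapDomain ρ] p) (𝓝 (z p)) := by
      have h3 : {ζ : ℂ | t ≤ ‖ζ‖ ∧ ‖ζ‖ ≤ 1} ∈ 𝓝[mapDomain ρ] p := by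
        filter_upwards [self_mem_nhdsWithin, mem_nhdsWithin_of_mem_nhds
          (continuous_norm.continuousAt.eventually_const_lt (show t < ‖p‖ by rwa [hp]))]
          with y hy hy'
        exact ⟨le_of_lt hy', hy.1.le⟩
      exact (hz p ⟨by rw [hp]; exact ht.le, hp.le⟩).mono_left
        (nhdsWithin_le_iff.2 h3)
    have h4 := h1.add ((Complex.continuous_re.tendsto _).comp h2)
    rw [hβ p hp] at h4
    have e : (conj Complex.I * z p).im + β + (z p).re = β := by simp
    rw [e] at h4
    refine h4.congr' ?_
    filter_upwards [mem_nhdsWithin_of_mem_nhds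
      (continuous_norm.continuousAt.eventually_const_lt (show t < ‖p‖ by rwa [hp]))] with y hy
    simp [radialCutoff_of_ge hs0 hst (le_of_lt hy)]
  · by_cases h0 : 0 < ρ
    · obtain ⟨γ, hγ⟩ := hγ h0
      refine ⟨γ, fun p hp => ?_⟩
      rw [hD]
      rcases (hDρ p hp).2.lt_or_eq with h | h
      · have : 𝓝[mapDomain ρ] p = ⊥ := by
          rw [← notMem_closure_iff_nhdsWithin_eq_bot, mem_closure_iff]
          intro h1
          obtain ⟨y, hy, hy'⟩ := h1 _ (isOpen_lt continuous_norm continuous_const) h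
          exact (hy'.2 h0).not_gt hy
        rw [this]; exact tendsto_bot
      · rw [← hγ p h]
        exact hlim p ⟨by rw [h]; exact hρ1.le, h.ge⟩
    · exact ⟨0, fun p hp => absurd (hDρ p hp).1 h0⟩
  · obtain ⟨C, hC⟩ := (isCompact_closedMapDomain ρ).exists_bound_of_continuousOn hψc
    refine ⟨C, fun ζ hζ => ?_⟩
    rw [hD] at hζ
    rw [← hψ ζ hζ]
    exact hC ζ (mapDomain_subset_closed hρ hζ)
  · have : (Metric.ball (0 : ℂ) 1 \ D) ∩ {z | 1 ≤ ‖z‖} = ∅ := by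
      refine eq_empty_of_forall_notMem fun ζ hζ => ?_
      have h1 : ‖ζ‖ < 1 := mem_ball_zero_iff.1 hζ.1.1
      exact (hζ.2 : 1 ≤ ‖ζ‖).not_gt h1
    rw [this]
    exact integrableOn_empty

theorem blasius_le_of_fixed_coefficients {A ρ : ℝ} {a : ℤ → ℂ} {b c : ℂ} {z W W₀ : ℂ → ℂ}
    (hA : 0 < A) (hρ : 0 < ρ) (hρ1 : ρ < 1) (hz : IsLaurentMap ρ a b c z)
    (hW : IsMappedPotential ρ z Complex.I W) (hW₀ : IsMappedPotential 0 z Complex.I W₀) :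
    ∃ Ca Ca₀ : ℝ, HasBlasiusAddedMass A z W Ca ∧ HasBlasiusAddedMass A z W₀ Ca₀ ∧ Ca₀ ≤ Ca := by
  set σ := max ρ ‖c‖ with hσdef
  have hσ1 : σ < 1 := max_lt hρ1 hz.pole_mem.1
  have hσ : 0 ≤ σ := hρ.le.trans (le_max_left _ _)
  obtain ⟨s, hs, hs1⟩ := exists_between hσ1
  obtain ⟨t, hst, ht⟩ := exists_between hs1
  have hs0 : 0 < s := hσ.trans_lt hs
  have hcol : ∀ {r}, σ ≤ r → collar r ⊆ regularDomain ρ b c := fun hr =>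
    collar_subset_regularDomain ((le_max_left _ _).trans hr) ((le_max_right _ _).trans hr)
  have hzd := (hz.differentiableOn hρ.le).mono (hcol le_rfl)
  have hball₀ : Metric.ball (0 : ℂ) 1 = mapDomain 0 := by ext ζ; simp [mapDomain]
  have hball : Metric.ball (0 : ℂ) 1 \ Metric.closedBall 0 ρ = mapDomain ρ := by
    ext ζ; simp [mapDomain, hρ]
  have hcball : collar σ ⊆ mapDomain ρ := fun ζ hζ => (hcol le_rfl hζ).1
  have hcball₀ : collar σ ⊆ mapDomain 0 := fun ζ hζ => hball₀ ▸ mem_ball_zero_iff.2 hζ.2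
  have hWd := hW.holomorphic.mono hcball
  have hWd₀ := hW₀.holomorphic.mono hcball₀
  refine ⟨_, _, hasBlasiusAddedMass hσ hzd hWd hs hs1 A, hasBlasiusAddedMass hσ hzd hWd₀ hs hs1 A,
    ?_⟩
  have hzc : ContinuousOn z {ζ | s ≤ ‖ζ‖ ∧ ‖ζ‖ ≤ 1} := hz.continuousOn.mono fun ζ hζ =>
    ⟨⟨hζ.2, ((le_max_left _ _).trans hs.le).trans hζ.1⟩, fun _ hc => by
      have h1 : s ≤ ‖ζ‖ := hζ.1
      rw [hc] at h1
      exact ((le_max_right _ _).trans_lt hs).not_ge h1⟩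
  have hcpt : IsCompact {ζ : ℂ | s ≤ ‖ζ‖ ∧ ‖ζ‖ ≤ 1} :=
    (isCompact_closedBall (0 : ℂ) 1).of_isClosed_subset
      ((isClosed_le continuous_const continuous_norm).inter
        (isClosed_le continuous_norm continuous_const)) fun ζ hζ => by simpa using hζ.2
  obtain ⟨C, hC⟩ := hcpt.exists_bound_of_continuousOn hzc
  have hC0 : 0 ≤ C := (norm_nonneg _).trans (hC 1 ⟨by simpa using hs1.le, by simp⟩)
  have hz2 : IntegrableOn (fun ζ => ‖deriv z ζ‖ ^ 2) (collar t) :=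
    integrableOn_deriv_sq_of_injOn (isOpen_collar t) (hzd.mono fun ζ hζ =>
      ⟨(hs.trans hst).trans hζ.1, hζ.2⟩) (hz.injOn.mono (hcol (hs.trans hst).le))
      fun ζ hζ => hC ζ ⟨(hst.trans hζ.1).le, hζ.2.le⟩
  have hM := contDiffOn_radialCutoff_mul hσ hs hst hzd
  have hM2 := integrableOn_fderiv_radial hσ hs hst ht hzd hz2
  have hMd : ∀ ζ ∈ Metric.ball (0 : ℂ) 1, DifferentiableAt ℝ
      (fun ζ => (radialCutoff s t ζ : ℂ) * z ζ) ζ := fun ζ hζ =>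
    (hM.contDiffAt (Metric.isOpen_ball.mem_nhds hζ)).differentiableAt two_ne_zero
  have hdata : IsBoundaryData (Metric.ball 0 1) (Metric.closedBall 0 ρ)
      fun ζ => -((radialCutoff s t ζ : ℂ) * z ζ).re := by
    refine ⟨(Complex.reCLM.contDiff.comp_contDiffOn (hM.of_le one_le_two)).neg,
      integrableOn_sq_of_norm_le Metric.isOpen_ball hM2 fun ζ hζ => norm_fderiv_re_le _ (hMd ζ hζ),
      ⟨C, fun ζ hζ => ?_⟩, fun p hp => ?_⟩
    · rw [abs_neg]
      refine (Complex.abs_re_le_norm _).trans ?_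
      rw [norm_mul, Complex.norm_real, Real.norm_eq_abs]
      rcases le_total ‖ζ‖ s with h | h
      · rw [radialCutoff_of_le hs0 hst h]; simpa using hC0
      · exact (mul_le_of_le_one_left (norm_nonneg _) (abs_radialCutoff_le s t ζ)).trans
          (hC ζ ⟨h, (mem_ball_zero_iff.1 hζ).le⟩)
    · have h : ‖p‖ < s := (mem_closedBall_zero_iff.1 hp).trans_lt ((le_max_left _ _).trans_lt hs)
      filter_upwards [continuous_norm.continuousAt.eventually_lt_const h] with y hy
      rw [radialCutoff_of_le hs0 hst (le_of_lt hy)]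
      simp
  have hzct : ContinuousOn z {ζ | t ≤ ‖ζ‖ ∧ ‖ζ‖ ≤ 1} :=
    hzc.mono fun ζ hζ => ⟨hst.le.trans hζ.1, hζ.2⟩
  have hflow := hW.isObstacleFlow hs0 hst ht hball hρ.le
    (fun p hp => ⟨hρ, mem_closedBall_zero_iff.1 hp⟩) hρ1 hzct
  have hflow₀ := hW₀.isObstacleFlow (D := ∅) hs0 hst ht (by rw [sdiff_empty, hball₀]) le_rfl
    (by simp) one_pos hzct
  have key := hflow.integral_im_dbar_le Metric.isOpen_ball Metric.isClosed_closedBall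
    (Metric.closedBall_subset_ball hρ1) hM hflow₀ hdata
    (integrableOn_sq_of_norm_le Metric.isOpen_ball hM2 fun ζ hζ =>
      norm_fderiv_im_le_norm _ (hMd ζ hζ))
    (isCutoff_radial hs0 ((le_max_left _ _).trans_lt hs) hst ht)
  rw [integral_im_dbar_radial hσ hs hst ht hzd hWd (hball ▸ isOpen_mapDomain ρ) sdiff_subset
    (hball ▸ hcball), integral_im_dbar_radial hσ hs hst ht hzd hWd₀ Metric.isOpen_ball Subset.rfl
    (hball₀ ▸ hcball₀)] at key
  have h1 : (blasiusResidue z W s).im ≤ (blasiusResidue z W₀ s).im :=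
    le_of_mul_le_mul_left key (by positivity)
  have h2 : 0 ≤ 2 * Real.pi / A := by positivity
  have := mul_le_mul_of_nonneg_left h1 h2
  linarith

/-! ### Injective holomorphic maps -/

section injective

variable {A : Set ℂ} {z : ℂ → ℂ}

theorem not_eventually_const_of_injOn (hA : IsOpen A) (hinj : InjOn z A) {ζ : ℂ} (hζ : ζ ∈ A) :
    ¬ ∀ᶠ ξ in 𝓝 ζ, z ξ = z ζ := fun h => by
  have hA' : ∀ᶠ ξ in 𝓝 ζ, ξ ∈ A := hA.mem_nhds hζ
  have h1 : ∀ᶠ ξ in 𝓝[≠] ζ, z ξ = z ζ ∧ ξ ∈ A ∧ ξ ≠ ζ :=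
    (h.filter_mono nhdsWithin_le_nhds).and
      ((hA'.filter_mono nhdsWithin_le_nhds).and self_mem_nhdsWithin)
  obtain ⟨ξ, h2, h3, h4⟩ := h1.exists
  exact h4 (hinj h3 hζ h2)

theorem nhds_le_map_of_injOn (hA : IsOpen A) (hz : DifferentiableOn ℂ z A) (hinj : InjOn z A)
    {ζ : ℂ} (hζ : ζ ∈ A) : 𝓝 (z ζ) ≤ map z (𝓝 ζ) :=
  (hz.analyticAt (hA.mem_nhds hζ)).eventually_constant_or_nhds_le_map_nhds.resolve_left
    (not_eventually_const_of_injOn hA hinj hζ)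

theorem invFunOn_apply (hinj : InjOn z A) {ζ : ℂ} (hζ : ζ ∈ A) :
    Function.invFunOn z A (z ζ) = ζ :=
  hinj.leftInvOn_invFunOn hζ

theorem continuousAt_invFunOn (hA : IsOpen A) (hz : DifferentiableOn ℂ z A) (hinj : InjOn z A)
    {ζ : ℂ} (hζ : ζ ∈ A) : ContinuousAt (Function.invFunOn z A) (z ζ) := by
  rw [ContinuousAt, invFunOn_apply hinj hζ]
  refine (tendsto_map' ?_).mono_left (nhds_le_map_of_injOn hA hz hinj hζ)
  refine tendsto_id.congr' ?_
  filter_upwards [hA.mem_nhds hζ] with ξ hξ using (invFunOn_apply hinj hξ).symm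

theorem eventually_apply_invFunOn (hA : IsOpen A) (hz : DifferentiableOn ℂ z A)
    (hinj : InjOn z A) {ζ : ℂ} (hζ : ζ ∈ A) :
    ∀ᶠ x in 𝓝 (z ζ), z (Function.invFunOn z A x) = x := by
  refine nhds_le_map_of_injOn hA hz hinj hζ (mem_map.2 ?_)
  filter_upwards [hA.mem_nhds hζ] with ξ hξ
  change z (Function.invFunOn z A (z ξ)) = z ξ
  rw [invFunOn_apply hinj hξ]

theorem hasDerivAt_invFunOn_of_ne_zero (hA : IsOpen A) (hz : DifferentiableOn ℂ z A)
    (hinj : InjOn z A) {ζ : ℂ} (hζ : ζ ∈ A) (h0 : deriv z ζ ≠ 0) :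
    HasDerivAt (Function.invFunOn z A) (deriv z ζ)⁻¹ (z ζ) := by
  refine HasDerivAt.of_local_left_inverse (continuousAt_invFunOn hA hz hinj hζ) ?_ h0
    (eventually_apply_invFunOn hA hz hinj hζ)
  rw [invFunOn_apply hinj hζ]
  exact (hz.differentiableAt (hA.mem_nhds hζ)).hasDerivAt

/-- The derivative of an injective holomorphic function has no zeros: the zeros would be isolated,
so the inverse function would have a removable singularity there. -/
theorem deriv_ne_zero_of_injOn (hA : IsOpen A) (hz : DifferentiableOn ℂ z A) (hinj : InjOn z A)
    {ζ : ℂ} (hζ : ζ ∈ A) : deriv z ζ ≠ 0 := by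
  intro h0
  rcases ((hz.deriv hA).analyticAt
    (hA.mem_nhds hζ)).eventually_eq_zero_or_eventually_ne_zero with h | h
  · obtain ⟨δ, hδ, hball⟩ := Metric.mem_nhds_iff.1 (Filter.inter_mem h (hA.mem_nhds hζ))
    refine not_eventually_const_of_injOn hA hinj hζ ?_
    filter_upwards [Metric.ball_mem_nhds ζ hδ] with ξ hξ
    exact Metric.isOpen_ball.is_const_of_deriv_eq_zero (convex_ball ζ δ).isPreconnected
      (hz.mono fun y hy => (hball hy).2) (fun y hy => (hball hy).1) hξ (Metric.mem_ball_self hδ)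
  · rw [eventually_nhdsWithin_iff] at h
    set N : Set ℂ := {ξ | (ξ ≠ ζ → deriv z ξ ≠ 0) ∧ ξ ∈ A}
    have hN : N ∈ 𝓝 ζ := Filter.inter_mem h (hA.mem_nhds hζ)
    have hs : z '' N ∈ 𝓝 (z ζ) :=
      nhds_le_map_of_injOn hA hz hinj hζ (mem_map.2 (mem_of_superset hN (subset_preimage_image z N)))
    have hd : DifferentiableOn ℂ (Function.invFunOn z A) (z '' N \ {z ζ}) := by
      rintro _ ⟨⟨ξ, hξ, rfl⟩, hne⟩
      have hne' : ξ ≠ ζ := fun h => hne (by rw [h]; rfl)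
      exact (hasDerivAt_invFunOn_of_ne_zero hA hz hinj hξ.2
        (hξ.1 hne')).differentiableAt.differentiableWithinAt
    have h1 := ((Complex.differentiableOn_compl_singleton_and_continuousAt_iff hs).1
      ⟨hd, continuousAt_invFunOn hA hz hinj hζ⟩).differentiableAt hs
    have h2 := h1.hasDerivAt.comp ζ (hz.differentiableAt (hA.mem_nhds hζ)).hasDerivAt
    have h3 : HasDerivAt (Function.invFunOn z A ∘ z) 1 ζ := by
      refine (hasDerivAt_id ζ).congr_of_eventuallyEq ?_
      filter_upwards [hA.mem_nhds hζ] with ξ hξ using invFunOn_apply hinj hξ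
    have := h2.unique h3
    rw [h0, mul_zero] at this
    exact zero_ne_one this

/-- The transplant `W ∘ z⁻¹` of `W` by an injective holomorphic function `z`. -/
theorem hasDerivAt_comp_invFunOn (hA : IsOpen A) (hz : DifferentiableOn ℂ z A)
    (hinj : InjOn z A) {W : ℂ → ℂ} {ζ : ℂ} (hζ : ζ ∈ A) (hW : DifferentiableAt ℂ W ζ) :
    HasDerivAt (W ∘ Function.invFunOn z A) (deriv W ζ * (deriv z ζ)⁻¹) (z ζ) := by
  refine HasDerivAt.comp (z ζ) ?_
    (hasDerivAt_invFunOn_of_ne_zero hA hz hinj hζ (deriv_ne_zero_of_injOn hA hz hinj hζ))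
  rw [invFunOn_apply hinj hζ]
  exact hW.hasDerivAt

theorem dbar_comp {χ : ℂ → ℝ} {ζ : ℂ} (hχ : DifferentiableAt ℝ χ (z ζ))
    (hz : DifferentiableAt ℂ z ζ) :
    dbar (fun ζ => (χ (z ζ) : ℂ)) ζ = conj (deriv z ζ) * dbar (fun x => (χ x : ℂ)) (z ζ) := by
  have h1 := hχ.hasFDerivAt.comp ζ (hz.hasDerivAt.hasFDerivAt.restrictScalars ℝ)
  have h3 : ∀ v, fderiv ℝ (fun ζ => χ (z ζ)) ζ v = fderiv ℝ χ (z ζ) (v * deriv z ζ) := fun v => by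
    have h2 : fderiv ℝ (fun ζ => χ (z ζ)) ζ = _ := h1.fderiv
    rw [h2]
    simp
  have h4 : DifferentiableAt ℝ (fun ζ => χ (z ζ)) ζ := h1.differentiableAt
  rw [dbar_ofReal h4, dbar_ofReal hχ, h3, h3, fderiv_apply_eq (z ζ) (1 * deriv z ζ),
    fderiv_apply_eq (z ζ) (Complex.I * deriv z ζ)]
  apply Complex.ext
  · simp
  · simp
    ring

/-- Cauchy's theorem, tested with a compactly supported function. -/
theorem integral_im_mul_dbar_eq_zero (hA : IsOpen A) {H : ℂ → ℂ} (hH : DifferentiableOn ℂ H A)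
    {X : ℂ → ℝ} (hX : ContDiffOn ℝ 1 X A) {K : Set ℂ} (hK : IsCompact K) (hKA : K ⊆ A)
    (h0 : ∀ ζ ∈ A, ζ ∉ K → X ζ = 0) :
    ∫ ζ in A, (H ζ * dbar (fun ζ => (X ζ : ℂ)) ζ).im = 0 := by
  have hX' : ContDiffOn ℝ 1 (A.indicator X) A := hX.congr fun ζ hζ => indicator_of_mem hζ X
  have key := integral_fderiv_apply_eq_zero_of_divergence hA hK hKA hX'
    (contDiffOn_I_mul_conj hA hH (n := 1)) (divergence_I_mul_conj hA hH) (Or.inl fun ζ hζ => by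
      by_cases h : ζ ∈ A
      · rw [indicator_of_mem h, h0 ζ h hζ]
      · exact indicator_of_notMem h X)
  rw [← key]
  refine setIntegral_congr_fun hA.measurableSet fun ζ hζ => ?_
  have he : A.indicator X =ᶠ[𝓝 ζ] X := by
    filter_upwards [hA.mem_nhds hζ] with y hy using indicator_of_mem hy X
  rw [he.fderiv_eq, dbar_ofReal ((hX.contDiffAt (hA.mem_nhds hζ)).differentiableAt one_ne_zero),
    fderiv_apply_eq ζ (Complex.I * conj (H ζ))]
  simp
  ring

end injective

/-! ### Transplanting mapped flows to the physical plane -/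

section transplant

variable {ρ : ℝ} {a : ℤ → ℂ} {b c : ℂ} {z W : ℂ → ℂ} {B D : Set ℂ} {χ : ℂ → ℝ}

theorem regularDomain_subset_closed (hρ : 0 ≤ ρ) :
    regularDomain ρ b c ⊆ closedRegularDomain ρ b c := fun _ hζ =>
  ⟨mapDomain_subset_closed hρ hζ.1, hζ.2⟩

theorem mem_regularDomain_or {ζ : ℂ} (hζ : ζ ∈ closedRegularDomain ρ b c) :
    ζ ∈ regularDomain ρ b c ∨ ‖ζ‖ = 1 ∨ 0 < ρ ∧ ‖ζ‖ = ρ := by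
  rcases hζ.1.1.lt_or_eq with h1 | h1
  · by_cases hρ : 0 < ρ
    · rcases hζ.1.2.lt_or_eq with h2 | h2
      · exact Or.inl ⟨⟨h1, fun _ => h2⟩, hζ.2⟩
      · exact Or.inr (Or.inr ⟨hρ, h2.symm⟩)
    · exact Or.inl ⟨⟨h1, fun h => absurd h hρ⟩, hζ.2⟩
  · exact Or.inr (Or.inl h1)

theorem MapsOntoFluid.norm_eq_one (hD : IsClosed D) (hBD : Disjoint B D)
    (h : MapsOntoFluid ρ b c z B D) {ζ : ℂ} (hζ : ζ ∈ closedRegularDomain ρ b c)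
    (hζB : z ζ ∈ B) : ‖ζ‖ = 1 := by
  rcases mem_regularDomain_or hζ with h1 | h1 | ⟨h0, h1⟩
  · have : z ζ ∈ (B ∪ D)ᶜ := h.image_eq ▸ mem_image_of_mem z h1
    exact absurd (Or.inl hζB) this
  · exact h1
  · have : z ζ ∈ frontier D := h.inner_circle h0 ▸ mem_image_of_mem z (by simpa using h1)
    exact absurd (hD.frontier_subset this) (disjoint_left.1 hBD hζB)

theorem MapsOntoFluid.norm_eq_inner (hB : IsClosed B) (hBD : Disjoint B D)
    (h : MapsOntoFluid ρ b c z B D) {ζ : ℂ} (hζ : ζ ∈ closedRegularDomain ρ b c)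
    (hζD : z ζ ∈ D) : 0 < ρ ∧ ‖ζ‖ = ρ := by
  rcases mem_regularDomain_or hζ with h1 | h1 | h1
  · have : z ζ ∈ (B ∪ D)ᶜ := h.image_eq ▸ mem_image_of_mem z h1
    exact absurd (Or.inr hζD) this
  · have : z ζ ∈ frontier B := h.outer_circle ▸ mem_image_of_mem z (by simpa using h1)
    exact absurd hζD (disjoint_left.1 hBD (hB.frontier_subset this))
  · exact h1

/-- Boundary values in the annulus give boundary values in the physical plane, since a Laurent map
is proper; the inverse map need not extend to the boundary. -/
theorem IsLaurentMap.tendsto_comp_invFunOn (hρ : 0 ≤ ρ) (hz : IsLaurentMap ρ a b c z)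
    {q : ℂ → ℝ} (hq : ContinuousOn q (closedRegularDomain ρ b c)) {p : ℂ} {q₀ : ℝ}
    (h : ∀ ζ ∈ closedRegularDomain ρ b c, z ζ = p → q ζ = q₀) :
    Tendsto (fun x => q (Function.invFunOn z (regularDomain ρ b c) x))
      (𝓝[z '' regularDomain ρ b c] p) (𝓝 q₀) := by
  rw [Metric.tendsto_nhds]
  intro ε hε
  set K := closedRegularDomain ρ b c ∩ z ⁻¹' Metric.closedBall p 1
  have hK : IsCompact K := hz.isCompact_preimage hρ (isCompact_closedBall p 1)
  have hK' : IsCompact (K ∩ q ⁻¹' {y | ε ≤ dist y q₀}) :=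
    hK.of_isClosed_subset ((hq.mono inter_subset_left).preimage_isClosed_of_isClosed hK.isClosed
      (isClosed_le continuous_const (continuous_id.dist continuous_const))) inter_subset_left
  have hzK : IsCompact (z '' (K ∩ q ⁻¹' {y | ε ≤ dist y q₀})) :=
    hK'.image_of_continuousOn (hz.continuousOn.mono fun ζ hζ => hζ.1.1)
  have hp : p ∉ z '' (K ∩ q ⁻¹' {y | ε ≤ dist y q₀}) := by
    rintro ⟨ζ, hζ, rfl⟩
    have h1 : ε ≤ dist (q ζ) q₀ := hζ.2
    rw [h ζ hζ.1.1 rfl, dist_self] at h1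
    exact hε.not_ge h1
  filter_upwards [self_mem_nhdsWithin, mem_nhdsWithin_of_mem_nhds
    (hzK.isClosed.isOpen_compl.mem_nhds hp), mem_nhdsWithin_of_mem_nhds
    (Metric.closedBall_mem_nhds p one_pos)] with x hx hx1 hx2
  obtain ⟨ζ, hζ, rfl⟩ := hx
  have hinj : InjOn z (regularDomain ρ b c) := hz.injOn
  rw [invFunOn_apply hinj hζ]
  by_contra hc
  exact hx1 ⟨ζ, ⟨⟨regularDomain_subset_closed hρ hζ, hx2⟩, not_lt.1 hc⟩, rfl⟩

/-- The part of the annulus which is mapped to a neighbourhood of infinity stays away from the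
boundary circles. -/
theorem IsLaurentMap.exists_compact_of_large (hρ : 0 ≤ ρ) (hz : IsLaurentMap ρ a b c z) :
    ∃ K : Set ℂ, IsCompact K ∧ K ⊆ mapDomain ρ ∧ ∃ R, ∀ ζ ∈ regularDomain ρ b c,
      R < ‖z ζ‖ → ζ ∈ K := by
  by_cases hb : b = 0
  · have h : closedRegularDomain ρ b c = closedMapDomain ρ := by
      ext ζ; simp [closedRegularDomain, hb]
    have hzc : ContinuousOn z (closedRegularDomain ρ b c) := hz.continuousOn
    rw [h] at hzc
    obtain ⟨C, hC⟩ := (isCompact_closedMapDomain ρ).exists_bound_of_continuousOn hzc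
    exact ⟨∅, isCompact_empty, empty_subset _, C, fun ζ hζ hR =>
      absurd (hC ζ (mapDomain_subset_closed hρ hζ.1)) hR.not_ge⟩
  · obtain ⟨δ, hδ, hball⟩ := Metric.nhds_basis_closedBall.mem_iff.1
      ((isOpen_mapDomain ρ).mem_nhds hz.pole_mem)
    obtain ⟨C, hC⟩ := ((isCompact_closedMapDomain ρ).inter_right
      (Metric.isOpen_ball (x := c) (ε := δ)).isClosed_compl).exists_bound_of_continuousOn
      (hz.continuousOn.mono fun ζ hζ => ⟨hζ.1, fun _ hc => hζ.2 (by
        rw [hc]; exact Metric.mem_ball_self hδ)⟩)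
    refine ⟨_, isCompact_closedBall c δ, hball, C, fun ζ hζ hR => ?_⟩
    by_contra hc
    exact (hC ζ ⟨mapDomain_subset_closed hρ hζ.1, fun h =>
      hc (Metric.ball_subset_closedBall h)⟩).not_gt hR

theorem hasFDerivWithinAt_of_differentiableOn {A : Set ℂ} (hA : IsOpen A)
    (hz : DifferentiableOn ℂ z A) {ζ : ℂ} (hζ : ζ ∈ A) : HasFDerivWithinAt z
      ((ContinuousLinearMap.toSpanSingleton ℂ (deriv z ζ)).restrictScalars ℝ : ℂ →L[ℝ] ℂ) A ζ :=
  ((hz.differentiableAt (hA.mem_nhds hζ)).hasDerivAt.hasFDerivAt.restrictScalars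
    ℝ).hasFDerivWithinAt

/-- Dirichlet's integral is a conformal invariant. -/
theorem integrableOn_deriv_comp_invFunOn {A : Set ℂ} (hA : IsOpen A)
    (hz : DifferentiableOn ℂ z A) (hinj : InjOn z A) (hW : DifferentiableOn ℂ W A) {S : Set ℂ}
    (hS : IsOpen S) (hSA : S ⊆ A) (hi : IntegrableOn (fun ζ => ‖deriv W ζ‖ ^ 2) S) :
    IntegrableOn (fun x => ‖deriv (W ∘ Function.invFunOn z A) x‖ ^ 2) (z '' S) := by
  rw [integrableOn_image_iff_integrableOn_abs_det_fderiv_smul volume hS.measurableSet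
    (fun ζ hζ => hasFDerivWithinAt_of_differentiableOn hS (hz.mono hSA) hζ) (hinj.mono hSA)]
  refine hi.congr_fun (fun ζ hζ => ?_) hS.measurableSet
  have h0 := norm_ne_zero_iff.2 (deriv_ne_zero_of_injOn hA hz hinj (hSA hζ))
  simp only
  rw [abs_det_toSpanSingleton, (hasDerivAt_comp_invFunOn hA hz hinj (hSA hζ)
    (hW.differentiableAt (hA.mem_nhds (hSA hζ)))).deriv, norm_mul, norm_inv, smul_eq_mul]
  field_simp

/-- The potential of a mapped flow, transplanted to the physical plane.  On the boundary of the body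
the function `Im W + Re z` is constant, so the boundary data are `-Re x`, localised by `χ`. -/
theorem IsMappedPotential.isObstacleFlow_comp_invFunOn (hρ : 0 ≤ ρ)
    (hB : IsClosed B) (hD : IsClosed D) (hBD : Disjoint B D) (hz : IsLaurentMap ρ a b c z)
    (hmap : MapsOntoFluid ρ b c z B D) (hχB : ∀ p ∈ B, χ =ᶠ[𝓝 p] fun _ => 1)
    (hW : IsMappedPotential ρ z Complex.I W) :
    IsObstacleFlow Bᶜ D (fun x => -((χ x : ℂ) * x).re)
      (W ∘ Function.invFunOn z (regularDomain ρ b c)) := by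
  set A := regularDomain ρ b c with hAdef
  have hA : IsOpen A := isOpen_regularDomain ρ b c
  have hzd : DifferentiableOn ℂ z A := hz.differentiableOn hρ
  have hWd : DifferentiableOn ℂ W A := hW.holomorphic.mono fun ζ hζ => hζ.1
  have hinj : InjOn z A := hz.injOn
  have himg : Bᶜ \ D = z '' A := by
    rw [sdiff_eq, ← compl_union]; exact hmap.image_eq.symm
  obtain ⟨ψ, hψc, hψ, ⟨β, hβ⟩, hγ⟩ := hW.no_flux
  have hψc' : ContinuousOn ψ (closedRegularDomain ρ b c) := hψc.mono fun ζ hζ => hζ.1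
  have hψg : ∀ x ∈ z '' A, ψ (Function.invFunOn z A x) =
      ((W ∘ Function.invFunOn z A) x).im := by
    rintro _ ⟨ζ, hζ, rfl⟩
    rw [Function.comp_apply, invFunOn_apply hinj hζ]
    exact hψ ζ hζ.1
  constructor
  · rw [himg]
    rintro _ ⟨ζ, hζ, rfl⟩
    exact (hasDerivAt_comp_invFunOn hA hzd hinj hζ
      (hWd.differentiableAt (hA.mem_nhds hζ))).differentiableAt.differentiableWithinAt
  · refine ⟨β, fun p hp => ?_⟩
    rw [frontier_compl] at hp
    have hpB := hB.frontier_subset hp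
    rw [himg]
    have h1 := hz.tendsto_comp_invFunOn hρ (q := fun ζ => ψ ζ + (z ζ).re) (p := p) (q₀ := β)
      (hψc'.add (Complex.continuous_re.comp_continuousOn hz.continuousOn)) fun ζ hζ hζp => by
        rw [hβ ζ (hmap.norm_eq_one hD hBD hζ (hζp ▸ hpB))]
        simp
    refine h1.congr' ?_
    filter_upwards [self_mem_nhdsWithin, mem_nhdsWithin_of_mem_nhds (hχB p hpB)] with x hx hx1
    rw [← hψg x hx, hx1, Function.invFunOn_eq hx]
    simp [hAdef]
  · obtain ⟨γ, hγ⟩ : ∃ γ, ∀ ζ : ℂ, 0 < ρ → ‖ζ‖ = ρ → ψ ζ = γ := by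
      by_cases h0 : 0 < ρ
      · obtain ⟨γ, hγ⟩ := hγ h0
        exact ⟨γ, fun ζ _ => hγ ζ⟩
      · exact ⟨0, fun ζ h => absurd h h0⟩
    refine ⟨γ, fun p hp => ?_⟩
    rw [himg]
    have h1 := hz.tendsto_comp_invFunOn hρ (p := p) (q₀ := γ) hψc' fun ζ hζ hζp =>
      have h := hmap.norm_eq_inner hB hBD hζ (hζp ▸ hp)
      hγ ζ h.1 h.2
    refine h1.congr' ?_
    filter_upwards [self_mem_nhdsWithin] with x hx using hψg x hx
  · obtain ⟨C, hC⟩ := (isCompact_closedMapDomain ρ).exists_bound_of_continuousOn hψc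
    refine ⟨C, ?_⟩
    rw [himg]
    rintro _ ⟨ζ, hζ, rfl⟩
    rw [← hψg _ (mem_image_of_mem z hζ), invFunOn_apply hinj hζ]
    exact hC ζ (mapDomain_subset_closed hρ hζ.1)
  · obtain ⟨K, hK, hKm, R, hR⟩ := hz.exists_compact_of_large hρ
    have hS : IsOpen (A ∩ z ⁻¹' {x | R < ‖x‖}) :=
      hzd.continuousOn.isOpen_inter_preimage hA (isOpen_lt continuous_const continuous_norm)
    have hi : IntegrableOn (fun ζ => ‖deriv W ζ‖ ^ 2) K := by
      refine ContinuousOn.integrableOn_compact hK ?_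
      exact (((hW.holomorphic.deriv (isOpen_mapDomain ρ)).continuousOn.mono hKm).norm).pow 2
    refine ⟨R + 1, (integrableOn_deriv_comp_invFunOn hA hzd hinj hWd hS inter_subset_left
      (hi.mono_set fun ζ hζ => hR ζ hζ.1 hζ.2)).mono_set ?_⟩
    rw [himg]
    rintro _ ⟨⟨ζ, hζ, rfl⟩, h⟩
    exact ⟨ζ, ⟨hζ, (lt_add_one R).trans_le h⟩, rfl⟩

theorem isCutoff_compl (hχ : ContDiff ℝ 2 χ) (hχc : HasCompactSupport χ)
    (hB : IsClosed B) (hχB : ∀ p ∈ B, χ =ᶠ[𝓝 p] fun _ => 1)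
    (hχD : ∀ p ∈ D, χ =ᶠ[𝓝 p] fun _ => 0) : IsCutoff Bᶜ D χ where
  contDiff := hχ
  bounded := by
    obtain ⟨C, hC⟩ := hχ.continuous.bounded_above_of_compact_support hχc
    exact ⟨C, hC⟩
  compact := by
    refine ⟨tsupport (fderiv ℝ χ), hχc.fderiv (𝕜 := ℝ), fun x hx => ⟨fun h => ?_, fun h => ?_⟩,
      fun x hx => image_eq_zero_of_notMem_tsupport hx⟩
    · refine (notMem_tsupport_iff_eventuallyEq.2 ?_) hx
      filter_upwards [(hχB x h).eventuallyEq_nhds] with y hy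
      rw [hy.fderiv_eq]; simp
    · refine (notMem_tsupport_iff_eventuallyEq.2 ?_) hx
      filter_upwards [(hχD x h).eventuallyEq_nhds] with y hy
      rw [hy.fderiv_eq]; simp
  outer := fun p hp => hχB p (hB.frontier_subset (by rwa [frontier_compl] at hp))
  inner := hχD

/-- Near the outer circle, the map takes values near the body. -/
theorem exists_norm_lt_of_mem {σ : ℝ} (hσ : σ < 1) (hz : ContinuousOn z {ζ | σ ≤ ‖ζ‖ ∧ ‖ζ‖ ≤ 1})
    {N : Set ℂ} (hN : IsOpen N) (h1 : ∀ ζ, ‖ζ‖ = 1 → z ζ ∈ N) :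
    ∃ t < 1, σ ≤ t ∧ ∀ ζ, t < ‖ζ‖ → ‖ζ‖ ≤ 1 → z ζ ∈ N := by
  have hT : IsCompact {ζ : ℂ | σ ≤ ‖ζ‖ ∧ ‖ζ‖ ≤ 1} :=
    (isCompact_closedBall (0 : ℂ) 1).of_isClosed_subset
      ((isClosed_le continuous_const continuous_norm).inter
        (isClosed_le continuous_norm continuous_const)) fun ζ hζ => by simpa using hζ.2
  have hT' : IsCompact ({ζ : ℂ | σ ≤ ‖ζ‖ ∧ ‖ζ‖ ≤ 1} ∩ z ⁻¹' Nᶜ) :=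
    hT.of_isClosed_subset (hz.preimage_isClosed_of_isClosed hT.isClosed hN.isClosed_compl)
      inter_subset_left
  rcases eq_empty_or_nonempty ({ζ : ℂ | σ ≤ ‖ζ‖ ∧ ‖ζ‖ ≤ 1} ∩ z ⁻¹' Nᶜ) with he | hne
  · refine ⟨σ, hσ, le_rfl, fun ζ h2 h3 => ?_⟩
    by_contra h
    exact (he.subset ⟨⟨h2.le, h3⟩, h⟩ : ζ ∈ (∅ : Set ℂ))
  · obtain ⟨ξ, hξ, hmax⟩ := hT'.exists_isMaxOn hne continuous_norm.continuousOn
    refine ⟨‖ξ‖, hξ.1.2.lt_of_ne fun h => hξ.2 (h1 ξ h), hξ.1.1, fun ζ h2 h3 => ?_⟩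
    by_contra h
    exact (hmax ⟨⟨hξ.1.1.trans h2.le, h3⟩, h⟩ : ‖ζ‖ ≤ ‖ξ‖).not_gt h2

/-- The Blasius integral of a transplanted potential in the annulus: the Jacobian
`‖deriv z ζ‖ ^ 2` of `x = z ζ` times the factor `(deriv z ζ)⁻¹` in the derivative of the transplanted
potential is the conjugate of `deriv z ζ`, which is the factor in the `dbar` derivative of `χ ∘ z`. -/
theorem integral_im_dbar_image {A : Set ℂ} (hA : IsOpen A) (hz : DifferentiableOn ℂ z A)
    (hinj : InjOn z A) (hW : DifferentiableOn ℂ W A) (hχ : Differentiable ℝ χ) :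
    ∫ x in z '' A, (deriv (W ∘ Function.invFunOn z A) x * dbar (fun x => (χ x : ℂ) * x) x).im =
      ∫ ζ in A, (z ζ * deriv W ζ * dbar (fun ζ => (χ (z ζ) : ℂ)) ζ).im := by
  rw [integral_image_eq_integral_abs_det_fderiv_smul volume hA.measurableSet
    (fun ζ hζ => hasFDerivWithinAt_of_differentiableOn hA hz hζ) hinj]
  refine setIntegral_congr_fun hA.measurableSet fun ζ hζ => ?_
  have h0 := deriv_ne_zero_of_injOn hA hz hinj hζ
  rw [abs_det_toSpanSingleton, (hasDerivAt_comp_invFunOn hA hz hinj hζ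
    (hW.differentiableAt (hA.mem_nhds hζ))).deriv, dbar_ofReal_mul (hχ _) differentiableAt_fun_id,
    dbar_comp (hχ _) (hz.differentiableAt (hA.mem_nhds hζ)), smul_eq_mul, ← Complex.im_ofReal_mul]
  congr 1
  rw [← Complex.normSq_eq_norm_sq, ← Complex.mul_conj]
  field_simp

theorem continuousOn_dbar_ofReal {A : Set ℂ} (hA : IsOpen A) {X : ℂ → ℝ}
    (hX : ContDiffOn ℝ 1 X A) : ContinuousOn (dbar fun ζ => (X ζ : ℂ)) A := by
  have h1 : ContinuousOn (fderiv ℝ X) A := hX.continuousOn_fderiv_of_isOpen hA le_rfl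
  have h2 : ContinuousOn (fun ζ => ((fderiv ℝ X ζ 1 : ℝ) : ℂ) +
      Complex.I * (fderiv ℝ X ζ Complex.I : ℝ)) A := by fun_prop
  exact h2.congr fun ζ hζ =>
    dbar_ofReal ((hX.contDiffAt (hA.mem_nhds hζ)).differentiableAt one_ne_zero)

/-- The Blasius integral over the fluid region, for data which are localised near the body, is the
residue. -/
theorem integral_im_mul_dbar_comp (hρ : 0 ≤ ρ) (hB : IsClosed B) (hD : IsClosed D)
    (hz : IsLaurentMap ρ a b c z) (hmap : MapsOntoFluid ρ b c z B D) (hχ : ContDiff ℝ 2 χ)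
    (hχc : HasCompactSupport χ) (hχB : ∀ p ∈ B, χ =ᶠ[𝓝 p] fun _ => 1)
    (hχD : ∀ p ∈ D, χ =ᶠ[𝓝 p] fun _ => 0) (hW : DifferentiableOn ℂ W (mapDomain ρ)) {r : ℝ}
    (hr : max ρ ‖c‖ < r) (hr1 : r < 1) :
    ∫ ζ in regularDomain ρ b c, (z ζ * deriv W ζ * dbar (fun ζ => (χ (z ζ) : ℂ)) ζ).im =
      2 * Real.pi * (blasiusResidue z W r).im := by
  set A := regularDomain ρ b c with hAdef
  set σ := max ρ ‖c‖ with hσdef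
  have hσ : 0 ≤ σ := hρ.trans (le_max_left _ _)
  have hA : IsOpen A := isOpen_regularDomain ρ b c
  have hzd : DifferentiableOn ℂ z A := hz.differentiableOn hρ
  have hWd : DifferentiableOn ℂ W A := hW.mono fun ζ hζ => hζ.1
  have hcol : collar σ ⊆ A := collar_subset_regularDomain (le_max_left _ _) (le_max_right _ _)
  have hAball : A ⊆ Metric.ball 0 1 := fun ζ hζ => mem_ball_zero_iff.2 hζ.1.1
  -- the radial cutoff has to be constant where `χ ∘ z` is not known to be `1`
  obtain ⟨t₀, ht₀, hrt₀, hN⟩ := exists_norm_lt_of_mem (z := z) hr1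
    (hz.continuousOn.mono fun ζ hζ => ⟨⟨hζ.2, (le_max_left _ _).trans (hr.le.trans hζ.1)⟩,
      fun _ h => ((le_max_right _ _).trans_lt hr).not_ge (h ▸ hζ.1)⟩)
    (N := {x | χ =ᶠ[𝓝 x] fun _ => 1}) isOpen_setOfPred_eventually_nhds fun ζ hζ =>
      hχB _ (hB.frontier_subset (hmap.outer_circle ▸ mem_image_of_mem z (by simpa using hζ)))
  obtain ⟨s, hs, hs1⟩ := exists_between ht₀
  obtain ⟨t, hst, ht⟩ := exists_between hs1
  have hσs : σ < s := hr.trans (hrt₀.trans_lt hs)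
  have hs0 : 0 < s := hσ.trans_lt hσs
  set K₁ := closedRegularDomain ρ b c ∩ z ⁻¹' tsupport χ ∩ {ζ | ‖ζ‖ ≤ t} with hK₁def
  set K₂ : Set ℂ := {ζ | s ≤ ‖ζ‖ ∧ ‖ζ‖ ≤ t} with hK₂def
  have hK₁ : IsCompact K₁ := (hz.isCompact_preimage hρ hχc).inter_right
    (isClosed_le continuous_norm continuous_const)
  have hK₂ : IsCompact K₂ := (isCompact_closedBall (0 : ℂ) t).of_isClosed_subset
    ((isClosed_le continuous_const continuous_norm).inter
      (isClosed_le continuous_norm continuous_const)) fun ζ hζ => by simpa using hζ.2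
  have hK₁A : K₁ ⊆ A := fun ζ hζ => by
    rcases mem_regularDomain_or hζ.1.1 with h | h | ⟨h0, h⟩
    · exact h
    · have : ‖ζ‖ ≤ t := hζ.2
      linarith
    · have : z ζ ∈ D := hD.frontier_subset
        (hmap.inner_circle h0 ▸ mem_image_of_mem z (by simpa using h))
      exact absurd hζ.1.2 (notMem_tsupport_iff_eventuallyEq.2 (hχD _ this))
  have hK₂A : K₂ ⊆ A := fun ζ hζ => hcol ⟨hσs.trans_le hζ.1, hζ.2.trans_lt ht⟩
  have hoff : ∀ ζ ∈ A, ζ ∉ K₁ → ‖ζ‖ ≤ t ∧ χ =ᶠ[𝓝 (z ζ)] (fun _ => 0) ∨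
      t < ‖ζ‖ ∧ χ =ᶠ[𝓝 (z ζ)] fun _ => 1 := fun ζ hζ h => by
    rcases le_or_gt ‖ζ‖ t with h1 | h1
    · exact Or.inl ⟨h1, notMem_tsupport_iff_eventuallyEq.1 fun h2 =>
        h ⟨⟨regularDomain_subset_closed hρ hζ, h2⟩, h1⟩⟩
    · exact Or.inr ⟨h1, hN ζ (hs.trans (hst.trans h1)) hζ.1.1.le⟩
  have hχd : Differentiable ℝ χ := hχ.differentiable two_ne_zero
  have hzA : ∀ ζ ∈ A, DifferentiableAt ℂ z ζ := fun ζ hζ => hzd.differentiableAt (hA.mem_nhds hζ)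
  have hχz : ContDiffOn ℝ 1 (fun ζ => χ (z ζ)) A :=
    (hχ.of_le one_le_two).comp_contDiffOn (contDiffOn_real hA hzd (n := 1))
  have hrad : ContDiff ℝ 1 (radialCutoff s t) := contDiff_radialCutoff s t (n := 1)
  set H : ℂ → ℂ := fun ζ => z ζ * deriv W ζ with hHdef
  have hH : DifferentiableOn ℂ H A := hzd.mul (hWd.deriv hA)
  set F₁ : ℂ → ℂ := fun ζ => H ζ * dbar (fun ζ => (χ (z ζ) : ℂ)) ζ with hF₁
  set F₂ : ℂ → ℂ := fun ζ => H ζ * dbar (fun ζ => (radialCutoff s t ζ : ℂ)) ζ with hF₂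
  have hi₁ : IntegrableOn F₁ A := by
    refine integrableOn_of_isCompact hA.measurableSet hK₁
      ((hH.continuousOn.mul (continuousOn_dbar_ofReal hA hχz)).mono hK₁A) fun ζ hζ h => ?_
    have : dbar (fun x => (χ x : ℂ)) (z ζ) = 0 := by
      rw [dbar_ofReal (hχd _)]
      rcases hoff ζ hζ h with ⟨-, h⟩ | ⟨-, h⟩ <;> rw [h.fderiv_eq] <;> simp
    simp only [hF₁]
    rw [dbar_comp (hχd _) (hzA ζ hζ), this, mul_zero, mul_zero]
  have hi₂ : IntegrableOn F₂ A := by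
    refine integrableOn_of_isCompact hA.measurableSet hK₂
      ((hH.continuousOn.mul (continuousOn_dbar_ofReal hA hrad.contDiffOn)).mono hK₂A) fun ζ hζ h => ?_
    simp only [hK₂def, mem_ofPred_eq, not_and_or, not_le] at h
    simp only [hF₂]
    rw [dbar_radialCutoff_eq_zero hs0 hst h, mul_zero]
  have h1 := integral_im_mul_dbar_eq_zero hA hH (X := fun ζ => χ (z ζ) - radialCutoff s t ζ)
    (hχz.sub hrad.contDiffOn) (hK₁.union hK₂) (union_subset hK₁A hK₂A) fun ζ hζ h => by
      rw [mem_union, not_or] at h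
      rcases hoff ζ hζ h.1 with ⟨h2, h'⟩ | ⟨h2, h'⟩
      · have h3 : ‖ζ‖ ≤ s := (lt_of_not_ge fun h3 => h.2 ⟨h3, h2⟩).le
        rw [h'.self_of_nhds, radialCutoff_of_le hs0 hst h3, sub_self]
      · rw [h'.self_of_nhds, radialCutoff_of_ge hs0 hst h2.le, sub_self]
  have h2 : ∫ ζ in A, ((F₁ ζ).im - (F₂ ζ).im) = 0 := by
    rw [← h1]
    refine setIntegral_congr_fun hA.measurableSet fun ζ hζ => ?_
    have e1 := (hχz.contDiffAt (hA.mem_nhds hζ)).differentiableAt one_ne_zero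
    have e2 := hrad.differentiable one_ne_zero ζ
    have e3 : DifferentiableAt ℝ (fun ζ => χ (z ζ) - radialCutoff s t ζ) ζ := e1.sub e2
    simp only [hF₁, hF₂]
    rw [dbar_ofReal e1, dbar_ofReal e2, dbar_ofReal e3, fderiv_fun_sub e1 e2,
      ← Complex.sub_im]
    congr 1
    simp only [sub_apply]
    push_cast
    ring
  have hi₁' : IntegrableOn (fun ζ => (F₁ ζ).im) A := Complex.imCLM.integrable_comp hi₁
  have hi₂' : IntegrableOn (fun ζ => (F₂ ζ).im) A := Complex.imCLM.integrable_comp hi₂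
  rw [integral_sub hi₁' hi₂', sub_eq_zero] at h2
  have hzc := hzd.mono hcol
  have hWc := hWd.mono hcol
  rw [blasiusResidue_eq hσ hzc hWc hr hr1 hσs hs1, ← integral_im_dbar_radial hσ hσs hst ht hzc hWc
    hA hAball hcol]
  refine Eq.trans h2 (setIntegral_congr_fun hA.measurableSet fun ζ hζ => ?_)
  simp only [hF₂, hHdef]
  rw [dbar_radialCutoff_mul hσ hσs hst hzc hζ.1.1]
  ring_nf

end transplant

/-- The same localised boundary data `χ x * x` serve for both flows, since both take place outside the
same body. -/
theorem blasius_le_of_same_body {ρ : ℝ} {a a₀ : ℤ → ℂ} {b c b₀ c₀ : ℂ} {z z₀ W W₀ : ℂ → ℂ}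
    {B D : Set ℂ} (hρ : 0 ≤ ρ) (hρ1 : ρ < 1) (hB : IsCompact B) (hD : IsClosed D)
    (hBD : Disjoint B D) (hz : IsLaurentMap ρ a b c z) (hmap : MapsOntoFluid ρ b c z B D)
    (hz₀ : IsLaurentMap 0 a₀ b₀ c₀ z₀) (hmap₀ : MapsOntoFluid 0 b₀ c₀ z₀ B ∅)
    (hW : IsMappedPotential ρ z Complex.I W) (hW₀ : IsMappedPotential 0 z₀ Complex.I W₀) :
    ∃ Ca Ca₀ : ℝ, HasBlasiusAddedMass (volume.real B) z W Ca ∧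
      HasBlasiusAddedMass (volume.real B) z₀ W₀ Ca₀ ∧ Ca₀ ≤ Ca := by
  obtain ⟨χ, hχ, hχc, hχB, hχD⟩ := exists_bodyCutoff hB hD hBD
  have hU₀ : IsOpen Bᶜ := hB.isClosed.isOpen_compl
  -- the coefficient is an integral over the fluid region, in which only the potential depends on
  -- the conformal map
  have coeff : ∀ {ρ : ℝ} {a : ℤ → ℂ} {b c : ℂ} {z W : ℂ → ℂ} {D : Set ℂ}, 0 ≤ ρ → ρ < 1 →
      IsClosed D → IsLaurentMap ρ a b c z → MapsOntoFluid ρ b c z B D →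
      (∀ p ∈ D, χ =ᶠ[𝓝 p] fun _ => 0) → IsMappedPotential ρ z Complex.I W →
      HasBlasiusAddedMass (volume.real B) z W (-(1 / volume.real B) * (∫ x in Bᶜ \ D,
        (deriv (W ∘ Function.invFunOn z (regularDomain ρ b c)) x *
          dbar (fun x => (χ x : ℂ) * x) x).im) - 1) := by
    intro ρ a b c z W D hρ hρ1 hD hz hmap hχD hW
    have hσ1 : max ρ ‖c‖ < 1 := max_lt hρ1 hz.pole_mem.1
    obtain ⟨r, hr, hr1⟩ := exists_between hσ1
    have hcol : collar (max ρ ‖c‖) ⊆ regularDomain ρ b c :=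
      collar_subset_regularDomain (le_max_left _ _) (le_max_right _ _)
    have hzd := hz.differentiableOn hρ
    have hWd : DifferentiableOn ℂ W (regularDomain ρ b c) :=
      hW.holomorphic.mono fun ζ hζ => hζ.1
    have himg : Bᶜ \ D = z '' regularDomain ρ b c := by
      rw [sdiff_eq, ← compl_union]; exact hmap.image_eq.symm
    rw [himg, integral_im_dbar_image (isOpen_regularDomain ρ b c) hzd hz.injOn hWd
      (hχ.differentiable two_ne_zero), integral_im_mul_dbar_comp hρ hB.isClosed hD hz hmap hχ
      hχc hχB hχD hW.holomorphic hr hr1]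
    have := hasBlasiusAddedMass (hρ.trans (le_max_left ρ ‖c‖)) (hzd.mono hcol) (hWd.mono hcol)
      hr hr1 (volume.real B)
    convert this using 1
    ring
  refine ⟨_, _, coeff hρ hρ1 hD hz hmap hχD hW,
    coeff le_rfl one_pos isClosed_empty hz₀ hmap₀ (by simp) hW₀, ?_⟩
  have hflow := hW.isObstacleFlow_comp_invFunOn hρ hB.isClosed hD hBD hz hmap hχB
  have hflow₀ := hW₀.isObstacleFlow_comp_invFunOn le_rfl hB.isClosed isClosed_empty
    (disjoint_empty B) hz₀ hmap₀ hχB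
  have hM : ContDiff ℝ 2 fun x : ℂ => (χ x : ℂ) * x :=
    (Complex.ofRealCLM.contDiff.comp hχ).mul contDiff_id
  have hMc : HasCompactSupport fun x : ℂ => (χ x : ℂ) * x :=
    (hχc.comp_left (g := fun y : ℝ => (y : ℂ)) Complex.ofReal_zero).mul_right
  have hre : ContDiff ℝ 2 fun x : ℂ => -((χ x : ℂ) * x).re := (Complex.reCLM.contDiff.comp hM).neg
  have hrec : HasCompactSupport fun x : ℂ => -((χ x : ℂ) * x).re :=
    hMc.comp_left (g := fun y : ℂ => -y.re) (by simp)
  have him : ContDiff ℝ 2 fun x : ℂ => ((χ x : ℂ) * x).im := Complex.imCLM.contDiff.comp hM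
  have himc : HasCompactSupport fun x : ℂ => ((χ x : ℂ) * x).im :=
    hMc.comp_left (g := fun y : ℂ => y.im) (by simp)
  have hdata : IsBoundaryData Bᶜ D fun x => -((χ x : ℂ) * x).re := by
    refine ⟨(hre.of_le one_le_two).contDiffOn,
      (integrable_norm_fderiv_sq (hre.of_le one_le_two) hrec).integrableOn, ?_, fun p hp => ?_⟩
    · obtain ⟨C, hC⟩ := hre.continuous.bounded_above_of_compact_support hrec
      exact ⟨C, fun x _ => hC x⟩
    · filter_upwards [hχD p hp] with x hx
      simp [hx]
  have key := hflow.integral_im_dbar_le hU₀ hD (subset_compl_iff_disjoint_left.2 hBD)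
    hM.contDiffOn hflow₀ hdata
    (integrable_norm_fderiv_sq (him.of_le one_le_two) himc).integrableOn
    (isCutoff_compl hχ hχc hB.isClosed hχB hχD)
  have h2 : 0 ≤ 1 / volume.real B := by positivity
  have h3 := mul_le_mul_of_nonneg_left key h2
  rw [sdiff_empty]
  linarith

end

theorem mainTheorem2 :
    -- kinetic energy formulation, arbitrary stationary obstacles
    (∀ (ϱ : ℝ) (B : Set ℂ) (n : ℕ) (D : Fin n → Set ℂ) (V : ℂ) (W W₀ : ℂ → ℂ),
      0 < ϱ → IsCompact B → IsConnected B → 0 < volume B →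
      (∀ i, IsClosed (D i)) → (∀ i, IsConnected (D i)) → (∀ i, Disjoint B (D i)) →
      Pairwise (fun i j => Disjoint (D i) (D j)) → V ≠ 0 →
      IsPotentialFlow B D V W → IsPotentialFlow B (![] : Fin 0 → Set ℂ) V W₀ →
      addedMassCoeff ϱ B (![] : Fin 0 → Set ℂ) V W₀ ≤ addedMassCoeff ϱ B D V W) ∧
    -- Blasius formulation: the body `B` with the stationary boundary `D`, and `B` alone
    (∀ (B D : Set ℂ) (ρ : ℝ) (a a₀ : ℤ → ℂ) (b c b₀ c₀ : ℂ) (z z₀ W W₀ : ℂ → ℂ),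
      0 < ρ → ρ < 1 → IsCompact B → 0 < volume B → IsClosed D → Disjoint B D →
      IsLaurentMap ρ a b c z → MapsOntoFluid ρ b c z B D →
      IsLaurentMap 0 a₀ b₀ c₀ z₀ → MapsOntoFluid 0 b₀ c₀ z₀ B ∅ →
      IsMappedPotential ρ z Complex.I W → IsMappedPotential 0 z₀ Complex.I W₀ →
      ∃ Ca Ca₀ : ℝ, HasBlasiusAddedMass (volume.real B) z W Ca ∧
        HasBlasiusAddedMass (volume.real B) z₀ W₀ Ca₀ ∧ Ca₀ ≤ Ca) ∧
    -- Blasius formulation: `Ca(ρ)` against its value at `ρ = 0` for the same map coefficients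
    (∀ (A ρ : ℝ) (a : ℤ → ℂ) (b c : ℂ) (z W W₀ : ℂ → ℂ),
      0 < A → 0 < ρ → ρ < 1 → IsLaurentMap ρ a b c z →
      IsMappedPotential ρ z Complex.I W → IsMappedPotential 0 z Complex.I W₀ →
      ∃ Ca Ca₀ : ℝ, HasBlasiusAddedMass A z W Ca ∧
        HasBlasiusAddedMass A z W₀ Ca₀ ∧ Ca₀ ≤ Ca) := by
  refine ⟨?_, ?_, fun A ρ a b c z W W₀ hA hρ hρ1 hz hW hW₀ =>
    blasius_le_of_fixed_coefficients hA hρ hρ1 hz hW hW₀⟩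
  · intro ϱ B n D V W W₀ hϱ hB _ _ hD _ hBD hDD _ hW hW₀
    exact addedMassCoeff_le hB hD hBD hDD hW hW₀ hϱ.le
  · intro B D ρ a a₀ b c b₀ c₀ z z₀ W W₀ hρ hρ1 hB _ hD hBD hz hmap hz₀ hmap₀ hW hW₀
    exact blasius_le_of_same_body hρ.le hρ1 hB hD hBD hz hmap hz₀ hmap₀ hW hW₀
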